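/- Let $n>1$, let $Q=(Q_1,Q_2):\mathbb{R}^2\to\mathbb{R}^2$ be a map whose components are homogeneous polynomials of degree $n$, and suppose that $Q$ is contracting, i.e. $\langle X,Q(X)\rangle<0$ for all $X\in\mathbb{R}^2$ with $\|X\|=1$. Let $\lambda>0$ and suppose that the differential equation $$\dot X=\lambda X+Q(X),\qquad X\in\mathbb{R}^2,$$ has finitely many equilibria. An equilibrium is *hyperbolic* if no eigenvalue of the linearization there has zero real part. A *sink* is an asymptotically stable equilibrium; a *saddle* is an equilibrium near which the phase portrait is topologically equivalent to that of $\dot x=x,\ \dot y=-y$ at the origin (so it need not be hyperbolic); a *saddle-node* is an equilibrium near which the phase portrait is topologically equivalent to that of $\dot x=x^2,\ \dot y=-y$ or $\dot x=x^2,\ \dot y=y$ at the origin. A *policycle* is a topological circle that is a union of finitely many equilibria and of trajectories connecting them. If there are equilibria other than the origin, then there is exactly one policycle in $\mathbb{R}^2\setminus\{0\}$, and it contains all of them; it is called *the policycle* below. (If there are none, there is no policycle in $\mathbb{R}^2\setminus\{0\}$ and all assertions below are empty or concern the number $0$.) Moreover: (a) if all the equilibria are hyperbolic, then the number of equilibria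 other than the origin is a multiple of $4$, each of them is a sink or a saddle, and sinks and saddles alternate along the policycle; (b) in general every equilibrium other than the origin is a sink, a saddle (each possibly non-hyperbolic) or a saddle-node; (c) in general the equilibria that are sinks and the equilibria that are saddles appear at alternating positions in the policycle (saddle-nodes being disregarded): each of the two open arcs of the policycle bounded by two distinct sinks contains a saddle, each of the two open arcs bounded by two distinct saddles contains a sink, and the complement in the policycle of a single sink (saddle) contains a saddle (sink). -/

import Mathlib

open Set Filter Topology

noncomputable section

/-- The Euclidean plane. -/
abbrev Plane : Type := EuclideanSpace ℝ (Fin 2)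

/-- The polynomial map of the plane with components `Q 0`, `Q 1`. -/
def polyMap (Q : Fin 2 → MvPolynomial (Fin 2) ℝ) (X : Plane) : Plane :=
  WithLp.toLp 2 fun i => MvPolynomial.eval (fun j => X j) (Q i)

/-- `Q` is contracting: `⟨X, Q(X)⟩ < 0` for every unit vector `X`. -/
def IsContracting (Q : Fin 2 → MvPolynomial (Fin 2) ℝ) : Prop :=
  ∀ X : Plane, ‖X‖ = 1 → inner ℝ X (polyMap Q X) < 0

/-- The planar vector field `X ↦ lam X + Q(X)`. -/
def starField (lam : ℝ) (Q : Fin 2 → MvPolynomial (Fin 2) ℝ) (X : Plane) : Plane :=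
  lam • X + polyMap Q X

/-- The set of equilibria of the autonomous equation `X' = F(X)`. -/
def equilibria (F : Plane → Plane) : Set Plane := {p | F p = 0}

/-- `γ` solves `X' = F(X)` on the set of times `s`. -/
def IsTrajectoryOn (F : Plane → Plane) (γ : ℝ → Plane) (s : Set ℝ) : Prop :=
  IsIntegralCurveOn γ (fun _ => F) s

/-- `p` is a hyperbolic equilibrium: no eigenvalue (complex root of the characteristic polynomial)
of the linearization of `F` at `p` has zero real part. -/
def IsHyperbolicEquilibrium (F : Plane → Plane) (p : Plane) : Prop :=
  F p = 0 ∧ ∀ z : ℂ,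
    ((fderiv ℝ F p).toLinearMap.charpoly.map (algebraMap ℝ ℂ)).IsRoot z → z.re ≠ 0

/-- `p` is a sink, i.e. an asymptotically stable equilibrium: trajectories that start close enough
to `p` exist for all `t ≥ 0`, remain in a prescribed neighbourhood of `p`, and tend to `p`. -/
def IsSink (F : Plane → Plane) (p : Plane) : Prop :=
  F p = 0 ∧ ∀ U ∈ 𝓝 p, ∃ V ∈ 𝓝 p, ∀ x ∈ V, ∃ γ : ℝ → Plane,
    IsTrajectoryOn F γ (Ici 0) ∧ γ 0 = x ∧ (∀ t, 0 ≤ t → γ t ∈ U) ∧ Tendsto γ atTop (𝓝 p)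

/-- The point `y` lies on the forward trajectory of `x`, and the trajectory from `x` to `y` stays
in `U`. For a fixed `U` this relation records the trajectories of `F` inside `U` and their
orientation. -/
def FlowsTo (F : Plane → Plane) (U : Set Plane) (x y : Plane) : Prop :=
  ∃ T : ℝ, 0 ≤ T ∧ ∃ γ : ℝ → Plane,
    IsTrajectoryOn F γ (Icc 0 T) ∧ (∀ t ∈ Icc 0 T, γ t ∈ U) ∧ γ 0 = x ∧ γ T = y

/-- Local topological (orbital) equivalence of `F` at `p` with `G` at `q`: a homeomorphism from an
open neighbourhood of `p` onto an open neighbourhood of `q` that takes `p` to `q` and, in both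
directions, takes trajectories to trajectories and preserves the orientation of time. -/
def LocallyTopEquivalent (F : Plane → Plane) (p : Plane) (G : Plane → Plane) (q : Plane) : Prop :=
  ∃ Φ : OpenPartialHomeomorph Plane Plane, p ∈ Φ.source ∧ Φ p = q ∧
    ∀ x ∈ Φ.source, ∀ y ∈ Φ.source,
      (FlowsTo F Φ.source x y ↔ FlowsTo G Φ.target (Φ x) (Φ y))

/-- `p` is a (topological, possibly non-hyperbolic) saddle: near `p` the phase portrait is that of
`x' = x`, `y' = -y` at the origin (four hyperbolic sectors). -/
def IsSaddle (F : Plane → Plane) (p : Plane) : Prop :=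
  F p = 0 ∧ LocallyTopEquivalent F p (fun X => !₂[X 0, -X 1]) 0

/-- `p` is a saddle-node: near `p` the phase portrait is that of `x' = x ^ 2`, `y' = -y` or of
`x' = x ^ 2`, `y' = y` at the origin (two hyperbolic sectors and one parabolic sector, which is
attracting in the first case and repelling in the second). -/
def IsSaddleNode (F : Plane → Plane) (p : Plane) : Prop :=
  F p = 0 ∧ (LocallyTopEquivalent F p (fun X => !₂[X 0 ^ 2, -X 1]) 0 ∨
    LocallyTopEquivalent F p (fun X => !₂[X 0 ^ 2, X 1]) 0)

/-- A policycle: a topological circle that is the union of finitely many equilibria and of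
trajectories connecting them. -/
def IsPolicycle (F : Plane → Plane) (S : Set Plane) : Prop :=
  Nonempty (S ≃ₜ Circle) ∧ (S ∩ equilibria F).Finite ∧
    ∀ x ∈ S, ∃ γ : ℝ → Plane, IsTrajectoryOn F γ univ ∧ γ 0 = x ∧ (∀ t, γ t ∈ S) ∧
      ∃ p ∈ S ∩ equilibria F, ∃ q ∈ S ∩ equilibria F,
        Tendsto γ atBot (𝓝 p) ∧ Tendsto γ atTop (𝓝 q)

/-- The points of `A` and the points of `B` occur at alternating positions on the topological
circle `S`: between any two points of `A` (on each of the two open arcs that they bound; for a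
single point, on its complement) there is a point of `B`, and vice versa. -/
def AlternateOn (S A B : Set Plane) : Prop :=
  (∀ a ∈ A ∩ S, ∀ a' ∈ A ∩ S, ∀ x ∈ S \ {a, a'},
      (connectedComponentIn (S \ {a, a'}) x ∩ B).Nonempty) ∧
  (∀ b ∈ B ∩ S, ∀ b' ∈ B ∩ S, ∀ x ∈ S \ {b, b'},
      (connectedComponentIn (S \ {b, b'}) x ∩ A).Nonempty)

end

/-! Write `N = n - 1` and use polar coordinates with `s = r ^ N`. Homogeneity turns the equation
into `θ' = s B(θ)`, `s' = N s (lam + s A(θ))`, where `A` and `B` are the radial and angular parts of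
`Q` on the unit circle. Contraction means `A < 0`, so dividing by the positive factor `N s (-A)`
only changes time. What remains is the skew product `θ' = h(θ)`, `s' = m(θ) - s` with `h = B / (N
(-A))` and `m = lam / (-A)` (`StarField.exists_polarModel`).

The second equation is linear in `s`. It has a single bounded solution over each orbit of `h`, which
defines the graph `sstar`, and the height `v = s - sstar(θ)` satisfies `v' = -v`. In the coordinates
`(θ, v)` the system is therefore a scalar equation on the circle times a linear contraction. The
graph `v = 0` is an invariant circle carrying all equilibria other than the origin, which correspond
to the zeros of `h`. A policycle avoiding the origin is compact and invariant, so `v` is bounded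
along its whole past and must vanish (`subset_cycle`); a topological circle inside a circle is all
of it (`eq_cycle_of_subset`).

The zeros of `h` are isolated, so the type of an equilibrium is read off the signs of `h` on its two
sides: from plus to minus a sink, from minus to plus a saddle, no change a saddle-node
(`classification`). The local equivalences conjugate the scalar equation to a normal form through
its time function, a primitive of `1 / h`. Conversely, a sink or a saddle forces its sign pattern
(`signs_of_isSink`, `signs_of_isSaddle`), and alternation becomes the intermediate value theorem for
`h`.

For the count, contraction forces `n` to be odd, so `h` has period `π`. At a hyperbolic equilibrium
`B' ≠ 0`, since otherwise the linearization has a kernel (`deriv_angularPart_ne_zero`); hence every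
zero is a change of sign. A half turn then contains an even number of zeros, and the full circle a
multiple of four (`four_dvd_ncard`). -/

noncomputable section

/-! ### Uniqueness for autonomous equations -/

section AutonomousUniqueness

variable {E : Type*} [NormedAddCommGroup E] [NormedSpace ℝ E]

/-- The field is only locally Lipschitz, but both solutions live in the union of their images, which
is compact and hence carries one Lipschitz constant. -/
theorem autonomous_unique_right {F : E → E} (hF : LocallyLipschitz F) {x y : ℝ → E} {a b : ℝ}
    (hx : ∀ t ∈ Icc a b, HasDerivWithinAt x (F (x t)) (Icc a b) t)
    (hy : ∀ t ∈ Icc a b, HasDerivWithinAt y (F (y t)) (Icc a b) t) (h0 : x a = y a) :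
    EqOn x y (Icc a b) := by
  have cx : ContinuousOn x (Icc a b) := fun t ht => (hx t ht).continuousWithinAt
  have cy : ContinuousOn y (Icc a b) := fun t ht => (hy t ht).continuousWithinAt
  have hK : IsCompact (x '' Icc a b ∪ y '' Icc a b) :=
    (isCompact_Icc.image_of_continuousOn cx).union (isCompact_Icc.image_of_continuousOn cy)
  obtain ⟨K, hL⟩ := (hF.locallyLipschitzOn
    (s := x '' Icc a b ∪ y '' Icc a b)).exists_lipschitzOnWith_of_compact hK
  refine ODE_solution_unique_of_mem_Icc_right (v := fun _ => F)
    (s := fun _ => x '' Icc a b ∪ y '' Icc a b) (fun _ _ => hL) cx ?_ ?_ cy ?_ ?_ h0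
  · exact fun t ht => (hx t (Ico_subset_Icc_self ht)).mono_of_mem_nhdsWithin
      (Icc_mem_nhdsGE_of_mem ht)
  · exact fun t ht => Or.inl (mem_image_of_mem x (Ico_subset_Icc_self ht))
  · exact fun t ht => (hy t (Ico_subset_Icc_self ht)).mono_of_mem_nhdsWithin
      (Icc_mem_nhdsGE_of_mem ht)
  · exact fun t ht => Or.inr (mem_image_of_mem y (Ico_subset_Icc_self ht))

theorem autonomous_unique_left {F : E → E} (hF : LocallyLipschitz F) {x y : ℝ → E} {a b : ℝ}
    (hx : ∀ t ∈ Icc a b, HasDerivWithinAt x (F (x t)) (Icc a b) t)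
    (hy : ∀ t ∈ Icc a b, HasDerivWithinAt y (F (y t)) (Icc a b) t) (h0 : x b = y b) :
    EqOn x y (Icc a b) := by
  have cx : ContinuousOn x (Icc a b) := fun t ht => (hx t ht).continuousWithinAt
  have cy : ContinuousOn y (Icc a b) := fun t ht => (hy t ht).continuousWithinAt
  have hK : IsCompact (x '' Icc a b ∪ y '' Icc a b) :=
    (isCompact_Icc.image_of_continuousOn cx).union (isCompact_Icc.image_of_continuousOn cy)
  obtain ⟨K, hL⟩ := (hF.locallyLipschitzOn
    (s := x '' Icc a b ∪ y '' Icc a b)).exists_lipschitzOnWith_of_compact hK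
  refine ODE_solution_unique_of_mem_Icc_left (v := fun _ => F)
    (s := fun _ => x '' Icc a b ∪ y '' Icc a b) (fun _ _ => hL) cx ?_ ?_ cy ?_ ?_ h0
  · exact fun t ht => (hx t (Ioc_subset_Icc_self ht)).mono_of_mem_nhdsWithin
      (Icc_mem_nhdsLE_of_mem ht)
  · exact fun t ht => Or.inl (mem_image_of_mem x (Ioc_subset_Icc_self ht))
  · exact fun t ht => (hy t (Ioc_subset_Icc_self ht)).mono_of_mem_nhdsWithin
      (Icc_mem_nhdsLE_of_mem ht)
  · exact fun t ht => Or.inr (mem_image_of_mem y (Ioc_subset_Icc_self ht))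

/-- A solution that meets a zero of the vector field is constant. -/
theorem autonomous_eq_const {F : E → E} (hF : LocallyLipschitz F) {x : ℝ → E} {a b c : ℝ}
    (hx : ∀ t ∈ Icc a b, HasDerivWithinAt x (F (x t)) (Icc a b) t) (hc : c ∈ Icc a b)
    (h0 : F (x c) = 0) : ∀ t ∈ Icc a b, x t = x c := by
  have hconst : ∀ (s : Set ℝ) (t : ℝ), HasDerivWithinAt (fun _ : ℝ => x c) (F (x c)) s t := by
    intro s t
    rw [h0]
    exact hasDerivWithinAt_const t s (x c)
  intro t ht
  rcases le_total t c with h | h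
  · have hs : Icc a c ⊆ Icc a b := Icc_subset_Icc_right hc.2
    exact autonomous_unique_left hF (x := x) (y := fun _ => x c)
      (fun t ht => (hx t (hs ht)).mono hs) (fun t _ => hconst _ t) rfl ⟨ht.1, h⟩
  · have hs : Icc c b ⊆ Icc a b := Icc_subset_Icc_left hc.1
    exact autonomous_unique_right hF (x := x) (y := fun _ => x c)
      (fun t ht => (hx t (hs ht)).mono hs) (fun t _ => hconst _ t) rfl ⟨h, ht.2⟩

end AutonomousUniqueness

/-! ### Global flows and changes of time -/

/-- A bounded Lipschitz vector field on the line has a global flow. -/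
theorem exists_global_flow {h : ℝ → ℝ} {K : NNReal} (hK : LipschitzWith K h) {M : ℝ}
    (hM : ∀ x, |h x| ≤ M) :
    ∃ Θ : ℝ → ℝ → ℝ, (∀ a, Θ a 0 = a) ∧ ∀ a t, HasDerivAt (Θ a) (h (Θ a t)) t := by
  have hM0 : 0 ≤ M := (abs_nonneg _).trans (hM 0)
  have key : ∀ a : ℝ, ∀ n : ℕ, ∃ x : ℝ → ℝ, x 0 = a ∧
      ∀ t ∈ Icc (-(n : ℝ)) n, HasDerivWithinAt x (h (x t)) (Icc (-(n : ℝ)) n) t := by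
    intro a n
    have hn : (0 : ℝ) ∈ Icc (-(n : ℝ)) n := ⟨by simp, by simp⟩
    -- A solution of speed at most `M` moves at most `M * n` in time `n`, so a ball of that radius
    -- suffices.
    have : IsPicardLindelof (fun _ : ℝ => h) (tmin := -(n : ℝ)) (tmax := n) ⟨0, hn⟩ a
        (⟨M, hM0⟩ * n) 0 ⟨M, hM0⟩ K := by
      refine IsPicardLindelof.of_time_independent (fun x _ => ?_) hK.lipschitzOnWith ?_
      · exact hM x
      · simp only [sub_neg_eq_add, sub_zero, zero_add, max_self]
        simp
        exact le_rfl
    exact this.exists_eq_forall_mem_Icc_hasDerivWithinAt₀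
  choose x hx0 hx using key
  have hcons : ∀ a (n k : ℕ), n ≤ k → ∀ t ∈ Icc (-(n : ℝ)) n, x a n t = x a k t := by
    intro a n k hnk
    have hnk' : (n : ℝ) ≤ k := by exact_mod_cast hnk
    have hL : LocallyLipschitz h := hK.locallyLipschitz
    have e1 : EqOn (x a n) (x a k) (Icc 0 (n : ℝ)) :=
      autonomous_unique_right hL
        (fun t ht => (hx a n t ⟨by linarith [ht.1, ht.2], ht.2⟩).mono
          (Icc_subset_Icc_left (by simp)))
        (fun t ht => (hx a k t ⟨by linarith [ht.1, ht.2], by linarith [ht.2]⟩).mono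
          (Icc_subset_Icc (by simp) hnk')) (by rw [hx0, hx0])
    have e2 : EqOn (x a n) (x a k) (Icc (-(n : ℝ)) 0) :=
      autonomous_unique_left hL
        (fun t ht => (hx a n t ⟨ht.1, by linarith [ht.1, ht.2]⟩).mono
          (Icc_subset_Icc_right (by simp)))
        (fun t ht => (hx a k t ⟨by linarith [ht.1], by linarith [ht.1, ht.2]⟩).mono
          (Icc_subset_Icc (by linarith) (by simp))) (by rw [hx0, hx0])
    intro t ht
    rcases le_total 0 t with h0 | h0
    · exact e1 ⟨h0, ht.2⟩
    · exact e2 ⟨ht.1, h0⟩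
  -- The extra `1` puts `t` in the interior of the interval used, so that the derivative there is
  -- two-sided.
  refine ⟨fun a t => x a (⌈|t|⌉₊ + 1) t, fun a => hx0 a _, fun a t => ?_⟩
  set n := ⌈|t|⌉₊ + 1 with hn
  have htn : |t| < n := by
    rw [hn]; push_cast
    linarith [Nat.le_ceil |t|]
  obtain ⟨h1, h2⟩ := abs_lt.1 htn
  have hd : HasDerivAt (x a n) (h (x a n t)) t :=
    (hx a n t ⟨h1.le, h2.le⟩).hasDerivAt (Icc_mem_nhds h1 h2)
  refine hd.congr_of_eventuallyEq ?_
  filter_upwards [isOpen_Ioo.mem_nhds (show t ∈ Ioo (-(n : ℝ)) n from ⟨h1, h2⟩)] with s hs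
  have hsn : |s| ≤ (⌈|s|⌉₊ + 1 : ℕ) := by
    push_cast
    linarith [Nat.le_ceil |s|]
  have hs' := abs_le.1 hsn
  rcases le_total (⌈|s|⌉₊ + 1) n with h | h
  · exact hcons a _ _ h s hs'
  · exact (hcons a _ _ h s ⟨hs.1.le, hs.2.le⟩).symm

/-- Change of time along a curve tangent to a positive multiple of a vector field. -/
theorem exists_time_change {k : ℝ → ℝ} (hk : Continuous k) {c : ℝ} (hc : 0 < c)
    (hck : ∀ t, c ≤ k t) :
    ∃ T : ℝ ≃o ℝ, T 0 = 0 ∧ (∀ t, HasDerivAt T (k t) t) ∧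
      ∀ t, HasDerivAt T.symm (k (T.symm t))⁻¹ t := by
  let f : ℝ → ℝ := fun t => ∫ u in (0 : ℝ)..t, k u
  have hf : ∀ t, HasDerivAt f (k t) t := fun t => hk.integral_hasStrictDerivAt 0 t |>.hasDerivAt
  have hdiff : Differentiable ℝ f := fun t => (hf t).differentiableAt
  -- The lower bound on the speed makes the new time strictly increasing and unbounded in both
  -- directions, hence a bijection of the line.
  have hlow : ∀ s t, s ≤ t → c * (t - s) ≤ f t - f s := by
    intro s t hst
    exact Convex.mul_sub_le_image_sub_of_le_deriv convex_univ hdiff.continuous.continuousOn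
      hdiff.differentiableOn (fun x _ => by rw [(hf x).deriv]; exact hck x) s trivial t trivial hst
  have hmono : StrictMono f := by
    intro s t hst
    have := hlow s t hst.le
    nlinarith [mul_pos hc (sub_pos.2 hst)]
  have hf0 : f 0 = 0 := by simp [f]
  have htop : Tendsto f atTop atTop := by
    refine tendsto_atTop_mono' atTop ?_ (tendsto_id.const_mul_atTop hc)
    filter_upwards [eventually_ge_atTop 0] with t ht
    have := hlow 0 t ht
    simp only [hf0, sub_zero] at this
    exact this
  have hbot : Tendsto f atBot atBot := by
    refine tendsto_atBot_mono' atBot ?_ (tendsto_id.const_mul_atBot hc)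
    filter_upwards [eventually_le_atBot 0] with t ht
    have := hlow t 0 ht
    simp only [hf0, zero_sub] at this
    show f t ≤ c * t
    linarith
  have hsurj : Function.Surjective f := hdiff.continuous.surjective htop hbot
  let T : ℝ ≃o ℝ := hmono.orderIsoOfSurjective f hsurj
  refine ⟨T, hf0, hf, fun t => ?_⟩
  have h1 : HasDerivAt T (k (T.symm t)) (T.symm t) := hf _
  exact h1.of_local_left_inverse T.symm.continuous.continuousAt
    (hc.trans_le (hck _)).ne' (Eventually.of_forall fun y => T.apply_symm_apply y)

/-! ### Dynamics of a scalar equation -/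

section LineFlow

/-- Losing the sign would mean meeting a zero of `h`, and by uniqueness such a solution is constant.
-/
theorem line_flow_pos {h : ℝ → ℝ} (hL : LocallyLipschitz h) {x : ℝ → ℝ}
    (hx : ∀ t, HasDerivAt x (h (x t)) t) (h0 : 0 < h (x 0)) (t : ℝ) : 0 < h (x t) := by
  have hc : Continuous fun t => h (x t) :=
    hL.continuous.comp (continuous_iff_continuousAt.2 fun t => (hx t).continuousAt)
  by_contra hneg
  push Not at hneg
  obtain ⟨c, hc0⟩ : ∃ c, h (x c) = 0 :=
    mem_range_of_exists_le_of_exists_ge hc ⟨t, hneg⟩ ⟨0, h0.le⟩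
  have := autonomous_eq_const (a := min c 0) (b := max c 0) hL
    (fun t _ => (hx t).hasDerivWithinAt) ⟨min_le_left _ _, le_max_left _ _⟩ hc0 0
    ⟨min_le_right _ _, le_max_right _ _⟩
  rw [this, hc0] at h0
  exact lt_irrefl _ h0

theorem line_flow_strictMono {h : ℝ → ℝ} (hL : LocallyLipschitz h) {x : ℝ → ℝ}
    (hx : ∀ t, HasDerivAt x (h (x t)) t) (h0 : 0 < h (x 0)) : StrictMono x :=
  strictMono_of_deriv_pos fun t => by
    rw [(hx t).deriv]
    exact line_flow_pos hL hx h0 t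

theorem LocallyLipschitz.neg_comp {h : ℝ → ℝ} (hL : LocallyLipschitz h) :
    LocallyLipschitz fun y => -h y :=
  (LipschitzWith.id.neg.locallyLipschitz).comp hL

theorem LocallyLipschitz.comp_neg' {h : ℝ → ℝ} (hL : LocallyLipschitz h) :
    LocallyLipschitz fun y => h (-y) :=
  hL.comp (LipschitzWith.id.neg.locallyLipschitz)

theorem line_flow_neg_strictAnti {h : ℝ → ℝ} (hL : LocallyLipschitz h) {x : ℝ → ℝ}
    (hx : ∀ t, HasDerivAt x (h (x t)) t) (h0 : h (x 0) < 0) : StrictAnti x := by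
  have := line_flow_strictMono (h := fun y => -h (-y)) (x := fun t => -x t) hL.comp_neg'.neg_comp
    (fun t => by simpa using! (hx t).neg) (by simpa using h0)
  exact fun a b hab => neg_lt_neg_iff.1 (this hab)

/-- Scalar solutions are monotone, so one that starts by moving away from `z` never comes back. This
is the obstruction to being a sink. -/
theorem line_flow_repelled {h : ℝ → ℝ} (hL : LocallyLipschitz h) {x : ℝ → ℝ}
    (hx : ∀ t, HasDerivAt x (h (x t)) t) {z : ℝ} (h0 : 0 < h (x 0) * (x 0 - z)) {t : ℝ}
    (ht : 0 ≤ t) : |x 0 - z| ≤ |x t - z| := by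
  rcases pos_and_pos_or_neg_and_neg_of_mul_pos h0 with ⟨h1, h2⟩ | ⟨h1, h2⟩
  · have := (line_flow_strictMono hL hx h1).monotone ht
    rw [abs_of_pos h2, abs_of_pos (by linarith)]
    linarith
  · have := (line_flow_neg_strictAnti hL hx h1).antitone ht
    rw [abs_of_neg h2, abs_of_neg (by linarith)]
    linarith

/-- A solution on the left of an attracting zero increases to it. -/
theorem line_flow_tendsto_of_lt {h : ℝ → ℝ} (hL : LocallyLipschitz h) {x : ℝ → ℝ}
    (hx : ∀ t, HasDerivAt x (h (x t)) t) {z : ℝ} (hz : h z = 0) (h0 : x 0 < z)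
    (hpos : ∀ y ∈ Ico (x 0) z, 0 < h y) :
    (∀ t, 0 ≤ t → x t ∈ Ico (x 0) z) ∧ Tendsto x atTop (𝓝 z) := by
  have hmono := line_flow_strictMono hL hx (hpos _ ⟨le_rfl, h0⟩)
  have hlt : ∀ t, x t < z := by
    intro t
    by_contra hge
    push Not at hge
    obtain ⟨c, rfl⟩ : ∃ c, x c = z :=
      mem_range_of_exists_le_of_exists_ge
        (continuous_iff_continuousAt.2 fun t => (hx t).continuousAt) ⟨0, h0.le⟩ ⟨t, hge⟩
    have := line_flow_pos hL hx (hpos _ ⟨le_rfl, h0⟩) c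
    linarith
  refine ⟨fun t ht => ⟨hmono.monotone ht, hlt t⟩, tendsto_order.2 ⟨fun a ha => ?_, fun a ha =>
    Eventually.of_forall fun t => (hlt t).trans ha⟩⟩
  suffices ∃ t, a < x t by
    obtain ⟨t0, ht0⟩ := this
    filter_upwards [eventually_ge_atTop t0] with t ht
    exact ht0.trans_le (hmono.monotone ht)
  -- If the solution stayed below `a < z`, then `h` would have a positive minimum on its range;
  -- linear growth would carry it to `z` by time `(z - x 0) / h y`.
  by_contra hno
  push Not at hno
  obtain ⟨y, hy, hmin⟩ := isCompact_Icc.exists_isMinOn (nonempty_Icc.2 (hno 0))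
    hL.continuous.continuousOn
  have hc : 0 < h y := hpos y ⟨hy.1, hy.2.trans_lt ha⟩
  have hgrow : ∀ t, 0 ≤ t → h y * (t - 0) ≤ x t - x 0 := by
    intro t ht
    refine Convex.mul_sub_le_image_sub_of_le_deriv (convex_Ici 0)
      (fun t _ => (hx t).continuousAt.continuousWithinAt)
      (fun t _ => (hx t).differentiableAt.differentiableWithinAt) (fun s hs => ?_) 0 self_mem_Ici
      t ht ht
    rw [(hx s).deriv]
    rw [interior_Ici] at hs
    exact hmin ⟨hmono.monotone (le_of_lt hs), hno s⟩
  have h1 := hgrow ((z - x 0) / h y) (div_nonneg (by linarith) hc.le)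
  rw [sub_zero, mul_div_cancel₀ _ hc.ne'] at h1
  linarith [hlt ((z - x 0) / h y)]

theorem line_flow_tendsto_of_gt {h : ℝ → ℝ} (hL : LocallyLipschitz h) {x : ℝ → ℝ}
    (hx : ∀ t, HasDerivAt x (h (x t)) t) {z : ℝ} (hz : h z = 0) (h0 : z < x 0)
    (hneg : ∀ y ∈ Ioc z (x 0), h y < 0) :
    (∀ t, 0 ≤ t → x t ∈ Ioc z (x 0)) ∧ Tendsto x atTop (𝓝 z) := by
  obtain ⟨h1, h2⟩ := line_flow_tendsto_of_lt (h := fun y => -h (-y)) (x := fun t => -x t) (z := -z)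
    hL.comp_neg'.neg_comp (fun t => by simpa using! (hx t).neg) (by simpa using hz)
    (by simpa using h0) (fun y hy => by
      have := hneg (-y) ⟨by linarith [hy.2], by linarith [hy.1]⟩
      linarith)
  refine ⟨fun t ht => ?_, by simpa using h2.neg⟩
  have := h1 t ht
  exact ⟨by linarith [this.2], by linarith [this.1]⟩

theorem pos_or_neg_of_ne_zero {h : ℝ → ℝ} (hc : Continuous h) {a b : ℝ} (hne : ∀ y ∈ Ioo a b, h y ≠ 0) :
    (∀ y ∈ Ioo a b, 0 < h y) ∨ ∀ y ∈ Ioo a b, h y < 0 := by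
  have him : OrdConnected (h '' Ioo a b) := (isPreconnected_Ioo.image h hc.continuousOn).ordConnected
  by_contra hcon
  push Not at hcon
  obtain ⟨⟨x, hx, hx0⟩, y, hy, hy0⟩ := hcon
  obtain ⟨u, hu, hu0⟩ := him.out (mem_image_of_mem h hx) (mem_image_of_mem h hy) ⟨hx0, hy0⟩
  exact hne u hu hu0

/-- A solution between two consecutive zeros tends to one of them in either direction of time. -/
theorem line_flow_connects {h : ℝ → ℝ} (hL : LocallyLipschitz h) {x : ℝ → ℝ}
    (hx : ∀ t, HasDerivAt x (h (x t)) t) {z w : ℝ} (hz : h z = 0) (hw : h w = 0)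
    (h0 : x 0 ∈ Ioo z w) (hne : ∀ y ∈ Ioo z w, h y ≠ 0) :
    ∃ p q : ℝ, h p = 0 ∧ h q = 0 ∧ Tendsto x atBot (𝓝 p) ∧ Tendsto x atTop (𝓝 q) := by
  have hrev : ∀ t, HasDerivAt (fun t => x (-t)) (-h (x (-t))) t := fun t => by
    simpa using! HasDerivAt.scomp t (hx (-t)) (hasDerivAt_neg t)
  have hback : ∀ {p}, Tendsto (fun t => x (-t)) atTop (𝓝 p) → Tendsto x atBot (𝓝 p) := by
    intro p hp
    have := hp.comp tendsto_neg_atBot_atTop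
    simpa [Function.comp_def] using this
  rcases (pos_or_neg_of_ne_zero hL.continuous hne).symm with hall | hall
  · refine ⟨w, z, hw, hz, hback ?_, ?_⟩
    · exact (line_flow_tendsto_of_lt (h := fun y => -h y) hL.neg_comp hrev (by simp [hw])
        (by simpa using h0.2) (fun y hy => by
          have := hall y ⟨h0.1.trans_le (by simpa using hy.1), hy.2⟩
          linarith)).2
    · exact (line_flow_tendsto_of_gt hL hx hz h0.1 fun y hy => hall y ⟨hy.1, hy.2.trans_lt h0.2⟩).2
  · refine ⟨z, w, hz, hw, hback ?_, ?_⟩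
    · exact (line_flow_tendsto_of_gt (h := fun y => -h y) hL.neg_comp hrev (by simp [hz])
        (by simpa using h0.1) (fun y hy => by
          have := hall y ⟨hy.1, lt_of_le_of_lt (by simpa using hy.2) h0.2⟩
          linarith)).2
    · exact (line_flow_tendsto_of_lt hL hx hw h0.2 fun y hy => hall y ⟨h0.1.trans_le hy.1, hy.2⟩).2

end LineFlow

/-! ### Conjugacy of scalar equations near a zero -/

section LineConjugacy

/-- `φ` conjugates, on the interval of radius `δ` around `z`, the equation `x' = h x` to
`y' = q y`, with `z` sent to `0`. -/
structure IsLineConj (h q : ℝ → ℝ) (z δ : ℝ) (φ : OpenPartialHomeomorph ℝ ℝ) : Prop where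
  pos : 0 < δ
  source : φ.source = Ioo (z - δ) (z + δ)
  map_center : φ z = 0
  zero_left : h z = 0
  zero_right : q 0 = 0
  deriv : ∀ x ∈ φ.source, x ≠ z → HasDerivAt φ (q (φ x) / h x) x ∧ q (φ x) ≠ 0 ∧ h x ≠ 0

namespace IsLineConj

variable {h q : ℝ → ℝ} {z δ : ℝ} {φ : OpenPartialHomeomorph ℝ ℝ}

theorem center_mem (H : IsLineConj h q z δ φ) : z ∈ φ.source := by
  rw [H.source]
  exact ⟨by linarith [H.pos], by linarith [H.pos]⟩

theorem symm_zero (H : IsLineConj h q z δ φ) : φ.symm 0 = z := by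
  rw [← H.map_center, φ.left_inv H.center_mem]

/-- Differentiability of `φ` at `z` is not needed: a solution through `z` is constant and goes to
the constant solution `0`. Elsewhere `φ' = q(φ) / h` and the chain rule apply. -/
theorem map_solution (H : IsLineConj h q z δ φ) (hh : LocallyLipschitz h) {x : ℝ → ℝ} {T : ℝ}
    (hx : ∀ t ∈ Icc 0 T, HasDerivWithinAt x (h (x t)) (Icc 0 T) t)
    (hs : ∀ t ∈ Icc 0 T, x t ∈ φ.source) :
    ∀ t ∈ Icc 0 T, HasDerivWithinAt (fun t => φ (x t)) (q (φ (x t))) (Icc 0 T) t := by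
  intro t ht
  by_cases hxz : x t = z
  · have hc := autonomous_eq_const hh hx ht (by rw [hxz, H.zero_left])
    rw [hxz, H.map_center, H.zero_right]
    refine (hasDerivWithinAt_const t _ (0 : ℝ)).congr (fun s hs => ?_) ?_
    · rw [hc s hs, hxz, H.map_center]
    · rw [hxz, H.map_center]
  · obtain ⟨h1, _, h3⟩ := H.deriv _ (hs t ht) hxz
    have := h1.comp_hasDerivWithinAt t (hx t ht)
    rwa [div_mul_cancel₀ _ h3] at this

theorem symm_map_solution (H : IsLineConj h q z δ φ) (hq : LocallyLipschitz q) {y : ℝ → ℝ} {T : ℝ}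
    (hy : ∀ t ∈ Icc 0 T, HasDerivWithinAt y (q (y t)) (Icc 0 T) t)
    (hs : ∀ t ∈ Icc 0 T, y t ∈ φ.target) :
    ∀ t ∈ Icc 0 T, HasDerivWithinAt (fun t => φ.symm (y t)) (h (φ.symm (y t))) (Icc 0 T) t := by
  intro t ht
  by_cases hy0 : y t = 0
  · have hc := autonomous_eq_const hq hy ht (by rw [hy0, H.zero_right])
    rw [hy0, H.symm_zero, H.zero_left]
    refine (hasDerivWithinAt_const t _ z).congr (fun s hs => ?_) ?_
    · rw [hc s hs, hy0, H.symm_zero]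
    · rw [hy0, H.symm_zero]
  · have hne : φ.symm (y t) ≠ z := by
      intro he
      apply hy0
      rw [← φ.right_inv (hs t ht), he, H.map_center]
    obtain ⟨h1, h2, h3⟩ := H.deriv _ (φ.map_target (hs t ht)) hne
    have h4 := φ.hasDerivAt_symm (hs t ht) (div_ne_zero h2 h3) h1
    rw [φ.right_inv (hs t ht)] at h2 h4
    have := h4.comp_hasDerivWithinAt t (hy t ht)
    rwa [inv_div, div_mul_cancel₀ _ h2] at this

end IsLineConj

/-- The image is order connected because it is connected, and open because the values at two points
on either side of `x` bracket `f x`. -/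
theorem exists_openPartialHomeomorph_of_strictMonoOn {f : ℝ → ℝ} {a b : ℝ}
    (hf : StrictMonoOn f (Ioo a b)) (hc : ContinuousOn f (Ioo a b)) :
    ∃ φ : OpenPartialHomeomorph ℝ ℝ, φ.source = Ioo a b ∧ (φ : ℝ → ℝ) = f := by
  have hord : OrdConnected (f '' Ioo a b) := (isPreconnected_Ioo.image f hc).ordConnected
  have hopen : IsOpen (f '' Ioo a b) := by
    rw [isOpen_iff_mem_nhds]
    rintro _ ⟨x, hx, rfl⟩
    obtain ⟨u, hu1, hu2⟩ := exists_between hx.1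
    obtain ⟨w, hw1, hw2⟩ := exists_between hx.2
    have hu : u ∈ Ioo a b := ⟨hu1, hu2.trans hx.2⟩
    have hw : w ∈ Ioo a b := ⟨hx.1.trans hw1, hw2⟩
    exact mem_of_superset (Ioo_mem_nhds (hf hu hx hu2) (hf hx hw hw1))
      (Ioo_subset_Icc_self.trans (hord.out (mem_image_of_mem f hu) (mem_image_of_mem f hw)))
  have hrange : range ((Ioo a b).domRestrict f) = f '' Ioo a b := range_domRestrict f _
  have hmono : StrictMono ((Ioo a b).domRestrict f) := fun x y hxy => hf x.2 y.2 hxy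
  have hemb : IsOpenEmbedding ((Ioo a b).domRestrict f) := by
    exact ⟨hmono.isEmbedding_of_ordConnected (hrange ▸ hord), hrange ▸ hopen⟩
  exact ⟨OpenPartialHomeomorph.ofContinuousOpenRestrict (hf.injOn.toPartialEquiv f _) hc
    hemb.isOpenMap isOpen_Ioo, rfl, rfl⟩

/-- The time function of `x' = h x` on the right of a zero of `h`. -/
theorem exists_time_function {h : ℝ → ℝ} {K : NNReal} (hK : LipschitzWith K h) {z δ : ℝ}
    (hδ : 0 < δ) (hz : h z = 0) (hpos : ∀ x ∈ Ioc z (z + δ), 0 < h x) :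
    ∃ T : ℝ → ℝ, (∀ x ∈ Ioo z (z + δ), HasDerivAt T (1 / h x) x ∧ T x < 0) ∧
      Tendsto T (𝓝[>] z) atBot := by
  -- Starting the integral at the right end makes `T` negative throughout, which `-(T x)⁻¹` needs
  -- later.
  let T : ℝ → ℝ := fun x => ∫ u in (z + δ)..x, 1 / h u
  have hcont : ContinuousOn (fun u => 1 / h u) (Ioc z (z + δ)) :=
    continuousOn_const.div hK.continuous.continuousOn fun x hx => (hpos x hx).ne'
  have hint : ∀ x ∈ Ioo z (z + δ), IntervalIntegrable (fun u => 1 / h u) MeasureTheory.volume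
      (z + δ) x := by
    intro x hx
    refine (hcont.mono ?_).intervalIntegrable
    rw [uIcc_of_ge hx.2.le]
    exact fun y hy => ⟨hx.1.trans_le hy.1, hy.2⟩
  have hderiv : ∀ x ∈ Ioo z (z + δ), HasDerivAt T (1 / h x) x := by
    intro x hx
    have hcont' := hcont.mono Ioo_subset_Ioc_self
    exact intervalIntegral.integral_hasDerivAt_right (hint x hx)
      (hcont'.stronglyMeasurableAtFilter isOpen_Ioo x hx)
      (hcont'.continuousAt (isOpen_Ioo.mem_nhds hx))
  refine ⟨T, fun x hx => ⟨hderiv x hx, ?_⟩, ?_⟩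
  · have : 0 < ∫ u in x..(z + δ), 1 / h u :=
      intervalIntegral.intervalIntegral_pos_of_pos_on (hint x hx).symm
        (fun u hu => one_div_pos.2 (hpos u ⟨hx.1.trans hu.1, hu.2.le⟩)) hx.2
    show (∫ u in (z + δ)..x, 1 / h u) < 0
    rw [intervalIntegral.integral_symm]
    linarith
  -- The Lipschitz bound gives `h x ≤ L (x - z)`, so `T` falls at least as fast as `L⁻¹ log (x -
  -- z)`. The `1` keeps `L` positive when `K = 0`.
  · set L : ℝ := K + 1 with hLdef
    have hL : 0 < L := by positivity
    have hbound : ∀ x ∈ Ioo z (z + δ), h x ≤ L * (x - z) := by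
      intro x hx
      have h1 := hK.dist_le_mul x z
      rw [hz, Real.dist_eq, Real.dist_eq, sub_zero, abs_of_pos (sub_pos.2 hx.1)] at h1
      have h2 := le_abs_self (h x)
      nlinarith [hx.1]
    have hD : ∀ x ∈ Ioo z (z + δ),
        HasDerivAt (fun x => T x - L⁻¹ * Real.log (x - z)) (1 / h x - L⁻¹ * (1 / (x - z))) x := by
      intro x hx
      refine (hderiv x hx).sub (HasDerivAt.const_mul _ ?_)
      exact ((hasDerivAt_id x).sub_const z).log (sub_pos.2 hx.1).ne'
    have hmono : MonotoneOn (fun x => T x - L⁻¹ * Real.log (x - z)) (Ioo z (z + δ)) := by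
      refine monotoneOn_of_deriv_nonneg (convex_Ioo _ _)
        (fun x hx => (hD x hx).continuousAt.continuousWithinAt) ?_ ?_
      · rw [interior_Ioo]
        exact fun x hx => (hD x hx).differentiableAt.differentiableWithinAt
      · rw [interior_Ioo]
        intro x hx
        rw [(hD x hx).deriv, sub_nonneg, inv_eq_one_div, one_div_mul_one_div]
        exact one_div_le_one_div_of_le (hpos x (Ioo_subset_Ioc_self hx)) (hbound x hx)
    have hmid : z + δ / 2 ∈ Ioo z (z + δ) := ⟨by linarith, by linarith⟩
    set C := T (z + δ / 2) - L⁻¹ * Real.log (z + δ / 2 - z)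
    have hlim : Tendsto (fun x => L⁻¹ * Real.log (x - z) + C) (𝓝[>] z) atBot := by
      refine tendsto_atBot_add_const_right _ _ (Tendsto.const_mul_atBot (inv_pos.2 hL) ?_)
      refine Real.tendsto_log_nhdsGT_zero.comp ?_
      refine tendsto_nhdsWithin_iff.2 ⟨?_, ?_⟩
      · have : Tendsto (fun x : ℝ => x - z) (𝓝 z) (𝓝 (z - z)) := tendsto_id.sub_const z
        rw [sub_self] at this
        exact this.mono_left nhdsWithin_le_nhds
      · filter_upwards [self_mem_nhdsWithin] with x hx
        exact sub_pos.2 (mem_Ioi.1 hx)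
    refine tendsto_atBot_mono' _ ?_ hlim
    filter_upwards [Ioo_mem_nhdsGT (show z < z + δ / 2 by linarith)] with x hx
    have := hmono ⟨hx.1, by linarith [hx.2]⟩ hmid hx.2.le
    simp only at this
    linarith

theorem exists_time_function_left {h : ℝ → ℝ} {K : NNReal} (hK : LipschitzWith K h) {z δ : ℝ}
    (hδ : 0 < δ) (hz : h z = 0) (hneg : ∀ x ∈ Ico (z - δ) z, h x < 0) :
    ∃ T : ℝ → ℝ, (∀ x ∈ Ioo (z - δ) z, HasDerivAt T (1 / h x) x ∧ T x < 0) ∧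
      Tendsto T (𝓝[<] z) atBot := by
  have hK' : LipschitzWith K fun y => -h (-y) := by
    have := (LipschitzWith.id (α := ℝ)).neg.comp (hK.comp (LipschitzWith.id (α := ℝ)).neg)
    simpa [Function.comp_def] using this
  obtain ⟨T, h1, h2⟩ := exists_time_function (z := -z) hK' hδ (by simpa using hz)
    (fun x hx => by
      have := hneg (-x) ⟨by linarith [hx.2], by linarith [hx.1]⟩
      linarith)
  refine ⟨fun x => T (-x), fun x hx => ?_, h2.comp ?_⟩
  · obtain ⟨h3, h4⟩ := h1 (-x) ⟨by linarith [hx.2], by linarith [hx.1]⟩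
    refine ⟨?_, h4⟩
    have := h3.comp x (hasDerivAt_neg x)
    simpa [Function.comp_def, div_neg] using this
  · refine tendsto_nhdsWithin_iff.2 ⟨(continuous_neg.tendsto z).mono_left nhdsWithin_le_nhds, ?_⟩
    filter_upwards [self_mem_nhdsWithin] with x hx
    exact neg_lt_neg (mem_Iio.1 hx)

/-- Both branches increase and tend to `0` at `z`, so gluing them with the value `0` gives a
continuous strictly increasing map. -/
theorem exists_isLineConj_of_halves {h q fR fL : ℝ → ℝ} {z δ : ℝ} (hδ : 0 < δ) (hz : h z = 0)
    (hq : q 0 = 0)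
    (hR : ∀ x ∈ Ioo z (z + δ), 0 < fR x ∧ HasDerivAt fR (q (fR x) / h x) x ∧ 0 < q (fR x) / h x)
    (hL : ∀ x ∈ Ioo (z - δ) z, fL x < 0 ∧ HasDerivAt fL (q (fL x) / h x) x ∧ 0 < q (fL x) / h x)
    (tR : Tendsto fR (𝓝[>] z) (𝓝 0)) (tL : Tendsto fL (𝓝[<] z) (𝓝 0)) :
    ∃ φ, IsLineConj h q z δ φ := by
  classical
  let f : ℝ → ℝ := fun x => if z < x then fR x else if x < z then fL x else 0
  have fR_eq : ∀ {x}, z < x → f x = fR x := fun hx => if_pos hx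
  have fL_eq : ∀ {x}, x < z → f x = fL x := fun hx => by
    show ite _ _ _ = _
    rw [if_neg hx.le.not_gt, if_pos hx]
  have f_z : f z = 0 := by simp [f]
  have dR : ∀ x ∈ Ioo z (z + δ), HasDerivAt f (q (f x) / h x) x := fun x hx => by
    rw [fR_eq hx.1]
    refine (hR x hx).2.1.congr_of_eventuallyEq ?_
    filter_upwards [lt_mem_nhds hx.1] with y hy using fR_eq hy
  have dL : ∀ x ∈ Ioo (z - δ) z, HasDerivAt f (q (f x) / h x) x := fun x hx => by
    rw [fL_eq hx.2]
    refine (hL x hx).2.1.congr_of_eventuallyEq ?_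
    filter_upwards [gt_mem_nhds hx.2] with y hy using fL_eq hy
  have mR : StrictMonoOn f (Ioo z (z + δ)) := by
    refine strictMonoOn_of_deriv_pos (convex_Ioo _ _)
      (fun x hx => (dR x hx).continuousAt.continuousWithinAt) ?_
    rw [interior_Ioo]
    intro x hx
    rw [(dR x hx).deriv, fR_eq hx.1]
    exact (hR x hx).2.2
  have mL : StrictMonoOn f (Ioo (z - δ) z) := by
    refine strictMonoOn_of_deriv_pos (convex_Ioo _ _)
      (fun x hx => (dL x hx).continuousAt.continuousWithinAt) ?_
    rw [interior_Ioo]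
    intro x hx
    rw [(dL x hx).deriv, fL_eq hx.2]
    exact (hL x hx).2.2
  have pR : ∀ x ∈ Ioo z (z + δ), 0 < f x := fun x hx => by
    rw [fR_eq hx.1]
    exact (hR x hx).1
  have pL : ∀ x ∈ Ioo (z - δ) z, f x < 0 := fun x hx => by
    rw [fL_eq hx.2]
    exact (hL x hx).1
  have hm : StrictMonoOn f (Ioo (z - δ) (z + δ)) := by
    intro x hx y hy hxy
    rcases lt_trichotomy x z with hxz | rfl | hxz
    · rcases lt_trichotomy y z with hyz | rfl | hyz
      · exact mL ⟨hx.1, hxz⟩ ⟨hy.1, hyz⟩ hxy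
      · rw [f_z]
        exact pL _ ⟨hx.1, hxz⟩
      · exact (pL _ ⟨hx.1, hxz⟩).trans (pR _ ⟨hyz, hy.2⟩)
    · rw [f_z]
      exact pR _ ⟨hxy, hy.2⟩
    · exact mR ⟨hxz, hx.2⟩ ⟨hxz.trans hxy, hy.2⟩ hxy
  have hcz : ContinuousAt f z := by
    rw [continuousAt_iff_continuous_left'_right']
    constructor
    · rw [ContinuousWithinAt, f_z]
      refine tL.congr' ?_
      filter_upwards [self_mem_nhdsWithin] with x hx using (fL_eq hx).symm
    · rw [ContinuousWithinAt, f_z]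
      refine tR.congr' ?_
      filter_upwards [self_mem_nhdsWithin] with x hx using (fR_eq hx).symm
  have hc : ContinuousOn f (Ioo (z - δ) (z + δ)) := by
    intro x hx
    rcases lt_trichotomy x z with hxz | rfl | hxz
    · exact (dL x ⟨hx.1, hxz⟩).continuousAt.continuousWithinAt
    · exact hcz.continuousWithinAt
    · exact (dR x ⟨hxz, hx.2⟩).continuousAt.continuousWithinAt
  clear_value f
  obtain ⟨φ, hs, rfl⟩ : ∃ φ : OpenPartialHomeomorph ℝ ℝ, φ.source = Ioo (z - δ) (z + δ) ∧ φ = f :=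
    exists_openPartialHomeomorph_of_strictMonoOn hm hc
  refine ⟨φ, hδ, hs, f_z, hz, hq, fun x hx hxz => ?_⟩
  rw [hs] at hx
  rcases lt_or_gt_of_ne hxz with hlt | hgt
  · have h1 := (hL x ⟨hx.1, hlt⟩).2.2
    rw [← fL_eq hlt] at h1
    refine ⟨dL x ⟨hx.1, hlt⟩, fun h0 => ?_, fun h0 => ?_⟩ <;> simp [h0] at h1
  · have h1 := (hR x ⟨hgt, hx.2⟩).2.2
    rw [← fR_eq hgt] at h1
    refine ⟨dR x ⟨hgt, hx.2⟩, fun h0 => ?_, fun h0 => ?_⟩ <;> simp [h0] at h1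

/-- A repelling zero is conjugate to the one of `y' = y`. -/
theorem exists_isLineConj_id {h : ℝ → ℝ} {K : NNReal} (hK : LipschitzWith K h) {z δ : ℝ}
    (hδ : 0 < δ) (hz : h z = 0) (hR : ∀ x ∈ Ioc z (z + δ), 0 < h x)
    (hL : ∀ x ∈ Ico (z - δ) z, h x < 0) : ∃ φ, IsLineConj h (fun y => y) z δ φ := by
  obtain ⟨T, h1, h2⟩ := exists_time_function hK hδ hz hR
  obtain ⟨S, h3, h4⟩ := exists_time_function_left hK hδ hz hL
  -- Since `T' = 1 / h`, the function `f = exp T` solves `f' = f / h`, and `T → -∞` gives `f → 0`.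
  refine exists_isLineConj_of_halves (fR := fun x => Real.exp (T x)) (fL := fun x => -Real.exp (S x))
    hδ hz rfl (fun x hx => ⟨Real.exp_pos _, ?_, ?_⟩) (fun x hx => ⟨?_, ?_, ?_⟩) ?_ ?_
  · simpa [div_eq_mul_inv] using (h1 x hx).1.exp
  · exact div_pos (Real.exp_pos _) (hR x (Ioo_subset_Ioc_self hx))
  · simpa using Real.exp_pos _
  · simpa [div_eq_mul_inv] using! (h3 x hx).1.exp.neg
  · exact div_pos_of_neg_of_neg (by simpa using Real.exp_pos _) (hL x (Ioo_subset_Ico_self hx))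
  · exact Real.tendsto_exp_atBot.comp h2
  · simpa using (Real.tendsto_exp_atBot.comp h4).neg

/-- A zero that attracts from the left and repels to the right is conjugate to the one of
`y' = y ^ 2`. -/
theorem exists_isLineConj_sq {h : ℝ → ℝ} {K : NNReal} (hK : LipschitzWith K h) {z δ : ℝ}
    (hδ : 0 < δ) (hz : h z = 0) (hR : ∀ x ∈ Ioc z (z + δ), 0 < h x)
    (hL : ∀ x ∈ Ico (z - δ) z, 0 < h x) : ∃ φ, IsLineConj h (fun y => y ^ 2) z δ φ := by
  have hK' : LipschitzWith K fun y => -h y := by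
    have := (LipschitzWith.id (α := ℝ)).neg.comp hK
    simpa [Function.comp_def] using this
  obtain ⟨T, h1, h2⟩ := exists_time_function hK hδ hz hR
  obtain ⟨S, h3, h4⟩ := exists_time_function_left (z := z) hK' hδ (by simp [hz])
    (fun x hx => by simpa using hL x hx)
  -- Here `f' = f ^ 2 / h` is solved by `-1 / T`. On the left `S` is a time function of `-h`, so the
  -- sign is absorbed and `1 / S` solves it.
  refine exists_isLineConj_of_halves (fR := fun x => -(T x)⁻¹) (fL := fun x => (S x)⁻¹)
    hδ hz (by simp) (fun x hx => ⟨?_, ?_, ?_⟩) (fun x hx => ⟨?_, ?_, ?_⟩) ?_ ?_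
  · simpa using (h1 x hx).2
  · have := ((h1 x hx).1.inv (h1 x hx).2.ne).neg
    convert! this using 1
    field_simp
  · have := (h1 x hx).2.ne
    exact div_pos (pow_pos (by simpa using (h1 x hx).2) 2) (hR x (Ioo_subset_Ioc_self hx))
  · simpa using (h3 x hx).2
  · have := (h3 x hx).1.inv (h3 x hx).2.ne
    convert! this using 1
    field_simp
  · have := (h3 x hx).2.ne
    exact div_pos (by positivity) (hL x (Ioo_subset_Ico_self hx))
  · simpa using (tendsto_inv_atBot_zero.comp h2).neg
  · exact tendsto_inv_atBot_zero.comp h4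

/-- The reflection `x ↦ -x` turns `h` into `y ↦ -h (-y)`, which is positive on both sides. -/
theorem exists_isLineConj_sq_of_neg {h : ℝ → ℝ} {K : NNReal} (hK : LipschitzWith K h) {z δ : ℝ}
    (hδ : 0 < δ) (hz : h z = 0) (hR : ∀ x ∈ Ioc z (z + δ), h x < 0)
    (hL : ∀ x ∈ Ico (z - δ) z, h x < 0) : ∃ φ, IsLineConj h (fun y => y ^ 2) z δ φ := by
  have hK' : LipschitzWith K fun y => -h (-y) := by
    have := (LipschitzWith.id (α := ℝ)).neg.comp (hK.comp (LipschitzWith.id (α := ℝ)).neg)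
    simpa [Function.comp_def] using this
  obtain ⟨φ, H⟩ := exists_isLineConj_sq (z := -z) hK' hδ (by simpa using hz)
    (fun x hx => by simpa using hL (-x) ⟨by linarith [hx.2], by linarith [hx.1]⟩)
    (fun x hx => by simpa using hR (-x) ⟨by linarith [hx.2], by linarith [hx.1]⟩)
  have hsrc : ((Homeomorph.neg ℝ).toOpenPartialHomeomorph.trans φ).source
      = Ioo (z - δ) (z + δ) := by
    ext x
    simp only [OpenPartialHomeomorph.trans_source, Homeomorph.toOpenPartialHomeomorph_source,
      univ_inter, mem_preimage, H.source]
    simp only [Homeomorph.toOpenPartialHomeomorph_apply, Homeomorph.coe_neg, mem_Ioo]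
    constructor <;> rintro ⟨h1, h2⟩ <;> constructor <;> linarith
  refine ⟨(Homeomorph.neg ℝ).toOpenPartialHomeomorph.trans φ, hδ, hsrc, ?_, hz, by simp, ?_⟩
  · simpa using H.map_center
  · intro x hx hxz
    rw [hsrc] at hx
    obtain ⟨h1, h2, h3⟩ := H.deriv (-x)
      (by rw [H.source]; exact ⟨by linarith [hx.2], by linarith [hx.1]⟩)
      (by simpa using hxz)
    refine ⟨?_, by simpa using h2, by simpa using h3⟩
    have := h1.comp x (hasDerivAt_neg x)
    simpa [Function.comp_def, div_neg] using! this

end LineConjugacy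

/-! ### Polar coordinates -/

section PolarCoordinates

/-- The point of argument `θ` whose norm has `N`-th power `s`. -/
def polarPt (N : ℕ) (θ s : ℝ) : Plane :=
  !₂[s ^ ((N : ℝ)⁻¹) * Real.cos θ, s ^ ((N : ℝ)⁻¹) * Real.sin θ]

/-- The complex number with the coordinates of a point of the plane. -/
def planeToComplex (X : Plane) : ℂ := ⟨X 0, X 1⟩

/-- The argument of a point of the plane, in the interval `(θ₀ - π, θ₀ + π]`. -/
def angleNear (θ₀ : ℝ) (X : Plane) : ℝ :=
  θ₀ + Complex.arg (planeToComplex X * Complex.exp ((-θ₀ : ℝ) * Complex.I))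

theorem planeToComplex_injective : Function.Injective planeToComplex := by
  intro X Y h
  have h0 := congrArg Complex.re h
  have h1 := congrArg Complex.im h
  ext i
  fin_cases i
  · exact h0
  · exact h1

theorem planeToComplex_continuous : Continuous planeToComplex := by
  have : planeToComplex = fun X : Plane => ((X 0 : ℝ) : ℂ) + (X 1 : ℝ) * Complex.I := by
    funext X
    apply Complex.ext <;> simp [planeToComplex]
  rw [this]
  fun_prop

theorem norm_planeToComplex (X : Plane) : ‖planeToComplex X‖ = ‖X‖ := by
  rw [Complex.norm_eq_sqrt_sq_add_sq, EuclideanSpace.norm_eq]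
  simp [planeToComplex, Fin.sum_univ_two]

variable {N : ℕ}

theorem planeToComplex_polarPt (θ s : ℝ) :
    planeToComplex (polarPt N θ s) = ((s ^ ((N : ℝ)⁻¹) : ℝ) : ℂ) * Complex.exp (θ * Complex.I) := by
  apply Complex.ext <;>
    simp [planeToComplex, polarPt, Complex.exp_ofReal_mul_I_re, Complex.exp_ofReal_mul_I_im,
      Complex.mul_re, Complex.mul_im]

theorem polarPt_add_int_mul (θ s : ℝ) (k : ℤ) :
    polarPt N (θ + k * (2 * Real.pi)) s = polarPt N θ s := by
  simp [polarPt]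

theorem norm_polarPt_pow (hN : N ≠ 0) {s : ℝ} (hs : 0 < s) (θ : ℝ) : ‖polarPt N θ s‖ ^ N = s := by
  rw [← norm_planeToComplex, planeToComplex_polarPt, norm_mul, Complex.norm_exp_ofReal_mul_I,
    mul_one, Complex.norm_real, Real.norm_of_nonneg (by positivity), Real.rpow_inv_natCast_pow hs.le hN]

theorem polarPt_ne_zero {s : ℝ} (hs : 0 < s) (θ : ℝ) : polarPt N θ s ≠ 0 := by
  intro h
  have := congrArg planeToComplex h
  rw [planeToComplex_polarPt] at this
  have h0 : planeToComplex 0 = 0 := by apply Complex.ext <;> simp [planeToComplex]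
  rw [h0, mul_eq_zero] at this
  rcases this with h1 | h1
  · rw [Complex.ofReal_eq_zero] at h1
    exact (Real.rpow_pos_of_pos hs _).ne' h1
  · exact Complex.exp_ne_zero _ h1

theorem rotate_polarPt (θ₀ θ s : ℝ) :
    planeToComplex (polarPt N θ s) * Complex.exp ((-θ₀ : ℝ) * Complex.I) =
      ((s ^ ((N : ℝ)⁻¹) : ℝ) : ℂ) * Complex.exp (((θ - θ₀ : ℝ) : ℂ) * Complex.I) := by
  rw [planeToComplex_polarPt, mul_assoc, ← Complex.exp_add]
  congr 2
  push_cast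
  ring

theorem arg_rotate_polarPt {θ₀ θ s : ℝ} (hs : 0 < s) (h : |θ - θ₀| < Real.pi) :
    Complex.arg (planeToComplex (polarPt N θ s) * Complex.exp ((-θ₀ : ℝ) * Complex.I)) = θ - θ₀ := by
  obtain ⟨h1, h2⟩ := abs_lt.1 h
  rw [rotate_polarPt, Complex.arg_real_mul _ (Real.rpow_pos_of_pos hs _),
    Complex.arg_exp_mul_I, toIocMod_eq_self]
  constructor <;> linarith

theorem angleNear_polarPt {θ₀ θ s : ℝ} (hs : 0 < s) (h : |θ - θ₀| < Real.pi) :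
    angleNear θ₀ (polarPt N θ s) = θ := by
  rw [angleNear, arg_rotate_polarPt hs h]
  ring

theorem polarPt_angleNear (hN : N ≠ 0) (θ₀ : ℝ) (X : Plane) :
    polarPt N (angleNear θ₀ X) (‖X‖ ^ N) = X := by
  apply planeToComplex_injective
  rw [planeToComplex_polarPt, Real.pow_rpow_inv_natCast (norm_nonneg _) hN]
  set w := planeToComplex X * Complex.exp ((-θ₀ : ℝ) * Complex.I) with hw
  have hn : ‖w‖ = ‖X‖ := by
    rw [hw, norm_mul, Complex.norm_exp_ofReal_mul_I, mul_one, norm_planeToComplex]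
  have h1 := Complex.norm_mul_exp_arg_mul_I w
  rw [angleNear, ← hw, ← hn]
  push_cast
  rw [add_mul, Complex.exp_add, mul_comm (Complex.exp _), ← mul_assoc, h1, hw, mul_assoc,
    ← Complex.exp_add]
  simp

theorem exists_eq_polarPt (hN : N ≠ 0) {X : Plane} (hX : X ≠ 0) :
    ∃ a s, 0 < s ∧ X = polarPt N a s :=
  ⟨angleNear 0 X, ‖X‖ ^ N, by positivity, (polarPt_angleNear hN 0 X).symm⟩

theorem polarPt_inj (hN : N ≠ 0) {a b s t : ℝ} (hs : 0 < s) (ht : 0 < t)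
    (h : polarPt N a s = polarPt N b t) : s = t ∧ ∃ k : ℤ, a = b + k * (2 * Real.pi) := by
  have hst : s = t := by rw [← norm_polarPt_pow hN hs a, h, norm_polarPt_pow hN ht b]
  subst hst
  refine ⟨rfl, ?_⟩
  have h1 := congrArg planeToComplex h
  rw [planeToComplex_polarPt, planeToComplex_polarPt] at h1
  have h2 := mul_left_cancel₀
    (Complex.ofReal_ne_zero.2 (Real.rpow_pos_of_pos hs ((N : ℝ)⁻¹)).ne') h1
  obtain ⟨k, hk⟩ := Complex.exp_eq_exp_iff_exists_int.1 h2
  refine ⟨k, ?_⟩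
  have := congrArg Complex.im hk
  simpa using this

theorem polarPt_continuousAt {p : ℝ × ℝ} (hp : 0 < p.2) :
    ContinuousAt (fun p : ℝ × ℝ => polarPt N p.1 p.2) p := by
  have h1 : ContinuousAt (fun p : ℝ × ℝ => p.2 ^ ((N : ℝ)⁻¹)) p :=
    continuousAt_snd.rpow_const (Or.inl hp.ne')
  have h2 : ContinuousAt (fun p : ℝ × ℝ => ![p.2 ^ ((N : ℝ)⁻¹) * Real.cos p.1,
      p.2 ^ ((N : ℝ)⁻¹) * Real.sin p.1]) p := by
    rw [continuousAt_pi]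
    intro i
    fin_cases i
    · exact h1.mul (Real.continuous_cos.continuousAt.comp continuousAt_fst)
    · exact h1.mul (Real.continuous_sin.continuousAt.comp continuousAt_fst)
  exact (PiLp.continuous_toLp 2 _).continuousAt.comp h2

theorem polarPt_comp_continuous {α : Type*} [TopologicalSpace α] {f g : α → ℝ}
    (hf : Continuous f) (hg : Continuous g) (hpos : ∀ x, 0 < g x) :
    Continuous fun x => polarPt N (f x) (g x) :=
  continuous_iff_continuousAt.2 fun x =>
    ContinuousAt.comp (f := fun x => (f x, g x)) (polarPt_continuousAt (p := (f x, g x)) (hpos x))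
      (hf.prodMk hg).continuousAt

/-- The points of the plane off the ray opposite to the direction `θ₀`. -/
def slitAround (θ₀ : ℝ) : Set Plane :=
  {X | planeToComplex X * Complex.exp ((-θ₀ : ℝ) * Complex.I) ∈ Complex.slitPlane}

theorem isOpen_slitAround (θ₀ : ℝ) : IsOpen (slitAround θ₀) :=
  Complex.isOpen_slitPlane.preimage (planeToComplex_continuous.mul continuous_const)

theorem angleNear_continuousOn (θ₀ : ℝ) : ContinuousOn (angleNear θ₀) (slitAround θ₀) := by
  intro X hX
  refine (ContinuousAt.add continuousAt_const ?_).continuousWithinAt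
  exact (Complex.continuousAt_arg hX).comp
    (f := fun X => planeToComplex X * Complex.exp ((-θ₀ : ℝ) * Complex.I))
    (planeToComplex_continuous.mul continuous_const).continuousAt

theorem polarPt_mem_slitAround {θ₀ θ s : ℝ} (hs : 0 < s) (h : |θ - θ₀| < Real.pi) :
    polarPt N θ s ∈ slitAround θ₀ := by
  rw [slitAround, mem_ofPred_eq, Complex.mem_slitPlane_iff_arg, arg_rotate_polarPt hs h]
  refine ⟨(abs_lt.1 h).2.ne, ?_⟩
  rw [rotate_polarPt]
  exact mul_ne_zero (Complex.ofReal_ne_zero.2 (Real.rpow_pos_of_pos hs _).ne') (Complex.exp_ne_zero _)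

end PolarCoordinates

/-- The lower bound is a value of `f`, so it is positive as soon as `f` is. -/
theorem Function.Periodic.exists_bounds {f : ℝ → ℝ} (hp : Function.Periodic f (2 * Real.pi))
    (hc : Continuous f) : ∃ lo hi, lo ∈ range f ∧ ∀ x, lo ≤ f x ∧ f x ≤ hi := by
  have hne : (Icc 0 (2 * Real.pi)).Nonempty := nonempty_Icc.2 (by positivity)
  obtain ⟨u, _, hu⟩ := isCompact_Icc.exists_isMinOn hne hc.continuousOn
  obtain ⟨w, _, hw⟩ := isCompact_Icc.exists_isMaxOn hne hc.continuousOn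
  refine ⟨f u, f w, mem_range_self u, fun x => ?_⟩
  obtain ⟨y, hy, hxy⟩ := hp.exists_mem_Ico₀ (by positivity) x
  rw [hxy]
  exact ⟨hu (Ico_subset_Icc_self hy), hw (Ico_subset_Icc_self hy)⟩

/-! ### The skew product and its invariant graph -/

/-- A planar vector field that, after a positive change of time, becomes the skew product
`θ' = h θ`, `s' = m θ - s` in polar coordinates; `Θ` is the flow of `h`. -/
structure PolarModel (F : Plane → Plane) where
  N : ℕ
  N_ne : N ≠ 0
  h : ℝ → ℝ
  m : ℝ → ℝ
  κ : ℝ → ℝ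
  K : NNReal
  lip : LipschitzWith K h
  h_per : Function.Periodic h (2 * Real.pi)
  m_per : Function.Periodic m (2 * Real.pi)
  κ_per : Function.Periodic κ (2 * Real.pi)
  m_cont : Continuous m
  κ_cont : Continuous κ
  m_pos : ∀ θ, 0 < m θ
  κ_pos : ∀ θ, 0 < κ θ
  F_lip : LocallyLipschitz F
  deriv_polar : ∀ (θ s : ℝ → ℝ) (τ : ℝ), 0 < s τ → HasDerivAt θ (h (θ τ)) τ →
    HasDerivAt s (m (θ τ) - s τ) τ →
    HasDerivAt (fun t => polarPt N (θ t) (s t)) ((κ (θ τ) / s τ) • F (polarPt N (θ τ) (s τ))) τ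
  eq_zero_iff : ∀ θ s, 0 < s → (F (polarPt N θ s) = 0 ↔ h θ = 0 ∧ m θ = s)
  Θ : ℝ → ℝ → ℝ
  Θ_zero : ∀ a, Θ a 0 = a
  Θ_deriv : ∀ a t, HasDerivAt (Θ a) (h (Θ a t)) t

namespace PolarModel

variable {F : Plane → Plane} (M : PolarModel F)

theorem m_bounds : ∃ lo hi, 0 < lo ∧ ∀ x, lo ≤ M.m x ∧ M.m x ≤ hi := by
  obtain ⟨lo, hi, ⟨x, rfl⟩, h⟩ := M.m_per.exists_bounds M.m_cont
  exact ⟨_, hi, M.m_pos x, h⟩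

theorem κ_bounds : ∃ lo hi, 0 < lo ∧ ∀ x, lo ≤ M.κ x ∧ M.κ x ≤ hi := by
  obtain ⟨lo, hi, ⟨x, rfl⟩, h⟩ := M.κ_per.exists_bounds M.κ_cont
  exact ⟨_, hi, M.κ_pos x, h⟩

theorem Θ_continuous (a : ℝ) : Continuous (M.Θ a) :=
  continuous_iff_continuousAt.2 fun t => (M.Θ_deriv a t).continuousAt

theorem Θ_unique {x : ℝ → ℝ} (hx : ∀ t, HasDerivAt x (M.h (x t)) t) (t : ℝ) :
    x t = M.Θ (x 0) t := by
  have := ODE_solution_unique_univ (v := fun _ => M.h) (s := fun _ => univ) (t₀ := 0)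
    (fun _ => M.lip.lipschitzOnWith) (fun t => ⟨hx t, trivial⟩)
    (fun t => ⟨M.Θ_deriv (x 0) t, trivial⟩) (M.Θ_zero _).symm
  exact congrFun this t

theorem Θ_unique_Icc {x : ℝ → ℝ} {T : ℝ}
    (hx : ∀ t ∈ Icc 0 T, HasDerivWithinAt x (M.h (x t)) (Icc 0 T) t) :
    ∀ t ∈ Icc 0 T, x t = M.Θ (x 0) t :=
  autonomous_unique_right M.lip.locallyLipschitz hx
    (fun t _ => (M.Θ_deriv (x 0) t).hasDerivWithinAt) (M.Θ_zero _).symm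

theorem Θ_add (a σ τ : ℝ) : M.Θ (M.Θ a σ) τ = M.Θ a (σ + τ) := by
  have := M.Θ_unique (x := fun t => M.Θ a (σ + t)) (fun t => by
    simpa using! (M.Θ_deriv a (σ + t)).comp_const_add σ t) τ
  simpa using this.symm

theorem Θ_add_two_pi (a τ : ℝ) : M.Θ (a + 2 * Real.pi) τ = M.Θ a τ + 2 * Real.pi := by
  have := M.Θ_unique (x := fun t => M.Θ a t + 2 * Real.pi) (fun t => by
    rw [M.h_per]
    exact (M.Θ_deriv a t).add_const _) τ
  rw [this, M.Θ_zero]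

theorem Θ_of_zero {z : ℝ} (hz : M.h z = 0) (t : ℝ) : M.Θ z t = z :=
  (M.Θ_unique (x := fun _ => z) (fun t => by rw [hz]; exact hasDerivAt_const t z) t).symm

/-- Grönwall for the reversed flow; only negative times are needed, as `sstar` integrates over the
past. -/
theorem Θ_continuous_left {t : ℝ} (ht : t ≤ 0) : Continuous fun a => M.Θ a t := by
  have hK : LipschitzWith M.K fun y => -M.h y := by
    have := (LipschitzWith.id (α := ℝ)).neg.comp M.lip
    simpa [Function.comp_def] using this
  have hd : ∀ a s, HasDerivAt (fun s => M.Θ a (-s)) (-M.h (M.Θ a (-s))) s := fun a s => by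
    simpa using! HasDerivAt.scomp s (M.Θ_deriv a (-s)) (hasDerivAt_neg s)
  have key : LipschitzWith ⟨Real.exp (M.K * -t), (Real.exp_pos _).le⟩ fun a => M.Θ a t := by
    refine LipschitzWith.of_dist_le_mul fun a b => ?_
    have := dist_le_of_trajectories_ODE (v := fun _ y => -M.h y) (K := M.K) (a := 0) (b := -t)
      (f := fun s => M.Θ a (-s)) (g := fun s => M.Θ b (-s)) (δ := dist a b) (fun _ => hK)
      (fun s _ => (hd a s).continuousAt.continuousWithinAt) (fun s _ => (hd a s).hasDerivWithinAt)
      (fun s _ => (hd b s).continuousAt.continuousWithinAt) (fun s _ => (hd b s).hasDerivWithinAt)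
      (by simp [M.Θ_zero]) (-t) ⟨by linarith, le_rfl⟩
    simp only [neg_neg, sub_zero] at this
    rw [mul_comm] at this
    exact this
  exact key.continuous

/-- The attracting invariant graph: the bounded solution of `s' = m θ - s` over the flow of `h`. -/
def sstar (θ : ℝ) : ℝ := ∫ u in Iic 0, Real.exp u * M.m (M.Θ θ u)

theorem sstar_integrableOn (θ c : ℝ) :
    MeasureTheory.IntegrableOn (fun u => Real.exp u * M.m (M.Θ θ u)) (Iic c) := by
  obtain ⟨lo, hi, hlo, hb⟩ := M.m_bounds
  refine MeasureTheory.Integrable.mul_bdd (c := hi) (integrableOn_exp_Iic c) ?_ ?_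
  · exact (M.m_cont.comp (M.Θ_continuous θ)).aestronglyMeasurable
  · filter_upwards with u
    rw [Real.norm_of_nonneg (M.m_pos _).le]
    exact (hb _).2

/-- `sstar` is an average of `m` along the past orbit, with the probability density `exp u` on `(-∞,
0]`. -/
theorem sstar_bounds {lo hi : ℝ} (hb : ∀ x, lo ≤ M.m x ∧ M.m x ≤ hi) (θ : ℝ) :
    lo ≤ M.sstar θ ∧ M.sstar θ ≤ hi := by
  have hc : ∀ c : ℝ, ∫ u in Iic (0 : ℝ), Real.exp u * c = c := fun c => by
    rw [MeasureTheory.integral_mul_const, integral_exp_Iic_zero, one_mul]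
  have hi' : ∀ c : ℝ, MeasureTheory.IntegrableOn (fun u => Real.exp u * c) (Iic (0 : ℝ)) :=
    fun c => (integrableOn_exp_Iic 0).mul_const c
  constructor
  · rw [← hc lo]
    exact MeasureTheory.integral_mono (hi' lo) (M.sstar_integrableOn θ 0)
      fun u => mul_le_mul_of_nonneg_left (hb _).1 (Real.exp_pos u).le
  · rw [← hc hi]
    exact MeasureTheory.integral_mono (M.sstar_integrableOn θ 0) (hi' hi)
      fun u => mul_le_mul_of_nonneg_left (hb _).2 (Real.exp_pos u).le

theorem sstar_pos (θ : ℝ) : 0 < M.sstar θ := by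
  obtain ⟨lo, hi, hlo, hb⟩ := M.m_bounds
  exact hlo.trans_le (M.sstar_bounds hb θ).1

theorem sstar_continuous : Continuous M.sstar := by
  obtain ⟨lo, hi, hlo, hb⟩ := M.m_bounds
  refine MeasureTheory.continuous_of_dominated (bound := fun u => Real.exp u * hi) ?_ ?_ ?_ ?_
  · intro θ
    exact (Real.continuous_exp.mul (M.m_cont.comp (M.Θ_continuous θ))).aestronglyMeasurable
  · intro θ
    filter_upwards with u
    rw [Real.norm_of_nonneg (mul_nonneg (Real.exp_pos u).le (M.m_pos _).le)]
    exact mul_le_mul_of_nonneg_left (hb _).2 (Real.exp_pos u).le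
  · exact (integrableOn_exp_Iic 0).mul_const hi
  · filter_upwards [MeasureTheory.ae_restrict_mem measurableSet_Iic] with u hu
    exact continuous_const.mul (M.m_cont.comp (M.Θ_continuous_left hu))

theorem sstar_periodic : Function.Periodic M.sstar (2 * Real.pi) := by
  intro θ
  simp only [sstar, M.Θ_add_two_pi, M.m_per _]

theorem sstar_of_zero {z : ℝ} (hz : M.h z = 0) : M.sstar z = M.m z := by
  simp only [sstar, M.Θ_of_zero hz]
  rw [MeasureTheory.integral_mul_const, integral_exp_Iic_zero, one_mul]

/-- Translating the variable of integration by `τ` and cutting at `0` leaves `τ` in a factor and an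
endpoint only, so the fundamental theorem of calculus can differentiate it. -/
theorem sstar_flow (a τ : ℝ) : M.sstar (M.Θ a τ) =
    Real.exp (-τ) * ((∫ u in Iic 0, Real.exp u * M.m (M.Θ a u)) +
      ∫ u in (0 : ℝ)..τ, Real.exp u * M.m (M.Θ a u)) := by
  rw [← intervalIntegral.integral_Iic_sub_Iic (M.sstar_integrableOn a 0) (M.sstar_integrableOn a τ),
    add_sub_cancel]
  have h1 := (MeasureTheory.measurePreserving_add_right MeasureTheory.volume τ).setIntegral_preimage_emb
    (measurableEmbedding_addRight τ) (fun u => Real.exp u * M.m (M.Θ a u)) (Iic τ)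
  rw [← h1, ← MeasureTheory.integral_const_mul]
  have h2 : (fun x : ℝ => x + τ) ⁻¹' Iic τ = Iic 0 := by
    ext x
    simp
  rw [h2, sstar]
  congr 1
  funext u
  rw [M.Θ_add, add_comm τ u, ← mul_assoc, ← Real.exp_add]
  congr 2
  ring

theorem sstar_deriv (a τ : ℝ) :
    HasDerivAt (fun τ => M.sstar (M.Θ a τ)) (M.m (M.Θ a τ) - M.sstar (M.Θ a τ)) τ := by
  have hc : Continuous fun u => Real.exp u * M.m (M.Θ a u) :=
    Real.continuous_exp.mul (M.m_cont.comp (M.Θ_continuous a))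
  have h1 := (hc.integral_hasStrictDerivAt 0 τ).hasDerivAt
  have h2 : HasDerivAt (fun τ => Real.exp (-τ)) (-Real.exp (-τ)) τ := by
    simpa using (hasDerivAt_neg τ).exp
  have h3 := h2.mul (h1.const_add (∫ u in Iic 0, Real.exp u * M.m (M.Θ a u)))
  have h4 : (fun τ => M.sstar (M.Θ a τ)) = _ := funext fun τ => M.sstar_flow a τ
  rw [h4]
  convert! h3 using 1
  rw [M.sstar_flow, ← mul_assoc, ← Real.exp_add]
  simp
  ring

/-- The radial coordinate along the orbit of the point with coordinates `(a, s)`. -/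
def radial (a s τ : ℝ) : ℝ := M.sstar (M.Θ a τ) + Real.exp (-τ) * (s - M.sstar a)

/-- The orbit, in normalised time, of the point with coordinates `(a, s)`. -/
def orbit (a s τ : ℝ) : Plane := polarPt M.N (M.Θ a τ) (M.radial a s τ)

theorem radial_zero (a s : ℝ) : M.radial a s 0 = s := by simp [radial, M.Θ_zero]

theorem orbit_zero (a s : ℝ) : M.orbit a s 0 = polarPt M.N a s := by
  rw [orbit, M.radial_zero, M.Θ_zero]

theorem radial_deriv (a s τ : ℝ) :
    HasDerivAt (M.radial a s) (M.m (M.Θ a τ) - M.radial a s τ) τ := by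
  have h2 : HasDerivAt (fun τ => Real.exp (-τ)) (-Real.exp (-τ)) τ := by
    simpa using (hasDerivAt_neg τ).exp
  have := (M.sstar_deriv a τ).add (h2.mul_const (s - M.sstar a))
  convert! this using 1
  rw [radial]
  ring

theorem radial_continuous (a s : ℝ) : Continuous (M.radial a s) :=
  continuous_iff_continuousAt.2 fun τ => (M.radial_deriv a s τ).continuousAt

/-- Along the flow `exp t * (s - c)` has derivative `exp t * (m - c) ≥ 0`, so it cannot become
negative. -/
theorem radial_lower {c : ℝ} (hc : ∀ x, c ≤ M.m x) (a : ℝ) {s τ : ℝ} (hs : c ≤ s) (hτ : 0 ≤ τ) :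
    c ≤ M.radial a s τ := by
  have hd : ∀ t, HasDerivAt (fun t => Real.exp t * (M.radial a s t - c))
      (Real.exp t * (M.m (M.Θ a t) - c)) t := by
    intro t
    have := (Real.hasDerivAt_exp t).mul ((M.radial_deriv a s t).sub_const c)
    convert! this using 1
    ring
  have hm : Monotone fun t => Real.exp t * (M.radial a s t - c) := by
    refine monotone_of_deriv_nonneg (fun t => (hd t).differentiableAt) fun t => ?_
    rw [(hd t).deriv]
    exact mul_nonneg (Real.exp_pos t).le (sub_nonneg.2 (hc _))
  have h1 := hm hτ
  simp only [Real.exp_zero, one_mul, M.radial_zero] at h1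
  have h2 : 0 ≤ Real.exp τ * (M.radial a s τ - c) := (sub_nonneg.2 hs).trans h1
  exact sub_nonneg.1 (nonneg_of_mul_nonneg_right h2 (Real.exp_pos τ))

theorem radial_pos (a : ℝ) {s τ : ℝ} (hs : 0 < s) (hτ : 0 ≤ τ) : 0 < M.radial a s τ := by
  obtain ⟨lo, hi, hlo, hb⟩ := M.m_bounds
  exact (lt_min hs hlo).trans_le
    (M.radial_lower (fun x => (min_le_right _ _).trans (hb x).1) a (min_le_left _ _) hτ)

theorem radial_upper {hi : ℝ} (hb : ∀ θ, M.sstar θ ≤ hi) (a : ℝ) {s τ : ℝ} (hs : 0 < s)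
    (hτ : 0 ≤ τ) : M.radial a s τ ≤ hi + s := by
  have h1 : Real.exp (-τ) ≤ 1 := Real.exp_le_one_iff.2 (by linarith)
  have h2 := Real.exp_pos (-τ)
  have h3 := M.sstar_pos a
  have : Real.exp (-τ) * (s - M.sstar a) ≤ s := by nlinarith [mul_pos h2 h3]
  have := hb (M.Θ a τ)
  rw [radial]
  linarith

theorem orbit_deriv {a s τ : ℝ} (h : 0 < M.radial a s τ) :
    HasDerivAt (M.orbit a s)
      ((M.κ (M.Θ a τ) / M.radial a s τ) • F (M.orbit a s τ)) τ :=
  M.deriv_polar _ _ τ h (M.Θ_deriv a τ) (M.radial_deriv a s τ)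

/-- Orbits are forward trajectories up to a change of time, whose speed is bounded as long as the
starting point keeps away from the origin. -/
theorem exists_forward_time {s₀ : ℝ} (hs₀ : 0 < s₀) : ∃ C, 0 < C ∧ ∀ a s, s₀ ≤ s →
    ∃ T : ℝ ≃o ℝ, T 0 = 0 ∧ IsTrajectoryOn F (fun t => M.orbit a s (T.symm t)) (Ici 0) ∧
      ∀ τ, 0 ≤ τ → T τ ≤ C * τ := by
  obtain ⟨lo, hi, hlo, hb⟩ := M.m_bounds
  obtain ⟨klo, khi, hklo, hkb⟩ := M.κ_bounds
  have hkhi : 0 < khi := hklo.trans_le ((hkb 0).1.trans (hkb 0).2)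
  have hc : 0 < min s₀ lo := lt_min hs₀ hlo
  refine ⟨khi / min s₀ lo, div_pos hkhi hc, fun a s hs => ?_⟩
  have hsp : 0 < s := hs₀.trans_le hs
  have hlow : ∀ τ, min s₀ lo ≤ M.radial a s (max τ 0) := fun τ =>
    M.radial_lower (fun x => (min_le_right _ _).trans (hb x).1) a ((min_le_left _ _).trans hs)
      (le_max_right _ _)
  have hup : ∀ τ, M.radial a s (max τ 0) ≤ hi + s := fun τ =>
    M.radial_upper (fun θ => (M.sstar_bounds hb θ).2) a hsp (le_max_right _ _)
  have hhi : 0 < hi + s := hc.trans_le ((hlow 0).trans (hup 0))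
  -- The radial coordinate is only known to be positive in forward time. Freezing the speed for
  -- negative `τ` keeps `k` positive and the time change defined on the whole line.
  let k : ℝ → ℝ := fun τ => M.κ (M.Θ a (max τ 0)) / M.radial a s (max τ 0)
  have hk : Continuous k := by
    have hmax : Continuous fun τ : ℝ => max τ 0 := by fun_prop
    exact (M.κ_cont.comp ((M.Θ_continuous a).comp hmax)).div ((M.radial_continuous a s).comp hmax)
      fun τ => (hc.trans_le (hlow τ)).ne'
  obtain ⟨T, hT0, hT, hTs⟩ := exists_time_change hk (div_pos hklo hhi) fun τ =>
    div_le_div₀ (M.κ_pos _).le (hkb _).1 (hc.trans_le (hlow τ)) (hup τ)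
  have hk_up : ∀ τ, k τ ≤ khi / min s₀ lo := fun τ =>
    div_le_div₀ hkhi.le (hkb _).2 hc (hlow τ)
  refine ⟨T, hT0, fun t ht => ?_, fun τ hτ => ?_⟩
  · have ht0 : 0 ≤ T.symm t := by
      rw [T.le_symm_apply, hT0]
      exact ht
    have h1 := M.orbit_deriv (a := a) (M.radial_pos a hsp ht0)
    have h2 := h1.scomp t (hTs t)
    refine HasDerivAt.hasDerivWithinAt ?_
    convert! h2 using 1
    have h3 : k (T.symm t) = M.κ (M.Θ a (T.symm t)) / M.radial a s (T.symm t) := by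
      simp only [k, max_eq_left ht0]
    rw [smul_smul, ← h3, inv_mul_cancel₀, one_smul]
    rw [h3]
    exact (div_pos (M.κ_pos _) (M.radial_pos a hsp ht0)).ne'
  · have := Convex.image_sub_le_mul_sub_of_deriv_le (convex_univ (𝕜 := ℝ) (E := ℝ))
      (f := T) (C := khi / min s₀ lo)
      (fun t _ => (hT t).continuousAt.continuousWithinAt)
      (fun t _ => (hT t).differentiableAt.differentiableWithinAt)
      (fun t _ => by rw [(hT t).deriv]; exact hk_up t) 0 trivial τ trivial hτ
    simpa [hT0] using this

/-- The orbits inside the invariant graph are complete trajectories up to a change of time. -/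
theorem exists_complete_time (a : ℝ) : ∃ T : ℝ ≃o ℝ, T 0 = 0 ∧
    IsTrajectoryOn F (fun t => polarPt M.N (M.Θ a (T.symm t)) (M.sstar (M.Θ a (T.symm t)))) univ := by
  obtain ⟨lo, hi, hlo, hb⟩ := M.m_bounds
  obtain ⟨klo, khi, hklo, hkb⟩ := M.κ_bounds
  have hup : ∀ θ, M.sstar θ ≤ hi := fun θ => (M.sstar_bounds hb θ).2
  have hhi : 0 < hi := (M.sstar_pos 0).trans_le (hup 0)
  have hk : Continuous fun τ => M.κ (M.Θ a τ) / M.sstar (M.Θ a τ) :=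
    (M.κ_cont.comp (M.Θ_continuous a)).div (M.sstar_continuous.comp (M.Θ_continuous a))
      fun τ => (M.sstar_pos _).ne'
  obtain ⟨T, hT0, hT, hTs⟩ := exists_time_change hk (div_pos hklo hhi) fun τ =>
    div_le_div₀ (M.κ_pos _).le (hkb _).1 (M.sstar_pos _) (hup _)
  refine ⟨T, hT0, fun t _ => ?_⟩
  have h1 := M.deriv_polar (M.Θ a) (fun τ => M.sstar (M.Θ a τ)) (T.symm t) (M.sstar_pos _)
    (M.Θ_deriv a _) (M.sstar_deriv a _)
  have h2 := h1.scomp t (hTs t)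
  refine HasDerivAt.hasDerivWithinAt ?_
  convert! h2 using 1
  rw [smul_smul, inv_mul_cancel₀ (div_pos (M.κ_pos _) (M.sstar_pos _)).ne', one_smul]

/-- A trajectory that starts at the point with coordinates `(a, s)` runs along its orbit. -/
theorem exists_normalised_time {s₀ : ℝ} (hs₀ : 0 < s₀) : ∃ C, 0 < C ∧ ∀ a s, s₀ ≤ s →
    ∀ (γ : ℝ → Plane) (T : ℝ), 0 ≤ T → IsTrajectoryOn F γ (Icc 0 T) → γ 0 = polarPt M.N a s →
      ∃ τ, 0 ≤ τ ∧ T ≤ C * τ ∧ γ T = M.orbit a s τ ∧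
        ∀ σ ∈ Icc 0 τ, ∃ t ∈ Icc 0 T, γ t = M.orbit a s σ := by
  obtain ⟨C, hC, H⟩ := M.exists_forward_time hs₀
  refine ⟨C, hC, fun a s hs γ T hT hγ h0 => ?_⟩
  obtain ⟨e, he0, htraj, hup⟩ := H a s hs
  have hes0 : e.symm 0 = 0 := (e.symm_apply_eq).2 he0.symm
  have heq : EqOn γ (fun t => M.orbit a s (e.symm t)) (Icc 0 T) := by
    refine autonomous_unique_right M.F_lip hγ
      (fun t ht => (htraj t ht.1).mono Icc_subset_Ici_self) ?_
    rw [h0, hes0, M.orbit_zero]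
  have hτ : 0 ≤ e.symm T := by rw [← hes0]; exact e.symm.monotone hT
  refine ⟨e.symm T, hτ, ?_, heq ⟨hT, le_rfl⟩, fun σ hσ => ⟨e σ, ⟨?_, ?_⟩, ?_⟩⟩
  · simpa using hup _ hτ
  · rw [← he0]
    exact e.monotone hσ.1
  · have := e.monotone hσ.2
    simpa using this
  · rw [heq (x := e σ) ⟨by rw [← he0]; exact e.monotone hσ.1,
      by simpa using e.monotone hσ.2⟩]
    simp

/-- `FlowsTo` ignores the parametrization, so local equivalence may be checked in normalised time.
-/
theorem flowsTo_polarPt_iff {U : Set Plane} {a s : ℝ} (hs : 0 < s) {y : Plane} :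
    FlowsTo F U (polarPt M.N a s) y ↔
      ∃ τ, 0 ≤ τ ∧ y = M.orbit a s τ ∧ ∀ σ ∈ Icc 0 τ, M.orbit a s σ ∈ U := by
  constructor
  · rintro ⟨T, hT, γ, hγ, hU, h0, rfl⟩
    obtain ⟨C, hC, H⟩ := M.exists_normalised_time hs
    obtain ⟨τ, hτ, _, h1, h2⟩ := H a s le_rfl γ T hT hγ h0
    refine ⟨τ, hτ, h1, fun σ hσ => ?_⟩
    obtain ⟨t, ht, hteq⟩ := h2 σ hσ
    exact hteq ▸ hU t ht
  · rintro ⟨τ, hτ, rfl, hU⟩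
    obtain ⟨C, hC, H⟩ := M.exists_forward_time hs
    obtain ⟨e, he0, htraj, hup⟩ := H a s le_rfl
    have hes0 : e.symm 0 = 0 := (e.symm_apply_eq).2 he0.symm
    refine ⟨e τ, by rw [← he0]; exact e.monotone hτ, fun t => M.orbit a s (e.symm t),
      fun t ht => (htraj t ht.1).mono Icc_subset_Ici_self, fun t ht => hU _ ⟨?_, ?_⟩, ?_, ?_⟩
    · rw [← hes0]
      exact e.symm.monotone ht.1
    · rw [e.symm_apply_le]
      exact ht.2
    · simp only [hes0, M.orbit_zero]
    · simp

end PolarModel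

theorem hasDerivWithinAt_plane_iff {γ : ℝ → Plane} {v : Plane} {s : Set ℝ} {t : ℝ} :
    HasDerivWithinAt γ v s t ↔ ∀ i, HasDerivWithinAt (fun t => γ t i) (v i) s t := by
  constructor
  · intro h i
    exact ((EuclideanSpace.proj (𝕜 := ℝ) i).hasFDerivAt.comp_hasDerivWithinAt t h :)
  · intro h
    have h1 : HasDerivWithinAt (fun t => (γ t).ofLp) v.ofLp s t := hasDerivWithinAt_pi.2 h
    exact (((PiLp.continuousLinearEquiv 2 ℝ fun _ : Fin 2 => ℝ).symm.toContinuousLinearMap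
      ).hasFDerivAt.comp_hasDerivWithinAt t h1 :)

/-- Membership in a box fixes the angle only modulo `2π`. A continuous lift cannot jump to another
translate, because the interval is shorter than `2π`. -/
theorem stays_in_interval {θ : ℝ → ℝ} (hθ : Continuous θ) {z δ : ℝ} (hδ : δ ≤ 1) {τ : ℝ}
    (h0 : θ 0 ∈ Ioo (z - δ) (z + δ))
    (h : ∀ σ ∈ Icc 0 τ, ∃ b ∈ Ioo (z - δ) (z + δ), ∃ k : ℤ, θ σ = b + k * (2 * Real.pi)) :
    ∀ σ ∈ Icc 0 τ, θ σ ∈ Ioo (z - δ) (z + δ) := by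
  have key : ∀ x, x ∈ Ioo (z - δ) (z + δ) ↔ |x - z| < δ := fun x => by
    rw [abs_lt]
    constructor <;> rintro ⟨h1, h2⟩ <;> constructor <;> linarith
  intro σ hσ
  rw [key] at h0 ⊢
  by_contra hcon
  push Not at hcon
  have hc : ContinuousOn (fun t => |θ t - z|) (Icc 0 σ) := by fun_prop
  -- On leaving the interval the lift would pass a point at distance exactly `δ` from `z`; its
  -- representative `b` lies at distance less than `δ`, which forces `k = 0` and a contradiction.
  obtain ⟨s, hs, hs1⟩ := intermediate_value_Icc hσ.1 hc ⟨h0.le, hcon⟩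
  obtain ⟨b, hb, k, hk⟩ := h s ⟨hs.1, hs.2.trans hσ.2⟩
  rw [key] at hb
  simp only at hs1
  have h1 : |(k : ℝ) * (2 * Real.pi)| < 2 := by
    have : (k : ℝ) * (2 * Real.pi) = (θ s - z) - (b - z) := by rw [hk]; ring
    rw [this]
    exact (abs_sub _ _).trans_lt (by linarith)
  have hk0 : k = 0 := by
    by_contra hne
    have h2 : (1 : ℝ) ≤ |(k : ℝ)| := by exact_mod_cast Int.one_le_abs hne
    rw [abs_mul, abs_of_pos (by positivity : (0 : ℝ) < 2 * Real.pi)] at h1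
    nlinarith [Real.pi_gt_three]
  subst hk0
  simp only [Int.cast_zero, zero_mul, add_zero] at hk
  rw [hk] at hs1
  linarith

/-! ### Product structure near an equilibrium, and the resulting types -/

namespace PolarModel

variable {F : Plane → Plane} (M : PolarModel F)

theorem exists_sstar_gt : ∃ ε, 0 < ε ∧ ∀ θ, ε < M.sstar θ := by
  obtain ⟨lo, hi, hlo, hb⟩ := M.m_bounds
  exact ⟨lo / 2, half_pos hlo, fun θ => by linarith [(M.sstar_bounds hb θ).1]⟩

/-- The point with angular coordinate `a` at height `v` above the invariant graph. -/
def pt (a v : ℝ) : Plane := polarPt M.N a (M.sstar a + v)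

theorem orbit_pt (a v τ : ℝ) :
    M.orbit a (M.sstar a + v) τ = M.pt (M.Θ a τ) (Real.exp (-τ) * v) := by
  simp [orbit, radial, pt]

theorem pt_continuousAt {z v : ℝ} (h : 0 < M.sstar z + v) :
    ContinuousAt (fun p : ℝ × ℝ => M.pt p.1 p.2) (z, v) := by
  have hc : ContinuousAt (fun p : ℝ × ℝ => (p.1, M.sstar p.1 + p.2)) (z, v) :=
    (continuous_fst.prodMk ((M.sstar_continuous.comp continuous_fst).add continuous_snd)).continuousAt
  exact ContinuousAt.comp (f := fun p : ℝ × ℝ => (p.1, M.sstar p.1 + p.2))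
    (polarPt_continuousAt (p := (z, M.sstar z + v)) h) hc

/-- The points with angular coordinate within `δ` of `z` and height less than `ε` in absolute
value. -/
def box (z δ ε : ℝ) : Set Plane :=
  slitAround z ∩ {X | angleNear z X ∈ Ioo (z - δ) (z + δ) ∧
    |‖X‖ ^ M.N - M.sstar (angleNear z X)| < ε}

theorem isOpen_box (z δ ε : ℝ) : IsOpen (M.box z δ ε) := by
  have hc : ContinuousOn (fun X : Plane =>
      (angleNear z X, |‖X‖ ^ M.N - M.sstar (angleNear z X)|)) (slitAround z) := by
    refine (angleNear_continuousOn z).prodMk (ContinuousOn.abs (ContinuousOn.sub ?_ ?_))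
    · exact (continuous_norm.pow _).continuousOn
    · exact M.sstar_continuous.comp_continuousOn (angleNear_continuousOn z)
  have := hc.isOpen_inter_preimage (isOpen_slitAround z) (isOpen_Ioo.prod (isOpen_Iio (a := ε)) :
    IsOpen (Ioo (z - δ) (z + δ) ×ˢ Iio ε))
  convert! this using 1

variable {z δ ε : ℝ}

theorem abs_lt_pi_of_mem (hδ : δ ≤ 1) {a : ℝ} (ha : a ∈ Ioo (z - δ) (z + δ)) : |a - z| < Real.pi := by
  rw [abs_lt]
  constructor <;> linarith [ha.1, ha.2, Real.pi_gt_three]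

theorem angleNear_pt (hδ : δ ≤ 1) {a v : ℝ} (ha : a ∈ Ioo (z - δ) (z + δ))
    (hv : 0 < M.sstar a + v) : angleNear z (M.pt a v) = a :=
  angleNear_polarPt hv (abs_lt_pi_of_mem hδ ha)

theorem height_pt {a v : ℝ} (hv : 0 < M.sstar a + v) : ‖M.pt a v‖ ^ M.N - M.sstar a = v := by
  rw [pt, norm_polarPt_pow M.N_ne hv]
  ring

theorem sstar_add_pos (hε : ∀ θ, ε < M.sstar θ) {a v : ℝ} (hv : |v| < ε) : 0 < M.sstar a + v := by
  linarith [(abs_lt.1 hv).1, hε a]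

theorem pt_mem_box (hδ : δ ≤ 1) (hε : ∀ θ, ε < M.sstar θ) {a v : ℝ}
    (ha : a ∈ Ioo (z - δ) (z + δ)) (hv : |v| < ε) : M.pt a v ∈ M.box z δ ε := by
  have hs := M.sstar_add_pos hε (a := a) hv
  refine ⟨polarPt_mem_slitAround hs (abs_lt_pi_of_mem hδ ha), ?_, ?_⟩
  · rwa [M.angleNear_pt hδ ha hs]
  · rwa [M.angleNear_pt hδ ha hs, M.height_pt hs]

theorem exists_pt_of_mem_box {X : Plane} (hX : X ∈ M.box z δ ε) :
    ∃ a ∈ Ioo (z - δ) (z + δ), ∃ v, |v| < ε ∧ X = M.pt a v := by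
  refine ⟨angleNear z X, hX.2.1, ‖X‖ ^ M.N - M.sstar (angleNear z X), hX.2.2, ?_⟩
  rw [pt, add_sub_cancel, polarPt_angleNear M.N_ne]

theorem center_mem_box (hδ0 : 0 < δ) (hδ : δ ≤ 1) (hε0 : 0 < ε) (hε : ∀ θ, ε < M.sstar θ) :
    M.pt z 0 ∈ M.box z δ ε :=
  M.pt_mem_box hδ hε ⟨by linarith, by linarith⟩ (by simpa using hε0)

theorem exists_box_subset {U : Set Plane} (hU : U ∈ 𝓝 (M.pt z 0)) {δ₀ : ℝ} (hδ₀ : 0 < δ₀) :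
    ∃ δ ε, 0 < δ ∧ δ ≤ δ₀ ∧ δ ≤ 1 ∧ 0 < ε ∧ (∀ θ, ε < M.sstar θ) ∧ M.box z δ ε ⊆ U := by
  obtain ⟨e, he, hes⟩ := M.exists_sstar_gt
  have hc := M.pt_continuousAt (z := z) (v := 0) (by simpa using M.sstar_pos z)
  obtain ⟨r, hr, hball⟩ := Metric.mem_nhds_iff.1 (hc hU)
  refine ⟨min r (min δ₀ 1), min r e, lt_min hr (lt_min hδ₀ one_pos),
    (min_le_right _ _).trans (min_le_left _ _), (min_le_right _ _).trans (min_le_right _ _),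
    lt_min hr he, fun θ => (min_le_right _ _).trans_lt (hes θ), fun X hX => ?_⟩
  obtain ⟨a, ha, v, hv, rfl⟩ := M.exists_pt_of_mem_box hX
  have : (a, v) ∈ Metric.ball (z, (0 : ℝ)) r := by
    rw [Metric.mem_ball, Prod.dist_eq, max_lt_iff, Real.dist_eq, Real.dist_eq, sub_zero]
    refine ⟨?_, hv.trans_le (min_le_left _ _)⟩
    rw [abs_lt]
    have := min_le_left r (min δ₀ 1)
    constructor <;> linarith [ha.1, ha.2]
  exact hball this

theorem box_mem_nhds (hδ0 : 0 < δ) (hδ : δ ≤ 1) (hε0 : 0 < ε) (hε : ∀ θ, ε < M.sstar θ) :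
    M.box z δ ε ∈ 𝓝 (M.pt z 0) :=
  (M.isOpen_box z δ ε).mem_nhds (M.center_mem_box hδ0 hδ hε0 hε)

theorem Θ_mem_of_orbit_mem_box (hδ : δ ≤ 1) (hε : ∀ θ, ε < M.sstar θ) {a s τ : ℝ} (hs : 0 < s)
    (ha : a ∈ Ioo (z - δ) (z + δ)) (h : ∀ σ ∈ Icc 0 τ, M.orbit a s σ ∈ M.box z δ ε) :
    ∀ σ ∈ Icc 0 τ, M.Θ a σ ∈ Ioo (z - δ) (z + δ) := by
  refine stays_in_interval (M.Θ_continuous a) hδ (by rwa [M.Θ_zero]) fun σ hσ => ?_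
  obtain ⟨b, hb, v, hv, heq⟩ := M.exists_pt_of_mem_box (h σ hσ)
  exact ⟨b, hb, (polarPt_inj M.N_ne (M.radial_pos a hs hσ.1) (M.sstar_add_pos hε hv) heq).2⟩

/-- The height shrinks along orbits, so an orbit can leave a box forwards only through its angular
sides. -/
theorem flowsTo_box_iff (hδ : δ ≤ 1) (hε : ∀ θ, ε < M.sstar θ) {a v : ℝ}
    (ha : a ∈ Ioo (z - δ) (z + δ)) (hv : |v| < ε) {y : Plane} :
    FlowsTo F (M.box z δ ε) (M.pt a v) y ↔ ∃ τ, 0 ≤ τ ∧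
      (∀ σ ∈ Icc 0 τ, M.Θ a σ ∈ Ioo (z - δ) (z + δ)) ∧ y = M.pt (M.Θ a τ) (Real.exp (-τ) * v) := by
  have hs := M.sstar_add_pos hε (a := a) hv
  rw [pt, M.flowsTo_polarPt_iff hs]
  constructor
  · rintro ⟨τ, hτ, rfl, hU⟩
    exact ⟨τ, hτ, M.Θ_mem_of_orbit_mem_box hδ hε hs ha hU, M.orbit_pt a v τ⟩
  · rintro ⟨τ, hτ, hU, rfl⟩
    refine ⟨τ, hτ, (M.orbit_pt a v τ).symm, fun σ hσ => ?_⟩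
    rw [M.orbit_pt]
    refine M.pt_mem_box hδ hε (hU σ hσ) ?_
    rw [abs_mul, abs_of_pos (Real.exp_pos _)]
    have : Real.exp (-σ) ≤ 1 := Real.exp_le_one_iff.2 (by linarith [hσ.1])
    nlinarith [abs_nonneg v]

/-- The chart that straightens the invariant graph and conjugates the angular dynamics by `φ`. -/
def conjChart (φ : OpenPartialHomeomorph ℝ ℝ) (hφ : φ.source = Ioo (z - δ) (z + δ)) (hδ : δ ≤ 1)
    (hε : ∀ θ, ε < M.sstar θ) : OpenPartialHomeomorph Plane Plane where
  toFun X := !₂[φ (angleNear z X), ‖X‖ ^ M.N - M.sstar (angleNear z X)]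
  invFun Y := M.pt (φ.symm (Y 0)) (Y 1)
  source := M.box z δ ε
  target := {Y | Y 0 ∈ φ.target ∧ |Y 1| < ε}
  map_source' X hX := by
    refine ⟨φ.map_source ?_, hX.2.2⟩
    rw [hφ]
    exact hX.2.1
  map_target' Y hY := M.pt_mem_box hδ hε (hφ ▸ φ.map_target hY.1) hY.2
  left_inv' X hX := by
    obtain ⟨a, ha, v, hv, rfl⟩ := M.exists_pt_of_mem_box hX
    have hs := M.sstar_add_pos hε (a := a) hv
    show M.pt (φ.symm (φ (angleNear z (M.pt a v)))) (‖M.pt a v‖ ^ M.N - M.sstar _) = _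
    rw [M.angleNear_pt hδ ha hs, M.height_pt hs, φ.left_inv (by rwa [hφ])]
  right_inv' Y hY := by
    have ha : φ.symm (Y 0) ∈ Ioo (z - δ) (z + δ) := hφ ▸ φ.map_target hY.1
    have hs := M.sstar_add_pos hε (a := φ.symm (Y 0)) hY.2
    rw [M.angleNear_pt hδ ha hs, M.height_pt hs, φ.right_inv hY.1]
    ext i
    fin_cases i <;> rfl
  open_source := M.isOpen_box z δ ε
  open_target := by
    have h0 : Continuous fun Y : Plane => Y 0 := by fun_prop
    have h1 : Continuous fun Y : Plane => |Y 1| := by fun_prop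
    exact (φ.open_target.preimage h0).inter (isOpen_Iio.preimage h1)
  continuousOn_toFun := by
    have hang : ContinuousOn (angleNear z) (M.box z δ ε) :=
      (angleNear_continuousOn z).mono inter_subset_left
    refine (PiLp.continuous_toLp 2 _).comp_continuousOn (continuousOn_pi.2 fun i => ?_)
    fin_cases i
    · refine φ.continuousOn.comp hang fun X hX => ?_
      rw [hφ]
      exact hX.2.1
    · exact (continuous_norm.pow _).continuousOn.sub (M.sstar_continuous.comp_continuousOn hang)
  continuousOn_invFun := by
    intro Y hY
    have h0 : ContinuousWithinAt (fun Y : Plane => φ.symm (Y 0))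
        {Y : Plane | Y 0 ∈ φ.target ∧ |Y 1| < ε} Y := by
      have h0 : Continuous fun Y : Plane => Y 0 := by fun_prop
      exact ((φ.symm.continuousAt hY.1).comp (f := fun Y : Plane => Y 0)
        h0.continuousAt).continuousWithinAt
    have h1 : Continuous fun Y : Plane => Y 1 := by fun_prop
    exact ContinuousAt.comp_continuousWithinAt (f := fun Y : Plane => (φ.symm (Y 0), Y 1))
      (M.pt_continuousAt (M.sstar_add_pos hε hY.2)) (h0.prodMk h1.continuousWithinAt)

theorem conjChart_pt (φ : OpenPartialHomeomorph ℝ ℝ) (hφ : φ.source = Ioo (z - δ) (z + δ))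
    (hδ : δ ≤ 1) (hε : ∀ θ, ε < M.sstar θ) {a v : ℝ} (ha : a ∈ Ioo (z - δ) (z + δ))
    (hv : |v| < ε) : M.conjChart φ hφ hδ hε (M.pt a v) = !₂[φ a, v] := by
  have hs := M.sstar_add_pos hε (a := a) hv
  show !₂[φ (angleNear z (M.pt a v)), ‖M.pt a v‖ ^ M.N - M.sstar (angleNear z (M.pt a v))] = _
  rw [M.angleNear_pt hδ ha hs, M.height_pt hs]

theorem locallyLipschitz_neg_id : LocallyLipschitz fun y : ℝ => -y :=
  LipschitzWith.id.neg.locallyLipschitz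

theorem exp_neg_unique {y : ℝ → ℝ} {T : ℝ}
    (hy : ∀ t ∈ Icc 0 T, HasDerivWithinAt y (-y t) (Icc 0 T) t) :
    ∀ t ∈ Icc 0 T, y t = Real.exp (-t) * y 0 := by
  refine autonomous_unique_right (F := fun y : ℝ => -y) locallyLipschitz_neg_id hy
    (fun t _ => ?_) (by simp)
  have h2 : HasDerivAt (fun τ => Real.exp (-τ)) (-Real.exp (-t)) t := by
    simpa using (hasDerivAt_neg t).exp
  simpa using (h2.mul_const (y 0)).hasDerivWithinAt

/-- A conjugacy of the angular dynamics near `z` yields a local topological equivalence. -/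
theorem locallyTopEquivalent_of_isLineConj {q : ℝ → ℝ} {φ : OpenPartialHomeomorph ℝ ℝ}
    (H : IsLineConj M.h q z δ φ) (hq : LocallyLipschitz q) (hδ : δ ≤ 1) :
    LocallyTopEquivalent F (M.pt z 0) (fun X => !₂[q (X 0), -X 1]) 0 := by
  obtain ⟨ε, hε0, hε⟩ := M.exists_sstar_gt
  set Φ := M.conjChart φ H.source hδ hε with hΦ
  have hz : z ∈ Ioo (z - δ) (z + δ) := H.source ▸ H.center_mem
  refine ⟨Φ, M.center_mem_box H.pos hδ hε0 hε, ?_, fun x hx y hy => ?_⟩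
  · rw [hΦ, M.conjChart_pt φ H.source hδ hε hz (by simpa using hε0), H.map_center]
    ext i
    fin_cases i <;> rfl
  obtain ⟨a, ha, v, hv, rfl⟩ := M.exists_pt_of_mem_box hx
  obtain ⟨b, hb, w, hw, rfl⟩ := M.exists_pt_of_mem_box hy
  have hsrc : Φ.source = M.box z δ ε := rfl
  have htgt : Φ.target = {Y | Y 0 ∈ φ.target ∧ |Y 1| < ε} := rfl
  have hxΦ : Φ (M.pt a v) = !₂[φ a, v] := M.conjChart_pt φ H.source hδ hε ha hv
  rw [hsrc, M.flowsTo_box_iff hδ hε ha hv]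
  have hsmall : ∀ t, 0 ≤ t → |Real.exp (-t) * v| < ε := by
    intro t ht
    rw [abs_mul, abs_of_pos (Real.exp_pos _)]
    have : Real.exp (-t) ≤ 1 := Real.exp_le_one_iff.2 (by linarith)
    nlinarith [abs_nonneg v]
  constructor
  · rintro ⟨τ, hτ, hU, heq⟩
    refine ⟨τ, hτ, fun t => !₂[φ (M.Θ a t), Real.exp (-t) * v], ?_, ?_, ?_, ?_⟩
    · intro t ht
      rw [hasDerivWithinAt_plane_iff]
      intro i
      fin_cases i
      · exact H.map_solution M.lip.locallyLipschitz
          (fun t _ => (M.Θ_deriv a t).hasDerivWithinAt) (fun t ht => H.source ▸ hU t ht) t ht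
      · have h2 : HasDerivAt (fun τ => Real.exp (-τ)) (-Real.exp (-t)) t := by
          simpa using (hasDerivAt_neg t).exp
        simpa using (h2.mul_const v).hasDerivWithinAt
    · intro t ht
      exact ⟨φ.map_source (by rw [H.source]; exact hU t ht), hsmall t ht.1⟩
    · rw [hxΦ]
      simp [M.Θ_zero]
    · rw [heq]
      exact (M.conjChart_pt φ H.source hδ hε (hU τ ⟨hτ, le_rfl⟩) (hsmall τ hτ)).symm
  · rintro ⟨T, hT, γ, hγ, hU, h0, h1⟩
    have hγ' := fun t ht => hasDerivWithinAt_plane_iff.1 (hγ t ht)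
    -- The two coordinates of the model decouple, so uniqueness for each scalar equation identifies
    -- `γ` with the image of an orbit.
    have hA : ∀ t ∈ Icc 0 T, φ.symm (γ t 0) = M.Θ (φ.symm (γ 0 0)) t :=
      M.Θ_unique_Icc (H.symm_map_solution hq (y := fun t => γ t 0) (fun t ht => hγ' t ht 0)
        fun t ht => (hU t ht).1)
    have hB : ∀ t ∈ Icc 0 T, γ t 1 = Real.exp (-t) * γ 0 1 :=
      exp_neg_unique (y := fun t => γ t 1) fun t ht => hγ' t ht 1
    have h00 : φ.symm (γ 0 0) = a := by
      rw [h0, hxΦ]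
      exact φ.left_inv (by rwa [H.source])
    have h01 : γ 0 1 = v := by
      rw [h0, hxΦ]
      rfl
    rw [h00] at hA
    rw [h01] at hB
    refine ⟨T, hT, fun t ht => ?_, ?_⟩
    · rw [← hA t ht, ← H.source]
      exact φ.map_target (hU t ht).1
    · have h2 : Φ.symm (γ T) = M.pt b w := by
        rw [h1]
        exact Φ.left_inv hy
      rw [← h2, ← hA T ⟨hT, le_rfl⟩, ← hB T ⟨hT, le_rfl⟩]
      rfl

theorem orbit_tendsto {a s : ℝ} (h : Tendsto (M.Θ a) atTop (𝓝 z)) :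
    Tendsto (M.orbit a s) atTop (𝓝 (M.pt z 0)) := by
  have hv : Tendsto (fun τ => Real.exp (-τ) * (s - M.sstar a)) atTop (𝓝 0) := by
    simpa using Real.tendsto_exp_neg_atTop_nhds_zero.mul_const (s - M.sstar a)
  have hc := (M.pt_continuousAt (z := z) (v := 0) (by simpa using M.sstar_pos z)).tendsto
  refine (hc.comp (h.prodMk_nhds hv)).congr fun τ => ?_
  rw [Function.comp_apply, ← M.orbit_pt, add_sub_cancel]

/-- Small boxes are positively invariant: the angle does not move away from `z` and the height
contracts. -/
theorem isSink_of_attracting (hz : F (M.pt z 0) = 0) {δ₀ : ℝ} (hδ₀ : 0 < δ₀)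
    (H : ∀ a ∈ Ioo (z - δ₀) (z + δ₀), Tendsto (M.Θ a) atTop (𝓝 z) ∧
      ∀ τ, 0 ≤ τ → |M.Θ a τ - z| ≤ |a - z|) : IsSink F (M.pt z 0) := by
  refine ⟨hz, fun U hU => ?_⟩
  obtain ⟨δ, ε, hδ0, hδ1, hδ, hε0, hε, hsub⟩ := M.exists_box_subset hU hδ₀
  refine ⟨M.box z δ ε, M.box_mem_nhds hδ0 hδ hε0 hε, fun x hx => ?_⟩
  obtain ⟨a, ha, v, hv, rfl⟩ := M.exists_pt_of_mem_box hx
  obtain ⟨h1, h2⟩ := H a ⟨by linarith [ha.1], by linarith [ha.2]⟩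
  have hs := M.sstar_add_pos hε (a := a) hv
  obtain ⟨C, hC, HT⟩ := M.exists_forward_time hs
  obtain ⟨T, hT0, htraj, -⟩ := HT a _ le_rfl
  have hTs0 : T.symm 0 = 0 := (T.symm_apply_eq).2 hT0.symm
  refine ⟨_, htraj, ?_, fun t ht => hsub ?_, (M.orbit_tendsto h1).comp T.symm.tendsto_atTop⟩
  · simp only [hTs0, M.orbit_zero]
    rfl
  · have hτ : 0 ≤ T.symm t := by
      rw [← hTs0]
      exact T.symm.monotone ht
    simp only [M.orbit_pt]
    refine M.pt_mem_box hδ hε ?_ ?_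
    · have h3 := abs_le.1 (h2 _ hτ)
      have h4 : |a - z| < δ := by
        rw [abs_lt]
        constructor <;> linarith [ha.1, ha.2]
      constructor <;> linarith
    · rw [abs_mul, abs_of_pos (Real.exp_pos _)]
      have : Real.exp (-T.symm t) ≤ 1 := Real.exp_le_one_iff.2 (by linarith)
      nlinarith [abs_nonneg v]

/-- Points of the invariant graph arbitrarily close to the equilibrium keep their angular distance
from it, so their trajectories cannot converge to it. -/
theorem not_isSink_of_repelling
    (H : ∀ η, 0 < η → ∃ a, 0 < |a - z| ∧ |a - z| < η ∧ ∀ τ, 0 ≤ τ → |a - z| ≤ |M.Θ a τ - z|) :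
    ¬ IsSink F (M.pt z 0) := by
  rintro ⟨-, hsink⟩
  obtain ⟨ε, hε0, hε⟩ := M.exists_sstar_gt
  -- Confining trajectories to a box of angular radius `1` makes `angleNear` follow the lifted angle
  -- `Θ`.
  obtain ⟨V, hV, hVx⟩ := hsink _ (M.box_mem_nhds (z := z) one_pos le_rfl hε0 hε)
  have hpos : 0 < M.sstar z + 0 := by simpa using M.sstar_pos z
  have hc : ContinuousAt (fun a => M.pt a 0) z :=
    ContinuousAt.comp (f := fun a : ℝ => (a, (0 : ℝ))) (M.pt_continuousAt hpos)
      (Continuous.prodMk_left 0).continuousAt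
  obtain ⟨r, hr, hball⟩ := Metric.mem_nhds_iff.1 (hc hV)
  obtain ⟨a, ha0, har, harep⟩ := H (min r 1) (lt_min hr one_pos)
  have haV : M.pt a 0 ∈ V := hball (by
    rw [Metric.mem_ball, Real.dist_eq]
    exact har.trans_le (min_le_left _ _))
  have ha1 : a ∈ Ioo (z - 1) (z + 1) := by
    have := abs_lt.1 (har.trans_le (min_le_right _ _))
    constructor <;> linarith [this.1, this.2]
  obtain ⟨γ, hγ, hγ0, hγU, hγt⟩ := hVx _ haV
  have hs : 0 < M.sstar a + 0 := by simpa using M.sstar_pos a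
  obtain ⟨C, hC, HT⟩ := M.exists_normalised_time hs
  have hfar : ∀ t, 0 ≤ t → |a - z| ≤ |angleNear z (γ t) - z| := by
    intro t ht
    obtain ⟨τ, hτ, -, heq, hall⟩ := HT a _ le_rfl γ t ht (hγ.mono Icc_subset_Ici_self) hγ0
    have hbox : ∀ σ ∈ Icc 0 τ, M.orbit a (M.sstar a + 0) σ ∈ M.box z 1 ε := by
      intro σ hσ
      obtain ⟨u, hu, hueq⟩ := hall σ hσ
      exact hueq ▸ hγU u hu.1
    have hΘ := M.Θ_mem_of_orbit_mem_box le_rfl hε hs ha1 hbox τ ⟨hτ, le_rfl⟩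
    have : angleNear z (γ t) = M.Θ a τ := by
      rw [heq]
      exact angleNear_polarPt (M.radial_pos a hs hτ) (abs_lt_pi_of_mem le_rfl hΘ)
    rw [this]
    exact harep τ hτ
  have hcz : ContinuousAt (angleNear z) (M.pt z 0) :=
    (angleNear_continuousOn z).continuousAt ((isOpen_slitAround z).mem_nhds
      (polarPt_mem_slitAround hpos (by simpa using Real.pi_pos)))
  have hlim : Tendsto (fun t => |angleNear z (γ t) - z|) atTop (𝓝 |angleNear z (M.pt z 0) - z|) :=
    ((hcz.tendsto.comp hγt).sub_const z).abs
  rw [show angleNear z (M.pt z 0) = z from angleNear_polarPt hpos (by simpa using Real.pi_pos),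
    sub_self, abs_zero] at hlim
  have := ge_of_tendsto hlim ((eventually_ge_atTop 0).mono fun t ht => hfar t ht)
  linarith

theorem _root_.exists_mem_fst_ne_zero {V : Set Plane} (hV : IsOpen V) (hne : V.Nonempty) :
    ∃ Y ∈ V, Y 0 ≠ 0 := by
  obtain ⟨Y, hY⟩ := hne
  by_cases h0 : Y 0 = 0
  · have hc : Continuous fun t : ℝ => Y + t • (!₂[1, 0] : Plane) := by fun_prop
    have h1 : ∀ᶠ t in 𝓝[≠] (0 : ℝ), Y + t • (!₂[1, 0] : Plane) ∈ V :=
      (hc.continuousAt.eventually_mem (hV.mem_nhds (by simpa using hY))).filter_mono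
        nhdsWithin_le_nhds
    obtain ⟨t, ht, ht0⟩ := (h1.and self_mem_nhdsWithin).exists
    exact ⟨_, ht, by simpa [h0] using ht0⟩
  · exact ⟨Y, hY, h0⟩

theorem _root_.flowsTo_saddle_abs_le {V : Set Plane} {x y : Plane}
    (h : FlowsTo (fun X => !₂[X 0, -X 1]) V x y) : |x 0| ≤ |y 0| := by
  obtain ⟨T, hT, γ, hγ, -, rfl, rfl⟩ := h
  have h1 : EqOn (fun t => γ t 0) (fun t => Real.exp t * γ 0 0) (Icc 0 T) := by
    refine autonomous_unique_right (F := fun y : ℝ => y) LipschitzWith.id.locallyLipschitz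
      (fun t ht => hasDerivWithinAt_plane_iff.1 (hγ t ht) 0) (fun t _ => ?_) (by simp)
    exact ((Real.hasDerivAt_exp t).mul_const _).hasDerivWithinAt
  have h2 := h1 ⟨hT, le_rfl⟩
  simp only at h2
  rw [h2, abs_mul, abs_of_pos (Real.exp_pos T)]
  exact le_mul_of_one_le_left (abs_nonneg _) (Real.one_le_exp hT)

/-- An open set of points would tend to the equilibrium while staying near it. In the model saddle
only points of the line `x = 0` can do so, and that line has empty interior. -/
theorem not_isSaddle_of_attracting
    (H : ∀ η, 0 < η → ∃ O : Set ℝ, IsOpen O ∧ O.Nonempty ∧ O ⊆ Ioo (z - η) (z + η) ∧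
      ∀ a ∈ O, Tendsto (M.Θ a) atTop (𝓝 z) ∧ ∀ τ, 0 ≤ τ → |M.Θ a τ - z| ≤ |a - z|) :
    ¬ IsSaddle F (M.pt z 0) := by
  rintro ⟨-, Φ, hp, hΦp, hflow⟩
  obtain ⟨δ, ε, hδ0, -, hδ, hε0, hε, hsub⟩ :=
    M.exists_box_subset (Φ.open_source.mem_nhds hp) one_pos
  obtain ⟨O, hO, ⟨a₀, ha₀⟩, hOsub, hOa⟩ := H δ hδ0
  have hcoord : ContinuousOn (angleNear z) (M.box z δ ε) :=
    (angleNear_continuousOn z).mono inter_subset_left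
  have hW : IsOpen (M.box z δ ε ∩ angleNear z ⁻¹' O) :=
    hcoord.isOpen_inter_preimage (M.isOpen_box z δ ε) hO
  have hWsub : M.box z δ ε ∩ angleNear z ⁻¹' O ⊆ Φ.source := inter_subset_left.trans hsub
  have hne : (Φ '' (M.box z δ ε ∩ angleNear z ⁻¹' O)).Nonempty := by
    refine ⟨_, mem_image_of_mem Φ (x := M.pt a₀ 0)
      ⟨M.pt_mem_box hδ hε (hOsub ha₀) (by simpa using hε0), ?_⟩⟩
    rw [mem_preimage, M.angleNear_pt hδ (hOsub ha₀) (by simpa using M.sstar_pos a₀)]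
    exact ha₀
  obtain ⟨_, ⟨X, ⟨hXb, hXO⟩, rfl⟩, hX0⟩ :=
    exists_mem_fst_ne_zero (Φ.isOpen_image_of_subset_source hW hWsub) hne
  obtain ⟨a, ha, v, hv, rfl⟩ := M.exists_pt_of_mem_box hXb
  have hs := M.sstar_add_pos hε (a := a) hv
  rw [mem_preimage, M.angleNear_pt hδ ha hs] at hXO
  obtain ⟨hlim, hnear⟩ := hOa a hXO
  have hstay : ∀ τ, 0 ≤ τ → M.orbit a (M.sstar a + v) τ ∈ M.box z δ ε := by
    intro τ hτ
    rw [M.orbit_pt]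
    refine M.pt_mem_box hδ hε ?_ ?_
    · have h3 := abs_le.1 (hnear _ hτ)
      have h4 : |a - z| < δ := by
        rw [abs_lt]
        constructor <;> linarith [ha.1, ha.2]
      constructor <;> linarith
    · rw [abs_mul, abs_of_pos (Real.exp_pos _)]
      have : Real.exp (-τ) ≤ 1 := Real.exp_le_one_iff.2 (by linarith)
      nlinarith [abs_nonneg v]
  -- In the model `|x|` never decreases along trajectories; the limit of the orbit being the
  -- equilibrium, the initial `|x|` must be `0`.
  have hfar : ∀ τ, 0 ≤ τ → |Φ (M.pt a v) 0| ≤ |Φ (M.orbit a (M.sstar a + v) τ) 0| := by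
    intro τ hτ
    refine flowsTo_saddle_abs_le (V := Φ.target) ?_
    rw [← hflow _ (hsub hXb) _ (hsub (hstay τ hτ))]
    rw [show M.pt a v = polarPt M.N a (M.sstar a + v) from rfl, M.flowsTo_polarPt_iff hs]
    exact ⟨τ, hτ, rfl, fun σ hσ => hsub (hstay σ hσ.1)⟩
  have h0 : Continuous fun Y : Plane => |Y 0| := by fun_prop
  have hlim2 : Tendsto (fun τ => |Φ (M.orbit a (M.sstar a + v) τ) 0|) atTop (𝓝 |Φ (M.pt z 0) 0|) :=
    (h0.tendsto _).comp ((Φ.continuousAt hp).tendsto.comp (M.orbit_tendsto hlim))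
  have := ge_of_tendsto hlim2 ((eventually_ge_atTop 0).mono fun τ hτ => hfar τ hτ)
  rw [hΦp] at this
  simp only [PiLp.zero_apply, abs_zero] at this
  exact hX0 (abs_nonpos_iff.1 this)

end PolarModel

/-! ### Signs of a function near its zeros, and gaps of periodic sets -/

section LineSigns

variable {h : ℝ → ℝ}

theorem exists_Ioc_of_eventually_right {P : ℝ → Prop} {z : ℝ} (h : ∀ᶠ x in 𝓝[>] z, P x) :
    ∃ δ, 0 < δ ∧ ∀ x ∈ Ioc z (z + δ), P x := by
  obtain ⟨u, hu, hsub⟩ := mem_nhdsGT_iff_exists_Ioc_subset.1 h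
  exact ⟨u - z, sub_pos.2 hu, fun x hx => hsub (by simpa using hx)⟩

theorem exists_Ico_of_eventually_left {P : ℝ → Prop} {z : ℝ} (h : ∀ᶠ x in 𝓝[<] z, P x) :
    ∃ δ, 0 < δ ∧ ∀ x ∈ Ico (z - δ) z, P x := by
  obtain ⟨u, hu, hsub⟩ := mem_nhdsLT_iff_exists_Ico_subset.1 h
  exact ⟨z - u, sub_pos.2 hu, fun x hx => hsub (by simpa using hx)⟩

theorem exists_common_radius {P Q : ℝ → Prop} {z : ℝ} (hP : ∀ᶠ x in 𝓝[>] z, P x)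
    (hQ : ∀ᶠ x in 𝓝[<] z, Q x) : ∃ δ, 0 < δ ∧ δ ≤ 1 ∧ (∀ x ∈ Ioc z (z + δ), P x) ∧
      ∀ x ∈ Ico (z - δ) z, Q x := by
  obtain ⟨r, hr, h1⟩ := exists_Ioc_of_eventually_right hP
  obtain ⟨l, hl, h2⟩ := exists_Ico_of_eventually_left hQ
  have hmr := min_le_left r l
  have hml := min_le_right r l
  have hm := min_le_left (min r l) 1
  exact ⟨min (min r l) 1, lt_min (lt_min hr hl) one_pos, min_le_right _ _,
    fun x hx => h1 x ⟨hx.1, by linarith [hx.2]⟩, fun x hx => h2 x ⟨by linarith [hx.1], hx.2⟩⟩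

theorem sign_right (hc : Continuous h) {z : ℝ} (hiso : ∀ᶠ x in 𝓝[≠] z, h x ≠ 0) :
    (∀ᶠ x in 𝓝[>] z, 0 < h x) ∨ ∀ᶠ x in 𝓝[>] z, h x < 0 := by
  obtain ⟨δ, hδ, hne⟩ := exists_Ioc_of_eventually_right
    (hiso.filter_mono (nhdsWithin_mono z fun x (hx : z < x) => hx.ne'))
  have hmem : Ioo z (z + δ) ∈ 𝓝[>] z := Ioo_mem_nhdsGT (by linarith)
  exact (pos_or_neg_of_ne_zero hc fun y hy => hne y (Ioo_subset_Ioc_self hy)).imp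
    (mem_of_superset hmem) (mem_of_superset hmem)

theorem sign_left (hc : Continuous h) {z : ℝ} (hiso : ∀ᶠ x in 𝓝[≠] z, h x ≠ 0) :
    (∀ᶠ x in 𝓝[<] z, 0 < h x) ∨ ∀ᶠ x in 𝓝[<] z, h x < 0 := by
  obtain ⟨δ, hδ, hne⟩ := exists_Ico_of_eventually_left
    (hiso.filter_mono (nhdsWithin_mono z fun x (hx : x < z) => hx.ne))
  have hmem : Ioo (z - δ) z ∈ 𝓝[<] z := Ioo_mem_nhdsLT (by linarith)
  exact (pos_or_neg_of_ne_zero hc fun y hy => hne y (Ioo_subset_Ico_self hy)).imp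
    (mem_of_superset hmem) (mem_of_superset hmem)

/-- Between two points such that `h` is negative just after the first and positive just before the
second there is a zero at which `h` changes sign from negative to positive. -/
theorem exists_repelling_between (hc : Continuous h)
    (hiso : ∀ z, h z = 0 → ∀ᶠ x in 𝓝[≠] z, h x ≠ 0) {z w : ℝ} (hzw : z < w)
    (hz : ∀ᶠ x in 𝓝[>] z, h x < 0) (hw : ∀ᶠ x in 𝓝[<] w, 0 < h x) :
    ∃ c ∈ Ioo z w, h c = 0 ∧ (∀ᶠ x in 𝓝[>] c, 0 < h x) ∧ ∀ᶠ x in 𝓝[<] c, h x < 0 := by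
  -- The zero sought is `sSup A`, the last place where `h` stops being negative.
  set A := {x | x ∈ Ioo z w ∧ h x < 0} with hA
  obtain ⟨x₀, hx₀⟩ : A.Nonempty := (hz.and (Ioo_mem_nhdsGT hzw)).exists.imp fun x hx => ⟨hx.2, hx.1⟩
  have hbdd : BddAbove A := ⟨w, fun x hx => hx.1.2.le⟩
  obtain ⟨δ, hδ, hpos⟩ := exists_Ico_of_eventually_left hw
  set c := sSup A with hcdef
  have hx₀c : x₀ ≤ c := le_csSup hbdd hx₀
  have hcw : c < w := by
    have : c ≤ max (w - δ) x₀ := by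
      refine csSup_le ⟨x₀, hx₀⟩ fun x hx => ?_
      by_contra hlt
      push Not at hlt
      have := hpos x ⟨((le_max_left _ _).trans_lt hlt).le, hx.1.2⟩
      linarith [hx.2]
    exact this.trans_lt (max_lt (by linarith) hx₀.1.2)
  have hzc : z < c := hx₀.1.1.trans_le hx₀c
  have hafter : ∀ x, c < x → x < w → 0 ≤ h x := by
    intro x hx hxw
    by_contra hneg
    push Not at hneg
    exact absurd (le_csSup hbdd (⟨⟨hzc.trans hx, hxw⟩, hneg⟩ : x ∈ A)) (not_le.2 hx)
  have hge : 0 ≤ h c := by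
    have ht : Tendsto h (𝓝[>] c) (𝓝 (h c)) := hc.continuousAt.mono_left nhdsWithin_le_nhds
    refine ge_of_tendsto ht ?_
    filter_upwards [Ioo_mem_nhdsGT hcw] with x hx
    exact hafter x hx.1 hx.2
  have hle : h c ≤ 0 := by
    have hcl := csSup_mem_closure ⟨x₀, hx₀⟩ hbdd
    have hsub : A ⊆ {x | h x ≤ 0} := fun x hx => hx.2.le
    exact closure_minimal hsub (isClosed_le hc continuous_const) hcl
  have h0 : h c = 0 := le_antisymm hle hge
  refine ⟨c, ⟨hzc, hcw⟩, h0, ?_, ?_⟩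
  · rcases sign_right hc (hiso c h0) with hp | hn
    · exact hp
    · obtain ⟨x, hx, hx'⟩ := (hn.and (Ioo_mem_nhdsGT hcw)).exists
      exact absurd (hafter x hx'.1 hx'.2) (not_le.2 hx)
  -- Positivity just before `c` would leave no points of `A` near its supremum.
  · rcases sign_left hc (hiso c h0) with hp | hn
    · obtain ⟨η, hη, hpos'⟩ := exists_Ico_of_eventually_left hp
      obtain ⟨x, hx, hxc⟩ := exists_lt_of_lt_csSup ⟨x₀, hx₀⟩ (show c - η < sSup A by linarith)
      rcases (le_csSup hbdd hx).lt_or_eq with hlt | heq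
      · linarith [hpos' x ⟨hxc.le, hlt⟩, hx.2]
      · have hx2 := hx.2
        rw [show x = c from heq, h0] at hx2
        exact absurd hx2 (lt_irrefl 0)
    · exact hn

theorem exists_attracting_between (hc : Continuous h)
    (hiso : ∀ z, h z = 0 → ∀ᶠ x in 𝓝[≠] z, h x ≠ 0) {z w : ℝ} (hzw : z < w)
    (hz : ∀ᶠ x in 𝓝[>] z, 0 < h x) (hw : ∀ᶠ x in 𝓝[<] w, h x < 0) :
    ∃ c ∈ Ioo z w, h c = 0 ∧ (∀ᶠ x in 𝓝[>] c, h x < 0) ∧ ∀ᶠ x in 𝓝[<] c, 0 < h x := by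
  simpa using exists_repelling_between (h := fun x => -h x) hc.neg (by simpa using hiso) hzw
    (by simpa using hz) (by simpa using hw)

/-- A point off a closed periodic set lies in a bounded gap of it. -/
theorem exists_gap {Z : Set ℝ} (hZ : IsClosed Z) {p : ℝ} (hp : 0 < p)
    (hper : ∀ x ∈ Z, ∀ k : ℤ, x + k * p ∈ Z) (hne : Z.Nonempty) {a : ℝ} (ha : a ∉ Z) :
    ∃ z ∈ Z, ∃ w ∈ Z, a ∈ Ioo z w ∧ ∀ y ∈ Ioo z w, y ∉ Z := by
  obtain ⟨x, hx⟩ := hne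
  have hlow : (Z ∩ Iic a).Nonempty := by
    obtain ⟨k, hk⟩ := exists_int_lt ((a - x) / p)
    refine ⟨_, hper x hx k, ?_⟩
    rw [lt_div_iff₀ hp] at hk
    rw [mem_Iic]
    linarith
  have hhigh : (Z ∩ Ici a).Nonempty := by
    obtain ⟨k, hk⟩ := exists_int_gt ((a - x) / p)
    refine ⟨_, hper x hx k, ?_⟩
    rw [div_lt_iff₀ hp] at hk
    rw [mem_Ici]
    linarith
  have bl : BddAbove (Z ∩ Iic a) := ⟨a, fun y hy => hy.2⟩
  have bh : BddBelow (Z ∩ Ici a) := ⟨a, fun y hy => hy.2⟩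
  have ml := (hZ.inter isClosed_Iic).csSup_mem hlow bl
  have mh := (hZ.inter isClosed_Ici).csInf_mem hhigh bh
  refine ⟨_, ml.1, _, mh.1, ⟨lt_of_le_of_ne ml.2 fun he => ha (he ▸ ml.1),
    lt_of_le_of_ne mh.2 fun he => ha (he ▸ mh.1)⟩, fun y hy hyZ => ?_⟩
  rcases le_total y a with hya | hya
  · exact absurd (le_csSup bl ⟨hyZ, hya⟩) (not_le.2 hy.1)
  · exact absurd (csInf_le bh ⟨hyZ, hya⟩) (not_le.2 hy.2)

end LineSigns

/-- Borsuk–Ulam in dimension one: the difference of the values at antipodal points changes sign over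
a half turn, hence vanishes somewhere. -/
theorem not_injective_circle_real {f : Circle → ℝ} (hf : Continuous f) :
    ¬ Function.Injective f := by
  intro hinj
  let d : ℝ → ℝ := fun t => f (Circle.exp t) - f (Circle.exp (t + Real.pi))
  have hd : Continuous d := by
    have h1 : Continuous fun t : ℝ => Circle.exp t := Circle.exp.continuous
    exact (hf.comp h1).sub (hf.comp (h1.comp (continuous_id.add continuous_const)))
  have hanti : d (0 + Real.pi) = -d 0 := by
    simp only [d]
    rw [show (0 : ℝ) + Real.pi + Real.pi = 0 + 2 * Real.pi by ring, Circle.exp_add 0 (2 * Real.pi),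
      Circle.exp_two_pi, mul_one]
    ring
  obtain ⟨t, ht⟩ : ∃ t, d t = 0 := by
    rcases le_total (d 0) 0 with h0 | h0
    · exact mem_range_of_exists_le_of_exists_ge hd ⟨0, h0⟩ ⟨0 + Real.pi, by rw [hanti]; linarith⟩
    · exact mem_range_of_exists_le_of_exists_ge hd ⟨0 + Real.pi, by rw [hanti]; linarith⟩ ⟨0, h0⟩
  have heq := hinj (sub_eq_zero.1 ht)
  rw [Circle.exp_add, left_eq_mul] at heq
  have := congrArg (fun z : Circle => (z : ℂ)) heq
  simp only [Circle.coe_exp, Complex.exp_pi_mul_I, Circle.coe_one] at this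
  norm_num at this

/-! ### Sign patterns, the invariant circle, uniqueness and alternation -/

namespace PolarModel

variable {F : Plane → Plane} (M : PolarModel F) {z : ℝ}

theorem h_continuous : Continuous M.h := M.lip.continuous

theorem pt_add_int_mul (a v : ℝ) (k : ℤ) : M.pt (a + k * (2 * Real.pi)) v = M.pt a v := by
  rw [pt, (M.sstar_periodic.int_mul k) a, polarPt_add_int_mul, pt]

theorem pt_zero_continuous : Continuous fun a => M.pt a 0 :=
  polarPt_comp_continuous continuous_id (M.sstar_continuous.add continuous_const)
    fun a => by simpa using M.sstar_pos a

theorem sstar_add_zero_pos (a : ℝ) : 0 < M.sstar a + 0 := by simpa using M.sstar_pos a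

theorem pt_ne_zero (a : ℝ) : M.pt a 0 ≠ 0 := polarPt_ne_zero (M.sstar_add_zero_pos a) a

theorem pt_zero_inj {a b : ℝ} (h : M.pt a 0 = M.pt b 0) : ∃ k : ℤ, a = b + k * (2 * Real.pi) :=
  (polarPt_inj M.N_ne (M.sstar_add_zero_pos a) (M.sstar_add_zero_pos b) h).2

theorem F_pt_eq_zero_iff : F (M.pt z 0) = 0 ↔ M.h z = 0 := by
  rw [pt, M.eq_zero_iff _ _ (M.sstar_add_zero_pos z), add_zero]
  exact ⟨fun h => h.1, fun h => ⟨h, (M.sstar_of_zero h).symm⟩⟩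

theorem exists_pt_of_equilibrium {X : Plane} (h0 : X ≠ 0) (hX : F X = 0) :
    ∃ a, M.h a = 0 ∧ X = M.pt a 0 := by
  obtain ⟨a, s, hs, rfl⟩ := exists_eq_polarPt M.N_ne h0
  obtain ⟨h1, h2⟩ := (M.eq_zero_iff a s hs).1 hX
  refine ⟨a, h1, ?_⟩
  rw [pt, M.sstar_of_zero h1, h2, add_zero]

/-- On an interval shorter than `2π` distinct zeros of `h` give distinct equilibria, so only
finitely many lie there. -/
theorem h_isolated (hfin : (equilibria F).Finite) (z : ℝ) :
    ∀ᶠ x in 𝓝[≠] z, M.h x ≠ 0 := by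
  have hf : ({x | M.h x = 0} ∩ Ioo (z - 1) (z + 1)).Finite := by
    refine Finite.of_finite_image (f := fun a => M.pt a 0) (hfin.subset ?_) ?_
    · rintro _ ⟨a, ha, rfl⟩
      exact M.F_pt_eq_zero_iff.2 ha.1
    · intro a ha b hb hab
      have h1 := angleNear_polarPt (N := M.N) (M.sstar_add_zero_pos a)
        (abs_lt_pi_of_mem le_rfl ha.2)
      have h2 := angleNear_polarPt (N := M.N) (M.sstar_add_zero_pos b)
        (abs_lt_pi_of_mem le_rfl hb.2)
      rw [← h1, ← h2]
      exact congrArg (angleNear z) hab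
  have hcl := (hf.subset (sdiff_subset (t := {z}))).isClosed
  have hmem : (({x | M.h x = 0} ∩ Ioo (z - 1) (z + 1)) \ {z})ᶜ ∈ 𝓝 z :=
    hcl.isOpen_compl.mem_nhds fun h => h.2 rfl
  filter_upwards [nhdsWithin_le_nhds hmem, self_mem_nhdsWithin,
    nhdsWithin_le_nhds (Ioo_mem_nhds (show z - 1 < z by linarith) (show z < z + 1 by linarith))]
    with x hx hxz hx1 hx0
  exact hx ⟨⟨hx0, hx1⟩, hxz⟩

theorem attracted_from_right (hz : M.h z = 0) {δ : ℝ} (h : ∀ x ∈ Ioc z (z + δ), M.h x < 0) {a : ℝ}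
    (ha : a ∈ Ioc z (z + δ)) :
    Tendsto (M.Θ a) atTop (𝓝 z) ∧ ∀ τ, 0 ≤ τ → |M.Θ a τ - z| ≤ |a - z| := by
  obtain ⟨h1, h2⟩ := line_flow_tendsto_of_gt M.lip.locallyLipschitz (M.Θ_deriv a) hz
    (by rw [M.Θ_zero]; exact ha.1) (by
      rw [M.Θ_zero]
      exact fun y hy => h y ⟨hy.1, hy.2.trans ha.2⟩)
  refine ⟨h2, fun τ hτ => ?_⟩
  have h3 := h1 τ hτ
  rw [M.Θ_zero] at h3
  rw [abs_of_pos (sub_pos.2 h3.1), abs_of_pos (sub_pos.2 ha.1)]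
  linarith [h3.2]

theorem attracted_from_left (hz : M.h z = 0) {δ : ℝ} (h : ∀ x ∈ Ico (z - δ) z, 0 < M.h x) {a : ℝ}
    (ha : a ∈ Ico (z - δ) z) :
    Tendsto (M.Θ a) atTop (𝓝 z) ∧ ∀ τ, 0 ≤ τ → |M.Θ a τ - z| ≤ |a - z| := by
  obtain ⟨h1, h2⟩ := line_flow_tendsto_of_lt M.lip.locallyLipschitz (M.Θ_deriv a) hz
    (by rw [M.Θ_zero]; exact ha.2) (by
      rw [M.Θ_zero]
      exact fun y hy => h y ⟨ha.1.trans hy.1, hy.2⟩)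
  refine ⟨h2, fun τ hτ => ?_⟩
  have h3 := h1 τ hτ
  rw [M.Θ_zero] at h3
  rw [abs_of_neg (sub_neg.2 h3.2), abs_of_neg (sub_neg.2 ha.2)]
  linarith [h3.1]

theorem isSink_of_signs (hz : M.h z = 0) (hR : ∀ᶠ x in 𝓝[>] z, M.h x < 0)
    (hL : ∀ᶠ x in 𝓝[<] z, 0 < M.h x) : IsSink F (M.pt z 0) := by
  obtain ⟨r, hr, h1⟩ := exists_Ioc_of_eventually_right hR
  obtain ⟨l, hl, h2⟩ := exists_Ico_of_eventually_left hL
  refine M.isSink_of_attracting (M.F_pt_eq_zero_iff.2 hz) (lt_min hr hl) fun a ha => ?_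
  rcases lt_trichotomy a z with h | rfl | h
  · exact M.attracted_from_left hz h2 ⟨by linarith [ha.1, min_le_right r l], h⟩
  · rw [show M.Θ a = fun _ => a from funext (M.Θ_of_zero hz)]
    exact ⟨tendsto_const_nhds, fun _ _ => le_rfl⟩
  · exact M.attracted_from_right hz h1 ⟨h, by linarith [ha.2, min_le_left r l]⟩

theorem not_isSink_of_pos_right (hR : ∀ᶠ x in 𝓝[>] z, 0 < M.h x) : ¬ IsSink F (M.pt z 0) := by
  refine M.not_isSink_of_repelling fun η hη => ?_
  obtain ⟨a, ha, haz⟩ := (hR.and (Ioo_mem_nhdsGT (show z < z + η by linarith))).exists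
  have h1 : 0 < a - z := sub_pos.2 haz.1
  refine ⟨a, abs_pos.2 h1.ne', by rw [abs_of_pos h1]; linarith [haz.2], fun τ hτ => ?_⟩
  have := line_flow_repelled M.lip.locallyLipschitz (M.Θ_deriv a) (z := z)
    (by rw [M.Θ_zero]; exact mul_pos ha h1) hτ
  rwa [M.Θ_zero] at this

theorem not_isSink_of_neg_left (hL : ∀ᶠ x in 𝓝[<] z, M.h x < 0) : ¬ IsSink F (M.pt z 0) := by
  refine M.not_isSink_of_repelling fun η hη => ?_
  obtain ⟨a, ha, haz⟩ := (hL.and (Ioo_mem_nhdsLT (show z - η < z by linarith))).exists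
  have h1 : a - z < 0 := sub_neg.2 haz.2
  refine ⟨a, abs_pos.2 h1.ne, by rw [abs_of_neg h1]; linarith [haz.1], fun τ hτ => ?_⟩
  have := line_flow_repelled M.lip.locallyLipschitz (M.Θ_deriv a) (z := z)
    (by rw [M.Θ_zero]; exact mul_pos_of_neg_of_neg ha h1) hτ
  rwa [M.Θ_zero] at this

theorem not_isSaddle_of_neg_right (hz : M.h z = 0) (hR : ∀ᶠ x in 𝓝[>] z, M.h x < 0) :
    ¬ IsSaddle F (M.pt z 0) := by
  obtain ⟨r, hr, h1⟩ := exists_Ioc_of_eventually_right hR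
  refine M.not_isSaddle_of_attracting fun η hη => ⟨Ioo z (z + min r η), isOpen_Ioo, ?_, ?_, ?_⟩
  · exact nonempty_Ioo.2 (by linarith [lt_min hr hη])
  · exact fun a ha => ⟨by linarith [ha.1], by linarith [ha.2, min_le_right r η]⟩
  · exact fun a ha => M.attracted_from_right hz h1 ⟨ha.1, by linarith [ha.2, min_le_left r η]⟩

theorem not_isSaddle_of_pos_left (hz : M.h z = 0) (hL : ∀ᶠ x in 𝓝[<] z, 0 < M.h x) :
    ¬ IsSaddle F (M.pt z 0) := by
  obtain ⟨l, hl, h1⟩ := exists_Ico_of_eventually_left hL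
  refine M.not_isSaddle_of_attracting fun η hη => ⟨Ioo (z - min l η) z, isOpen_Ioo, ?_, ?_, ?_⟩
  · exact nonempty_Ioo.2 (by linarith [lt_min hl hη])
  · exact fun a ha => ⟨by linarith [ha.1, min_le_right l η], by linarith [ha.2]⟩
  · exact fun a ha => M.attracted_from_left hz h1 ⟨by linarith [ha.1, min_le_left l η], ha.2⟩

theorem isSaddle_of_signs (hz : M.h z = 0) (hR : ∀ᶠ x in 𝓝[>] z, 0 < M.h x)
    (hL : ∀ᶠ x in 𝓝[<] z, M.h x < 0) : IsSaddle F (M.pt z 0) := by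
  obtain ⟨δ, hδ, hδ1, h1, h2⟩ := exists_common_radius hR hL
  obtain ⟨φ, H⟩ := exists_isLineConj_id M.lip hδ hz h1 h2
  exact ⟨M.F_pt_eq_zero_iff.2 hz, M.locallyTopEquivalent_of_isLineConj H
    LipschitzWith.id.locallyLipschitz hδ1⟩

theorem locallyLipschitz_sq : LocallyLipschitz fun y : ℝ => y ^ 2 :=
  (contDiff_id.pow 2 : ContDiff ℝ 1 fun y : ℝ => y ^ 2).locallyLipschitz

/-- The direction transverse to the invariant graph always contracts, so only the normal form with
`y' = -y` occurs. -/
theorem isSaddleNode_of_pos (hz : M.h z = 0) (hR : ∀ᶠ x in 𝓝[>] z, 0 < M.h x)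
    (hL : ∀ᶠ x in 𝓝[<] z, 0 < M.h x) : IsSaddleNode F (M.pt z 0) := by
  obtain ⟨δ, hδ, hδ1, h1, h2⟩ := exists_common_radius hR hL
  obtain ⟨φ, H⟩ := exists_isLineConj_sq M.lip hδ hz h1 h2
  exact ⟨M.F_pt_eq_zero_iff.2 hz, Or.inl (M.locallyTopEquivalent_of_isLineConj H
    locallyLipschitz_sq hδ1)⟩

theorem isSaddleNode_of_neg (hz : M.h z = 0) (hR : ∀ᶠ x in 𝓝[>] z, M.h x < 0)
    (hL : ∀ᶠ x in 𝓝[<] z, M.h x < 0) : IsSaddleNode F (M.pt z 0) := by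
  obtain ⟨δ, hδ, hδ1, h1, h2⟩ := exists_common_radius hR hL
  obtain ⟨φ, H⟩ := exists_isLineConj_sq_of_neg M.lip hδ hz h1 h2
  exact ⟨M.F_pt_eq_zero_iff.2 hz, Or.inl (M.locallyTopEquivalent_of_isLineConj H
    locallyLipschitz_sq hδ1)⟩

theorem classification (hfin : (equilibria F).Finite) (hz : M.h z = 0) :
    IsSink F (M.pt z 0) ∨ IsSaddle F (M.pt z 0) ∨ IsSaddleNode F (M.pt z 0) := by
  rcases sign_right M.h_continuous (M.h_isolated hfin z) with hR | hR <;>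
    rcases sign_left M.h_continuous (M.h_isolated hfin z) with hL | hL
  · exact Or.inr (Or.inr (M.isSaddleNode_of_pos hz hR hL))
  · exact Or.inr (Or.inl (M.isSaddle_of_signs hz hR hL))
  · exact Or.inl (M.isSink_of_signs hz hR hL)
  · exact Or.inr (Or.inr (M.isSaddleNode_of_neg hz hR hL))

/-- Sinks and saddles are defined dynamically; alternation needs this converse, which recovers the
signs by excluding the opposite one on each side. -/
theorem signs_of_isSink (hfin : (equilibria F).Finite) (h : IsSink F (M.pt z 0)) :
    (∀ᶠ x in 𝓝[>] z, M.h x < 0) ∧ ∀ᶠ x in 𝓝[<] z, 0 < M.h x := by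
  have hz := M.F_pt_eq_zero_iff.1 h.1
  exact ⟨(sign_right M.h_continuous (M.h_isolated hfin z)).resolve_left
      fun hR => M.not_isSink_of_pos_right hR h,
    (sign_left M.h_continuous (M.h_isolated hfin z)).resolve_right
      fun hL => M.not_isSink_of_neg_left hL h⟩

theorem signs_of_isSaddle (hfin : (equilibria F).Finite) (h : IsSaddle F (M.pt z 0)) :
    (∀ᶠ x in 𝓝[>] z, 0 < M.h x) ∧ ∀ᶠ x in 𝓝[<] z, M.h x < 0 := by
  have hz := M.F_pt_eq_zero_iff.1 h.1
  exact ⟨(sign_right M.h_continuous (M.h_isolated hfin z)).resolve_right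
      fun hR => M.not_isSaddle_of_neg_right hz hR h,
    (sign_left M.h_continuous (M.h_isolated hfin z)).resolve_left
      fun hL => M.not_isSaddle_of_pos_left hz hL h⟩

/-- The invariant circle. -/
def cycle : Set Plane := range fun a => M.pt a 0

theorem zero_notMem_cycle : (0 : Plane) ∉ M.cycle := by
  rintro ⟨a, ha⟩
  exact M.pt_ne_zero a ha

theorem equilibria_subset_cycle : equilibria F \ {0} ⊆ M.cycle := by
  rintro X ⟨hX, h0⟩
  obtain ⟨a, -, rfl⟩ := M.exists_pt_of_equilibrium h0 hX
  exact mem_range_self a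

/-- The parametrization descends to a continuous injection of the compact `AddCircle (2 * Real.pi)`
into a Hausdorff space, hence to a homeomorphism onto its image. -/
theorem cycle_homeo : Nonempty (M.cycle ≃ₜ Circle) := by
  have : Fact (0 < 2 * Real.pi) := ⟨by positivity⟩
  have hper : Function.Periodic (fun a => M.pt a 0) (2 * Real.pi) := fun a => by
    simpa using M.pt_add_int_mul a 0 1
  have hcont : Continuous (hper.lift : AddCircle (2 * Real.pi) → Plane) :=
    continuous_coinduced_dom.2 M.pt_zero_continuous
  have hinj : Function.Injective (hper.lift : AddCircle (2 * Real.pi) → Plane) := by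
    intro x y
    induction x using QuotientAddGroup.induction_on with | _ a =>
    induction y using QuotientAddGroup.induction_on with | _ b =>
    intro hab
    obtain ⟨k, hk⟩ := M.pt_zero_inj (a := a) (b := b) hab
    refine QuotientAddGroup.eq.2 (AddSubgroup.mem_zmultiples_iff.2 ⟨-k, ?_⟩)
    rw [hk, zsmul_eq_mul]
    push_cast
    ring
  have hrange : range (hper.lift : AddCircle (2 * Real.pi) → Plane) = M.cycle := by
    ext X
    constructor
    · rintro ⟨x, rfl⟩
      induction x using QuotientAddGroup.induction_on with | _ a =>
      exact ⟨a, rfl⟩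
    · rintro ⟨a, rfl⟩
      exact ⟨(a : AddCircle (2 * Real.pi)), rfl⟩
  let e : AddCircle (2 * Real.pi) ≃ₜ range (hper.lift : AddCircle (2 * Real.pi) → Plane) :=
    Continuous.homeoOfEquivCompactToT2 (f := Equiv.ofInjective _ hinj)
      (hcont.subtype_mk fun x => mem_range_self x)
  exact ⟨(Homeomorph.setCongr hrange.symm).trans (e.symm.trans AddCircle.homeomorphCircle')⟩

theorem isPolicycle_cycle (hfin : (equilibria F).Finite) (hne : (equilibria F \ {0}).Nonempty) :
    IsPolicycle F M.cycle := by
  refine ⟨M.cycle_homeo, hfin.subset inter_subset_right, ?_⟩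
  rintro _ ⟨a, rfl⟩
  by_cases ha : M.h a = 0
  · have hF := M.F_pt_eq_zero_iff.2 ha
    refine ⟨fun _ => M.pt a 0, fun t _ => ?_, rfl, fun _ => mem_range_self a, M.pt a 0,
      ⟨mem_range_self a, hF⟩, M.pt a 0, ⟨mem_range_self a, hF⟩, tendsto_const_nhds,
      tendsto_const_nhds⟩
    simp only [hF]
    exact hasDerivWithinAt_const t _ _
  · obtain ⟨X, hX, hX0⟩ := hne
    obtain ⟨b, hb, -⟩ := M.exists_pt_of_equilibrium hX0 hX
    -- The orbit of a non-equilibrium joins the two consecutive zeros of `h` that enclose its angle.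
    obtain ⟨z, hz, w, hw, haz, hgap⟩ := exists_gap (Z := {x | M.h x = 0})
      (isClosed_eq M.h_continuous continuous_const) (p := 2 * Real.pi) (by positivity)
      (fun x hx k => by
        rw [mem_ofPred_eq] at hx ⊢
        rw [(M.h_per.int_mul k) x, hx]) ⟨b, hb⟩ ha
    obtain ⟨p, q, hp, hq, h1, h2⟩ := line_flow_connects M.lip.locallyLipschitz (M.Θ_deriv a) hz hw
      (by rwa [M.Θ_zero]) hgap
    obtain ⟨T, hT0, hT⟩ := M.exists_complete_time a
    have hTs0 : T.symm 0 = 0 := (T.symm_apply_eq).2 hT0.symm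
    have hform : (fun t => polarPt M.N (M.Θ a (T.symm t)) (M.sstar (M.Θ a (T.symm t)))) =
        fun t => M.pt (M.Θ a (T.symm t)) 0 := by
      funext t
      rw [pt, add_zero]
    rw [hform] at hT
    refine ⟨_, hT, ?_, fun t => mem_range_self _, M.pt p 0,
      ⟨mem_range_self p, M.F_pt_eq_zero_iff.2 hp⟩, M.pt q 0,
      ⟨mem_range_self q, M.F_pt_eq_zero_iff.2 hq⟩, ?_, ?_⟩
    · simp only [hTs0, M.Θ_zero]
    · exact (M.pt_zero_continuous.tendsto p).comp (h1.comp T.symm.tendsto_atBot)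
    · exact (M.pt_zero_continuous.tendsto q).comp (h2.comp T.symm.tendsto_atTop)

/-- A compact invariant set away from the origin lies on the invariant circle. -/
theorem subset_cycle {S : Set Plane} (hS : IsCompact S) (h0 : (0 : Plane) ∉ S)
    (hinv : ∀ x ∈ S, ∃ γ : ℝ → Plane, IsTrajectoryOn F γ univ ∧ γ 0 = x ∧ ∀ t, γ t ∈ S) :
    S ⊆ M.cycle := by
  intro x hx
  have hcn : ContinuousOn (fun X : Plane => ‖X‖ ^ M.N) S := (continuous_norm.pow _).continuousOn
  obtain ⟨u, hu, hmin⟩ := hS.exists_isMinOn ⟨x, hx⟩ hcn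
  obtain ⟨w, hw, hmax⟩ := hS.exists_isMaxOn ⟨x, hx⟩ hcn
  have hu0 : 0 < ‖u‖ ^ M.N := by
    have : u ≠ 0 := fun h => h0 (h ▸ hu)
    positivity
  obtain ⟨lo, hi, hlo, hb⟩ := M.m_bounds
  obtain ⟨C, hC, HT⟩ := M.exists_normalised_time hu0
  obtain ⟨γ, hγ, hγ0, hγS⟩ := hinv x hx
  obtain ⟨a, s, hs, hxas⟩ := exists_eq_polarPt M.N_ne (fun h => h0 (h ▸ hx) : x ≠ 0)
  -- Start `n` units of time earlier. Away from the origin the time change has speed at most `C`, so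
  -- at least `n / C` units of normalised time elapse, during which the bounded height contracts by
  -- their exponential.
  have key : ∀ n : ℕ, |s - M.sstar a| ≤ Real.exp (-(n / C)) * (‖w‖ ^ M.N + hi) := by
    intro n
    obtain ⟨b, t, ht, hbt⟩ := exists_eq_polarPt M.N_ne
      (fun h => h0 (h ▸ hγS (-n)) : γ (-n) ≠ 0)
    have htn : ‖γ (-n)‖ ^ M.N = t := by rw [hbt, norm_polarPt_pow M.N_ne ht]
    have htu : ‖u‖ ^ M.N ≤ t := htn ▸ hmin (hγS _)
    have htw : t ≤ ‖w‖ ^ M.N := htn ▸ hmax (hγS _)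
    have hshift : IsTrajectoryOn F (fun r => γ (r - n)) (Icc 0 (n : ℝ)) := by
      intro r _
      have h1 := (hγ (r - n) trivial).hasDerivAt univ_mem
      exact (h1.comp_sub_const r (n : ℝ)).hasDerivWithinAt
    obtain ⟨τ, hτ, hnτ, heq, -⟩ := HT b t htu _ n (Nat.cast_nonneg n) hshift (by simpa using hbt)
    simp only [sub_self, hγ0, hxas] at heq
    obtain ⟨h1, k, h2⟩ := polarPt_inj M.N_ne hs (M.radial_pos b ht hτ) heq
    have h3 : s - M.sstar a = Real.exp (-τ) * (t - M.sstar b) := by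
      rw [h1, h2, (M.sstar_periodic.int_mul k) _, radial]
      ring
    have h4 : |t - M.sstar b| ≤ ‖w‖ ^ M.N + hi := by
      have := (M.sstar_bounds hb b).2
      have := M.sstar_pos b
      rw [abs_le]
      constructor <;> linarith
    have h5 : (n : ℝ) / C ≤ τ := by
      rw [div_le_iff₀ hC]
      linarith
    rw [h3, abs_mul, abs_of_pos (Real.exp_pos _)]
    exact mul_le_mul (Real.exp_le_exp.2 (by linarith)) h4 (abs_nonneg _) (Real.exp_pos _).le
  have hlim : Tendsto (fun n : ℕ => Real.exp (-(n / C)) * (‖w‖ ^ M.N + hi)) atTop (𝓝 0) := by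
    have h1 : Tendsto (fun n : ℕ => (n : ℝ) / C) atTop atTop :=
      tendsto_natCast_atTop_atTop.atTop_div_const hC
    simpa using (Real.tendsto_exp_neg_atTop_nhds_zero.comp h1).mul_const (‖w‖ ^ M.N + hi)
  have hzero : |s - M.sstar a| ≤ 0 := ge_of_tendsto hlim (Eventually.of_forall key)
  refine ⟨a, ?_⟩
  have : s = M.sstar a := by linarith [abs_nonpos_iff.1 hzero]
  rw [hxas, this]
  simp [pt]

/-- If a point were missed, the angle would be a continuous injective real function on a topological
circle. -/
theorem eq_cycle_of_subset {S : Set Plane} (hS : S ⊆ M.cycle) (e : S ≃ₜ Circle) : S = M.cycle := by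
  refine hS.antisymm ?_
  rintro _ ⟨a, rfl⟩
  by_contra hmiss
  -- Angles are centred at `a + π`, so that the cut falls on the ray through the missed point.
  have hrep : ∀ X ∈ S, ∃ b, |b - (a + Real.pi)| < Real.pi ∧ X = M.pt b 0 := by
    intro X hX
    obtain ⟨b, rfl⟩ := hS hX
    obtain ⟨c, hc, k, hk⟩ : ∃ c ∈ Ico a (a + 2 * Real.pi), ∃ k : ℤ, c = b + k * (2 * Real.pi) := by
      refine ⟨toIcoMod (by positivity : (0 : ℝ) < 2 * Real.pi) a b, toIcoMod_mem_Ico _ _ _,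
        -toIcoDiv (by positivity : (0 : ℝ) < 2 * Real.pi) a b, ?_⟩
      rw [toIcoMod, zsmul_eq_mul]
      push_cast
      ring
    have hbc : M.pt c 0 = M.pt b 0 := by rw [hk, M.pt_add_int_mul]
    refine ⟨c, ?_, hbc.symm⟩
    have hca : c ≠ a := by
      rintro rfl
      have hX' : M.pt b 0 ∈ S := hX
      exact hmiss (hbc ▸ hX' : M.pt c 0 ∈ S)
    have := lt_of_le_of_ne hc.1 hca.symm
    rw [abs_lt]
    constructor <;> linarith [hc.2]
  have hang : ∀ X ∈ S, M.pt (angleNear (a + Real.pi) X) 0 = X := by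
    intro X hX
    obtain ⟨b, hb, rfl⟩ := hrep X hX
    rw [show angleNear (a + Real.pi) (M.pt b 0) = b from
      angleNear_polarPt (M.sstar_add_zero_pos b) hb]
  have hcont : Continuous fun X : S => angleNear (a + Real.pi) (X : Plane) := by
    refine continuousOn_iff_continuous_domRestrict.1 ((angleNear_continuousOn _).mono fun X hX => ?_)
    obtain ⟨b, hb, rfl⟩ := hrep X hX
    exact polarPt_mem_slitAround (M.sstar_add_zero_pos b) hb
  refine not_injective_circle_real (hcont.comp e.symm.continuous) fun x y hxy => ?_
  apply e.symm.injective
  apply Subtype.ext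
  rw [← hang _ (e.symm x).2, ← hang _ (e.symm y).2]
  exact congrArg (fun t => M.pt t 0) hxy

theorem policycle_eq_cycle {S : Set Plane} (hS : IsPolicycle F S) (h0 : (0 : Plane) ∉ S) :
    S = M.cycle := by
  obtain ⟨⟨e⟩, -, htraj⟩ := hS
  have hcomp : IsCompact S := by
    rw [isCompact_iff_compactSpace]
    exact e.symm.compactSpace
  refine M.eq_cycle_of_subset (M.subset_cycle hcomp h0 fun x hx => ?_) e
  obtain ⟨γ, h1, h2, h3, -⟩ := htraj x hx
  exact ⟨γ, h1, h2, h3⟩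

/-- Each arc of the invariant circle bounded by one or two given points contains the image of an
interval whose ends are mapped to these points. -/
theorem exists_arc {p p' x : Plane} (hp : p ∈ M.cycle) (hx : x ∈ M.cycle \ {p, p'}) :
    ∃ z w, z < w ∧ M.pt z 0 ∈ ({p, p'} : Set Plane) ∧ M.pt w 0 ∈ ({p, p'} : Set Plane) ∧
      ∀ c ∈ Ioo z w, M.pt c 0 ∈ connectedComponentIn (M.cycle \ {p, p'}) x := by
  obtain ⟨⟨a, rfl⟩, hxa⟩ := hx
  obtain ⟨b, rfl⟩ := hp
  obtain ⟨z, hz, w, hw, haz, hgap⟩ := exists_gap (Z := (fun t => M.pt t 0) ⁻¹' {M.pt b 0, p'})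
    ((Set.toFinite _).isClosed.preimage M.pt_zero_continuous) (p := 2 * Real.pi) (by positivity)
    (fun t ht k => by
      rw [mem_preimage] at ht ⊢
      rwa [M.pt_add_int_mul]) ⟨b, Or.inl rfl⟩ hxa
  refine ⟨z, w, haz.1.trans haz.2, hz, hw, fun c hc => ?_⟩
  have hpre : IsPreconnected ((fun t => M.pt t 0) '' Ioo z w) :=
    isPreconnected_Ioo.image _ M.pt_zero_continuous.continuousOn
  refine hpre.subset_connectedComponentIn (mem_image_of_mem _ haz) ?_ (mem_image_of_mem _ hc)
  rintro _ ⟨t, ht, rfl⟩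
  exact ⟨mem_range_self t, hgap t ht⟩

/-- Between two lifts of sinks `h` starts negative and ends positive, so it changes sign upwards at
a saddle; the other case is dual. For a single point the lifts are successive translates, so no
separate argument is needed. -/
theorem alternateOn_cycle (hfin : (equilibria F).Finite) :
    AlternateOn M.cycle {p | IsSink F p} {p | IsSaddle F p} := by
  have hiso : ∀ z, M.h z = 0 → ∀ᶠ x in 𝓝[≠] z, M.h x ≠ 0 := fun z _ => M.h_isolated hfin z
  constructor
  · intro p hp p' hp' x hx
    obtain ⟨z, w, hzw, hz, hw, harc⟩ := M.exists_arc hp.2 hx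
    have hsink : ∀ y ∈ ({p, p'} : Set Plane), IsSink F y := by
      rintro y (rfl | rfl)
      exacts [hp.1, hp'.1]
    obtain ⟨c, hc, h0, hR, hL⟩ := exists_repelling_between M.h_continuous hiso hzw
      (M.signs_of_isSink hfin (hsink _ hz)).1 (M.signs_of_isSink hfin (hsink _ hw)).2
    exact ⟨_, harc c hc, M.isSaddle_of_signs h0 hR hL⟩
  · intro p hp p' hp' x hx
    obtain ⟨z, w, hzw, hz, hw, harc⟩ := M.exists_arc hp.2 hx
    have hsaddle : ∀ y ∈ ({p, p'} : Set Plane), IsSaddle F y := by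
      rintro y (rfl | rfl)
      exacts [hp.1, hp'.1]
    obtain ⟨c, hc, h0, hR, hL⟩ := exists_attracting_between M.h_continuous hiso hzw
      (M.signs_of_isSaddle hfin (hsaddle _ hz)).1 (M.signs_of_isSaddle hfin (hsaddle _ hw)).2
    exact ⟨_, harc c hc, M.isSink_of_signs h0 hR hL⟩

end PolarModel

/-! ### Parity of the number of sign changes -/

theorem mul_pos_of_no_zeros {h : ℝ → ℝ} (hc : Continuous h) {a b : ℝ} (hab : a ≤ b)
    (hne : ∀ y ∈ Icc a b, h y ≠ 0) : 0 < h a * h b := by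
  have ha := left_mem_Icc.2 hab
  have hb := right_mem_Icc.2 hab
  have him : OrdConnected (h '' Icc a b) := (isPreconnected_Icc.image h hc.continuousOn).ordConnected
  have hno : ∀ x ∈ Icc a b, ∀ y ∈ Icc a b, h x ≤ 0 → 0 ≤ h y → False := by
    intro x hx y hy hx0 hy0
    obtain ⟨u, hu, hu0⟩ := him.out (mem_image_of_mem h hx) (mem_image_of_mem h hy) ⟨hx0, hy0⟩
    exact hne u hu hu0
  rcases le_total (h a) 0 with h1 | h1 <;> rcases le_total (h b) 0 with h2 | h2
  · exact mul_pos_of_neg_of_neg (lt_of_le_of_ne h1 (hne a ha)) (lt_of_le_of_ne h2 (hne b hb))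
  · exact (hno a ha b hb h1 h2).elim
  · exact (hno b hb a ha h2 h1).elim
  · exact mul_pos (lt_of_le_of_ne h1 (hne a ha).symm) (lt_of_le_of_ne h2 (hne b hb).symm)

/-- A function all of whose finitely many zeros in an interval are sign changes has the same sign at
both ends if and only if the number of these zeros is even. -/
theorem mul_pos_iff_even_ncard {h : ℝ → ℝ} (hc : Continuous h) {a : ℝ} (ha : h a ≠ 0) (n : ℕ) :
    ∀ b, a < b → h b ≠ 0 → ({x | h x = 0} ∩ Ioo a b).Finite →
      (∀ z, h z = 0 → ((∀ᶠ x in 𝓝[>] z, 0 < h x) ∧ ∀ᶠ x in 𝓝[<] z, h x < 0) ∨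
        ((∀ᶠ x in 𝓝[>] z, h x < 0) ∧ ∀ᶠ x in 𝓝[<] z, 0 < h x)) →
      ({x | h x = 0} ∩ Ioo a b).ncard = n → (0 < h a * h b ↔ Even n) := by
  induction n with
  | zero =>
    intro b hab hb hfin _ hcard
    rw [ncard_eq_zero hfin] at hcard
    simp only [Even.zero, iff_true]
    refine mul_pos_of_no_zeros hc hab.le fun y hy h0 => ?_
    have hya : y ≠ a := fun he => ha (he ▸ h0)
    have hyb : y ≠ b := fun he => hb (he ▸ h0)
    exact (hcard ▸ notMem_empty y : y ∉ {x | h x = 0} ∩ Ioo a b)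
      ⟨h0, lt_of_le_of_ne hy.1 hya.symm, lt_of_le_of_ne hy.2 hyb⟩
  | succ n ih =>
    intro b hab hb hfin hsign hcard
    have hne : ({x | h x = 0} ∩ Ioo a b).Nonempty := by
      rw [nonempty_iff_ne_empty]
      intro he
      simp [he] at hcard
    -- Induction removes the last zero `z`: at a point `c` just before it `h` has the sign opposite
    -- to `h b`, and `(a, c)` contains the remaining zeros.
    obtain ⟨z, ⟨hz0, hz⟩, hmax⟩ := hfin.exists_maximal hne
    have hlast : ∀ y, z < y → y ≤ b → h y ≠ 0 := by
      intro y hzy hyb h0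
      have : y ≠ b := fun he => hb (he ▸ h0)
      exact absurd (hmax ⟨h0, hz.1.trans hzy, lt_of_le_of_ne hyb this⟩ hzy.le) (not_le.2 hzy)
    have hopp : ∃ c, a < c ∧ c < z ∧ (∀ y, c ≤ y → y < z → h y ≠ 0) ∧ h c * h b < 0 := by
      have hright : ∀ {P : ℝ → Prop}, (∀ᶠ x in 𝓝[>] z, P x) → ∃ x, P x ∧ 0 < h x * h b := by
        intro P hP
        obtain ⟨x, hx, hxz⟩ := (hP.and (Ioo_mem_nhdsGT hz.2)).exists
        exact ⟨x, hx, mul_pos_of_no_zeros hc hxz.2.le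
          fun y hy => hlast y (hxz.1.trans_le hy.1) hy.2⟩
      have hleft : ∀ {P : ℝ → Prop}, (∀ᶠ x in 𝓝[<] z, P x) →
          ∃ c, a < c ∧ c < z ∧ ∀ y, c ≤ y → y < z → P y := by
        intro P hP
        obtain ⟨δ, hδ, h1⟩ := exists_Ico_of_eventually_left hP
        refine ⟨max (z - δ) ((a + z) / 2), lt_max_of_lt_right (by linarith [hz.1]),
          max_lt (by linarith) (by linarith [hz.1]), fun y hy hyz => ?_⟩
        exact h1 y ⟨(le_max_left _ _).trans hy, hyz⟩
      rcases hsign z hz0 with ⟨hR, hL⟩ | ⟨hR, hL⟩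
      · obtain ⟨x, hx, hxb⟩ := hright hR
        obtain ⟨c, hac, hcz, hcP⟩ := hleft hL
        exact ⟨c, hac, hcz, fun y h1 h2 => (hcP y h1 h2).ne, mul_neg_of_neg_of_pos (hcP c le_rfl hcz)
          ((pos_iff_pos_of_mul_pos hxb).1 hx)⟩
      · obtain ⟨x, hx, hxb⟩ := hright hR
        obtain ⟨c, hac, hcz, hcP⟩ := hleft hL
        exact ⟨c, hac, hcz, fun y h1 h2 => (hcP y h1 h2).ne', mul_neg_of_pos_of_neg
          (hcP c le_rfl hcz) ((neg_iff_neg_of_mul_pos hxb).1 hx)⟩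
    obtain ⟨c, hac, hcz, hcne, hcb⟩ := hopp
    have hset : {x | h x = 0} ∩ Ioo a c = ({x | h x = 0} ∩ Ioo a b) \ {z} := by
      ext y
      constructor
      · rintro ⟨h0, hy1, hy2⟩
        exact ⟨⟨h0, hy1, hy2.trans (hcz.trans hz.2)⟩, (hy2.trans hcz).ne⟩
      · rintro ⟨⟨h0, hy1, hy2⟩, hyz⟩
        refine ⟨h0, hy1, ?_⟩
        by_contra hcy
        push Not at hcy
        rcases lt_or_gt_of_ne (hyz : y ≠ z) with hlt | hgt
        · exact hcne y hcy hlt h0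
        · exact hlast y hgt hy2.le h0
    have hcard' : ({x | h x = 0} ∩ Ioo a c).ncard = n := by
      rw [hset, ncard_sdiff_singleton_of_mem (mem_inter hz0 hz), hcard, Nat.add_sub_cancel]
    have := ih c hac (hcne c le_rfl hcz) (hset ▸ hfin.subset sdiff_subset) hsign hcard'
    rw [Nat.even_add_one, ← this]
    have hc0 := hcne c le_rfl hcz
    rcases lt_or_gt_of_ne ha with h1 | h1 <;> rcases lt_or_gt_of_ne hc0 with h2 | h2 <;>
      rcases lt_or_gt_of_ne hb with h3 | h3 <;>
      first
      | nlinarith [mul_pos_of_neg_of_neg h2 h3]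
      | nlinarith [mul_pos h2 h3]
      | simp [mul_pos_iff, h1, h2, h3, h1.le, h2.le, h3.le]

namespace PolarModel

variable {F : Plane → Plane} (M : PolarModel F)

/-- From a point `a` that is not a zero, `h (a + π) = h a` makes the number of zeros in `(a, a + π)`
even, and translation by `π` doubles it. -/
theorem four_dvd_ncard (hfin : (equilibria F).Finite)
    (hper : Function.Periodic M.h Real.pi)
    (hsign : ∀ z, M.h z = 0 → ((∀ᶠ x in 𝓝[>] z, 0 < M.h x) ∧ ∀ᶠ x in 𝓝[<] z, M.h x < 0) ∨
        ((∀ᶠ x in 𝓝[>] z, M.h x < 0) ∧ ∀ᶠ x in 𝓝[<] z, 0 < M.h x)) :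
    4 ∣ (equilibria F \ {0}).ncard := by
  obtain ⟨a, ha⟩ : ∃ a, M.h a ≠ 0 := by
    by_contra hall
    push Not at hall
    obtain ⟨x, hx⟩ := (M.h_isolated hfin 0).exists
    exact hx (hall x)
  have hpi := Real.pi_pos
  set Z := {x | M.h x = 0} with hZ
  have himage : (fun t => M.pt t 0) '' (Z ∩ Ioo a (a + 2 * Real.pi)) = equilibria F \ {0} := by
    ext X
    constructor
    · rintro ⟨t, ht, rfl⟩
      exact ⟨M.F_pt_eq_zero_iff.2 ht.1, M.pt_ne_zero t⟩
    · rintro ⟨hX, hX0⟩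
      obtain ⟨b, hb, rfl⟩ := M.exists_pt_of_equilibrium hX0 hX
      have hpos : (0 : ℝ) < 2 * Real.pi := by positivity
      have hk : toIcoMod hpos a b = b + ((-toIcoDiv hpos a b : ℤ) : ℝ) * (2 * Real.pi) := by
        rw [toIcoMod, zsmul_eq_mul]
        push_cast
        ring
      have hb' : M.h (toIcoMod hpos a b) = 0 := by rw [hk, (M.h_per.int_mul _) b, hb]
      have hmem := toIcoMod_mem_Ico hpos a b
      refine ⟨toIcoMod hpos a b, ⟨hb', lt_of_le_of_ne hmem.1 fun he => ha (he ▸ hb'), hmem.2⟩, ?_⟩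
      simp only [hk, M.pt_add_int_mul]
  have hinj : InjOn (fun t => M.pt t 0) (Z ∩ Ioo a (a + 2 * Real.pi)) := by
    have hang : ∀ t ∈ Z ∩ Ioo a (a + 2 * Real.pi), angleNear (a + Real.pi) (M.pt t 0) = t := by
      intro t ht
      refine angleNear_polarPt (M.sstar_add_zero_pos t) (abs_lt.2 ⟨?_, ?_⟩)
      · linarith [ht.2.1]
      · linarith [ht.2.2]
    intro t ht t' ht' heq
    rw [← hang t ht, ← hang t' ht']
    exact congrArg _ heq
  have hZfin : (Z ∩ Ioo a (a + 2 * Real.pi)).Finite :=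
    Finite.of_finite_image (himage ▸ hfin.subset sdiff_subset) hinj
  have hsub : Z ∩ Ioo a (a + Real.pi) ⊆ Z ∩ Ioo a (a + 2 * Real.pi) := fun x hx =>
    ⟨hx.1, hx.2.1, by linarith [hx.2.2]⟩
  have hsplit : Z ∩ Ioo a (a + 2 * Real.pi) =
      (Z ∩ Ioo a (a + Real.pi)) ∪ (fun x => x + Real.pi) '' (Z ∩ Ioo a (a + Real.pi)) := by
    ext x
    constructor
    · rintro ⟨hx0, hx1, hx2⟩
      rcases lt_trichotomy x (a + Real.pi) with hlt | heq | hgt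
      · exact Or.inl ⟨hx0, hx1, hlt⟩
      · rw [hZ, mem_ofPred_eq, heq, hper] at hx0
        exact absurd hx0 ha
      · refine Or.inr ⟨x - Real.pi, ⟨?_, by linarith, by linarith⟩, by simp⟩
        rw [hZ, mem_ofPred_eq, ← hper, sub_add_cancel]
        exact hx0
    · rintro (hx | ⟨y, hy, rfl⟩)
      · exact hsub hx
      · refine ⟨?_, by linarith [hy.2.1], by linarith [hy.2.2]⟩
        rw [hZ, mem_ofPred_eq, hper]
        exact hy.1
  have hdisj : Disjoint (Z ∩ Ioo a (a + Real.pi))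
      ((fun x => x + Real.pi) '' (Z ∩ Ioo a (a + Real.pi))) := by
    rw [disjoint_left]
    rintro x hx ⟨y, hy, rfl⟩
    linarith [hx.2.2, hy.2.1]
  have heven : Even (Z ∩ Ioo a (a + Real.pi)).ncard := by
    rw [← mul_pos_iff_even_ncard M.h_continuous ha _ (a + Real.pi) (by linarith) (by rwa [hper])
      (hZfin.subset hsub) hsign rfl, hper]
    exact mul_self_pos.2 ha
  rw [← himage, hinj.ncard_image, hsplit, ncard_union_eq hdisj (hZfin.subset hsub)
    ((hZfin.subset hsub).image _), (add_left_injective Real.pi).injOn.ncard_image]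
  obtain ⟨k, hk⟩ := heven
  exact ⟨k, by omega⟩

end PolarModel

/-! ### The star field in polar coordinates -/

theorem MvPolynomial.IsHomogeneous.eval_mul_left {p : MvPolynomial (Fin 2) ℝ} {n : ℕ}
    (hp : p.IsHomogeneous n) (r : ℝ) (x : Fin 2 → ℝ) :
    MvPolynomial.eval (fun j => r * x j) p = r ^ n * MvPolynomial.eval x p := by
  rw [MvPolynomial.eval_eq', MvPolynomial.eval_eq', Finset.mul_sum]
  refine Finset.sum_congr rfl fun d hd => ?_
  have hdeg : ∑ i, d i = n := by
    rw [← Finsupp.degree_eq_sum, Finsupp.degree_eq_weight_one]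
    exact hp (MvPolynomial.mem_support_iff.1 hd)
  simp_rw [mul_pow, Finset.prod_mul_distrib, Finset.prod_pow_eq_pow_sum, hdeg]
  ring

theorem MvPolynomial.contDiff_eval {E : Type*} [NormedAddCommGroup E] [NormedSpace ℝ E] {k : WithTop ℕ∞}
    {f : E → Fin 2 → ℝ} (hf : ∀ i, ContDiff ℝ k fun x => f x i) (p : MvPolynomial (Fin 2) ℝ) :
    ContDiff ℝ k fun x => MvPolynomial.eval (f x) p := by
  induction p using MvPolynomial.induction_on with
  | C a => simpa using contDiff_const
  | add p q hp hq => simpa using hp.add hq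
  | mul_X p i hp => simpa using hp.mul (hf i)

theorem Function.Periodic.exists_lipschitzWith {h : ℝ → ℝ}
    (hp : Function.Periodic h (2 * Real.pi)) (hd : ContDiff ℝ 1 h) : ∃ K, LipschitzWith K h := by
  have hpd : Function.Periodic (fun x => |deriv h x|) (2 * Real.pi) := fun x => by
    have : deriv (fun y => h (y + 2 * Real.pi)) x = deriv h (x + 2 * Real.pi) :=
      deriv_comp_add_const h (2 * Real.pi) x
    simp only [← this, funext hp]
  obtain ⟨lo, hi, -, hb⟩ := hpd.exists_bounds (hd.continuous_deriv le_rfl).abs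
  refine ⟨⟨hi, (abs_nonneg _).trans (hb 0).2⟩, lipschitzWith_of_nnnorm_deriv_le
    (hd.differentiable one_ne_zero) fun x => ?_⟩
  exact (hb x).2

namespace StarField

variable (Q : Fin 2 → MvPolynomial (Fin 2) ℝ)

/-- The component `Q i` on the unit circle. -/
def onCircle (i : Fin 2) (θ : ℝ) : ℝ := MvPolynomial.eval ![Real.cos θ, Real.sin θ] (Q i)

/-- The radial component of `Q` on the unit circle. -/
def radialPart (θ : ℝ) : ℝ := Real.cos θ * onCircle Q 0 θ + Real.sin θ * onCircle Q 1 θ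

/-- The angular component of `Q` on the unit circle. -/
def angularPart (θ : ℝ) : ℝ := -Real.sin θ * onCircle Q 0 θ + Real.cos θ * onCircle Q 1 θ

theorem onCircle_zero (θ : ℝ) :
    onCircle Q 0 θ = radialPart Q θ * Real.cos θ - angularPart Q θ * Real.sin θ := by
  rw [radialPart, angularPart]
  linear_combination (-onCircle Q 0 θ) * Real.sin_sq_add_cos_sq θ

theorem onCircle_one (θ : ℝ) :
    onCircle Q 1 θ = radialPart Q θ * Real.sin θ + angularPart Q θ * Real.cos θ := by
  rw [radialPart, angularPart]
  linear_combination (-onCircle Q 1 θ) * Real.sin_sq_add_cos_sq θ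

theorem onCircle_contDiff (i : Fin 2) : ContDiff ℝ 1 (onCircle Q i) := by
  refine MvPolynomial.contDiff_eval (fun j => ?_) (Q i)
  fin_cases j
  · exact Real.contDiff_cos
  · exact Real.contDiff_sin

theorem radialPart_contDiff : ContDiff ℝ 1 (radialPart Q) :=
  (Real.contDiff_cos.mul (onCircle_contDiff Q 0)).add (Real.contDiff_sin.mul (onCircle_contDiff Q 1))

theorem angularPart_contDiff : ContDiff ℝ 1 (angularPart Q) :=
  (Real.contDiff_sin.neg.mul (onCircle_contDiff Q 0)).add
    (Real.contDiff_cos.mul (onCircle_contDiff Q 1))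

theorem starField_contDiff (lam : ℝ) : ContDiff ℝ 1 (starField lam Q) := by
  refine (contDiff_id.const_smul lam).add (contDiff_euclidean.2 fun i => ?_)
  exact MvPolynomial.contDiff_eval (fun j => contDiff_euclidean.1 contDiff_id j) (Q i)

theorem radialPart_periodic : Function.Periodic (radialPart Q) (2 * Real.pi) := fun θ => by
  simp [radialPart, onCircle]

theorem angularPart_periodic : Function.Periodic (angularPart Q) (2 * Real.pi) := fun θ => by
  simp [angularPart, onCircle]

variable {Q} {n : ℕ}

theorem radialPart_neg (hcontr : IsContracting Q) (θ : ℝ) : radialPart Q θ < 0 := by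
  have hn : ‖(!₂[Real.cos θ, Real.sin θ] : Plane)‖ = 1 := by
    rw [EuclideanSpace.norm_eq]
    simp [Fin.sum_univ_two]
  have := hcontr _ hn
  rw [PiLp.inner_apply, Fin.sum_univ_two] at this
  simp only [polyMap] at this
  simp only [RCLike.inner_apply, conj_trivial] at this
  rw [radialPart, onCircle, onCircle]
  convert! this using 1
  simp
  ring

theorem onCircle_add_pi (hQ : ∀ i, (Q i).IsHomogeneous n) (i : Fin 2) (θ : ℝ) :
    onCircle Q i (θ + Real.pi) = (-1) ^ n * onCircle Q i θ := by
  rw [onCircle, onCircle, ← (hQ i).eval_mul_left]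
  congr 2
  funext j
  fin_cases j <;> simp

/-- For even `n` the map `Q` is even, so `⟨X, Q(X)⟩` changes sign with `X` and cannot be negative at
both `X` and `-X`. -/
theorem odd_degree (hQ : ∀ i, (Q i).IsHomogeneous n) (hcontr : IsContracting Q) : Odd n := by
  by_contra hodd
  rw [Nat.not_odd_iff_even] at hodd
  have h1 := radialPart_neg hcontr 0
  have h2 := radialPart_neg hcontr (0 + Real.pi)
  rw [radialPart, onCircle_add_pi hQ, onCircle_add_pi hQ, hodd.neg_one_pow, Real.cos_add_pi,
    Real.sin_add_pi] at h2
  rw [radialPart] at h1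
  linarith

theorem radialPart_add_pi (hQ : ∀ i, (Q i).IsHomogeneous n) (hn : Odd n) (θ : ℝ) :
    radialPart Q (θ + Real.pi) = radialPart Q θ := by
  rw [radialPart, radialPart, onCircle_add_pi hQ, onCircle_add_pi hQ, hn.neg_one_pow,
    Real.cos_add_pi, Real.sin_add_pi]
  ring

theorem angularPart_add_pi (hQ : ∀ i, (Q i).IsHomogeneous n) (hn : Odd n) (θ : ℝ) :
    angularPart Q (θ + Real.pi) = angularPart Q θ := by
  rw [angularPart, angularPart, onCircle_add_pi hQ, onCircle_add_pi hQ, hn.neg_one_pow,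
    Real.cos_add_pi, Real.sin_add_pi]
  ring

/-- This is why `s = r ^ N` is the radial coordinate: `r ^ (N + 1) = r * s`, so the field is affine
in `s` up to the factor `r`. -/
theorem starField_polarPt {N : ℕ} (hN : N ≠ 0) (hQ : ∀ i, (Q i).IsHomogeneous (N + 1)) (lam : ℝ)
    {s : ℝ} (hs : 0 < s) (θ : ℝ) : starField lam Q (polarPt N θ s) =
      !₂[s ^ ((N : ℝ)⁻¹) * (lam * Real.cos θ + s * onCircle Q 0 θ),
        s ^ ((N : ℝ)⁻¹) * (lam * Real.sin θ + s * onCircle Q 1 θ)] := by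
  have hr : (s ^ ((N : ℝ)⁻¹)) ^ (N + 1) = s ^ ((N : ℝ)⁻¹) * s := by
    rw [pow_succ, Real.rpow_inv_natCast_pow hs.le hN, mul_comm]
  have hv : (fun j => polarPt N θ s j) =
      fun j => s ^ ((N : ℝ)⁻¹) * ![Real.cos θ, Real.sin θ] j := by
    funext j
    fin_cases j <;> rfl
  have hQi : ∀ i, polyMap Q (polarPt N θ s) i = s ^ ((N : ℝ)⁻¹) * s * onCircle Q i θ := fun i => by
    show MvPolynomial.eval (fun j => polarPt N θ s j) (Q i) = _
    rw [hv, (hQ i).eval_mul_left, hr]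
    rfl
  ext i
  rw [starField, PiLp.add_apply, PiLp.smul_apply, hQi]
  fin_cases i <;> simp [polarPt] <;> ring

theorem starField_eq_zero_iff {N : ℕ} (hN : N ≠ 0) (hQ : ∀ i, (Q i).IsHomogeneous (N + 1))
    (lam : ℝ) {s : ℝ} (hs : 0 < s) (θ : ℝ) : starField lam Q (polarPt N θ s) = 0 ↔
      angularPart Q θ = 0 ∧ lam + s * radialPart Q θ = 0 := by
  have hr := Real.rpow_pos_of_pos hs ((N : ℝ)⁻¹)
  rw [starField_polarPt hN hQ lam hs]
  constructor
  · intro h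
    have h0 : s ^ ((N : ℝ)⁻¹) * (lam * Real.cos θ + s * onCircle Q 0 θ) = 0 :=
      congrArg (fun X : Plane => X 0) h
    have h1 : s ^ ((N : ℝ)⁻¹) * (lam * Real.sin θ + s * onCircle Q 1 θ) = 0 :=
      congrArg (fun X : Plane => X 1) h
    have h0' := (mul_eq_zero.1 h0).resolve_left hr.ne'
    have h1' := (mul_eq_zero.1 h1).resolve_left hr.ne'
    constructor
    · have : s * angularPart Q θ = 0 := by
        rw [angularPart]
        linear_combination (-Real.sin θ) * h0' + Real.cos θ * h1'
      exact (mul_eq_zero.1 this).resolve_left hs.ne'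
    · rw [radialPart]
      linear_combination Real.cos θ * h0' + Real.sin θ * h1' - lam * Real.sin_sq_add_cos_sq θ
  · rintro ⟨h1, h2⟩
    have h0 : lam * Real.cos θ + s * onCircle Q 0 θ = 0 := by
      rw [onCircle_zero, h1]
      linear_combination Real.cos θ * h2
    have h3 : lam * Real.sin θ + s * onCircle Q 1 θ = 0 := by
      rw [onCircle_one, h1]
      linear_combination Real.sin θ * h2
    rw [h0, h3]
    ext i
    fin_cases i <;> simp

theorem hasDerivAt_polarPt {N : ℕ} {θ s : ℝ → ℝ} {τ θ' s' : ℝ} (hs : 0 < s τ)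
    (hθ : HasDerivAt θ θ' τ) (hs' : HasDerivAt s s' τ) :
    HasDerivAt (fun t => polarPt N (θ t) (s t))
      (s τ ^ ((N : ℝ)⁻¹) • (!₂[s' / (N * s τ) * Real.cos (θ τ) - θ' * Real.sin (θ τ),
        s' / (N * s τ) * Real.sin (θ τ) + θ' * Real.cos (θ τ)] : Plane)) τ := by
  have hr : HasDerivAt (fun t => s t ^ ((N : ℝ)⁻¹)) (s τ ^ ((N : ℝ)⁻¹) * (s' / (N * s τ))) τ := by
    have := hs'.rpow_const (p := (N : ℝ)⁻¹) (Or.inl hs.ne')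
    convert! this using 1
    rw [Real.rpow_sub_one hs.ne']
    field_simp
  rw [← hasDerivWithinAt_univ, hasDerivWithinAt_plane_iff]
  intro i
  rw [hasDerivWithinAt_univ]
  fin_cases i
  · have := hr.mul hθ.cos
    convert! this using 1
    simp
    ring
  · have := hr.mul hθ.sin
    convert! this using 1
    simp
    ring

/-- The polar model of `X' = lam X + Q(X)`. -/
theorem exists_polarModel {N : ℕ} (hN : N ≠ 0) (hQ : ∀ i, (Q i).IsHomogeneous (N + 1))
    (hcontr : IsContracting Q) {lam : ℝ} (hlam : 0 < lam) :
    ∃ M : PolarModel (starField lam Q), M.N = N ∧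
      M.h = fun θ => angularPart Q θ / (N * -radialPart Q θ) := by
  have hA : ∀ θ, 0 < -radialPart Q θ := fun θ => neg_pos.2 (radialPart_neg hcontr θ)
  have hN' : (0 : ℝ) < N := by exact_mod_cast Nat.pos_of_ne_zero hN
  have hNA : ∀ θ, 0 < N * -radialPart Q θ := fun θ => mul_pos hN' (hA θ)
  have hper : Function.Periodic (fun θ => angularPart Q θ / (N * -radialPart Q θ))
      (2 * Real.pi) := fun θ => by
    simp only [angularPart_periodic Q θ, radialPart_periodic Q θ]
  have hsmooth : ContDiff ℝ 1 fun θ => angularPart Q θ / (N * -radialPart Q θ) :=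
    (angularPart_contDiff Q).div (contDiff_const.mul (radialPart_contDiff Q).neg)
      fun θ => (hNA θ).ne'
  obtain ⟨K, hK⟩ := hper.exists_lipschitzWith hsmooth
  have hperabs : Function.Periodic (fun θ => |angularPart Q θ / (N * -radialPart Q θ)|)
      (2 * Real.pi) := fun θ => congrArg abs (hper θ)
  obtain ⟨lo, hi, -, hb⟩ := hperabs.exists_bounds hsmooth.continuous.abs
  obtain ⟨Θ, hΘ0, hΘ⟩ := exists_global_flow hK fun x => (hb x).2
  have hAc : Continuous fun θ => -radialPart Q θ := (radialPart_contDiff Q).continuous.neg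
  refine ⟨{
    -- The data are those of `θ' = s B`, `s' = N s (lam + s A)` divided by `N s (-A)`; hence `m =
    -- lam / (-A)`, and `κ / s` is the inverse of the divisor.
    N := N
    N_ne := hN
    h := fun θ => angularPart Q θ / (N * -radialPart Q θ)
    m := fun θ => lam / -radialPart Q θ
    κ := fun θ => 1 / (N * -radialPart Q θ)
    K := K
    lip := hK
    h_per := hper
    m_per := fun θ => by simp only [radialPart_periodic Q θ]
    κ_per := fun θ => by simp only [radialPart_periodic Q θ]
    m_cont := continuous_const.div hAc fun θ => (hA θ).ne'
    κ_cont := continuous_const.div (continuous_const.mul hAc) fun θ => (hNA θ).ne'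
    m_pos := fun θ => div_pos hlam (hA θ)
    κ_pos := fun θ => one_div_pos.2 (hNA θ)
    F_lip := (starField_contDiff Q lam).locallyLipschitz
    deriv_polar := ?_
    eq_zero_iff := ?_
    Θ := Θ
    Θ_zero := hΘ0
    Θ_deriv := hΘ }, rfl, rfl⟩
  · intro θ s τ hs hθ hs'
    convert! hasDerivAt_polarPt (N := N) hs hθ hs' using 1
    rw [starField_polarPt hN hQ lam hs, onCircle_zero, onCircle_one]
    have hA' : radialPart Q (θ τ) ≠ 0 := (radialPart_neg hcontr _).ne
    ext i
    fin_cases i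
    · simp
      field_simp
      ring
    · simp
      field_simp
      ring
  · intro θ s hs
    rw [starField_eq_zero_iff hN hQ lam hs, div_eq_zero_iff, or_iff_left (hNA θ).ne',
      div_eq_iff (hA θ).ne']
    refine and_congr_right fun _ => ⟨fun h => by linarith, fun h => by linarith⟩

/-- At a hyperbolic equilibrium the angular component changes sign. -/
theorem deriv_angularPart_ne_zero {N : ℕ} (hN : N ≠ 0) (hQ : ∀ i, (Q i).IsHomogeneous (N + 1))
    (hcontr : IsContracting Q) (lam : ℝ) {z s : ℝ} (hs : 0 < s)
    (hyp : IsHyperbolicEquilibrium (starField lam Q) (polarPt N z s)) :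
    deriv (angularPart Q) z ≠ 0 := by
  intro hB'
  obtain ⟨hB, hrad⟩ := (starField_eq_zero_iff hN hQ lam hs z).1 hyp.1
  set F := starField lam Q with hF
  set p := polarPt N z s with hp
  set D := fderiv ℝ F p with hD
  have hFd : HasFDerivAt F D p :=
    ((starField_contDiff Q lam).differentiable one_ne_zero p).hasFDerivAt
  set r := s ^ ((N : ℝ)⁻¹) with hr
  have hr0 : 0 < r := Real.rpow_pos_of_pos hs _
  have hN' : (N : ℝ) ≠ 0 := Nat.cast_ne_zero.2 hN
  have hAz : radialPart Q z ≠ 0 := (radialPart_neg hcontr z).ne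
  have dA : HasDerivAt (radialPart Q) (deriv (radialPart Q) z) z :=
    ((radialPart_contDiff Q).differentiable one_ne_zero z).hasDerivAt
  have dB : HasDerivAt (angularPart Q) 0 z := by
    rw [← hB']
    exact ((angularPart_contDiff Q).differentiable one_ne_zero z).hasDerivAt
  have hform : ∀ θ t, 0 < t → F (polarPt N θ t) =
      !₂[t ^ ((N : ℝ)⁻¹) * ((lam + t * radialPart Q θ) * Real.cos θ - t * angularPart Q θ * Real.sin θ),
        t ^ ((N : ℝ)⁻¹) * ((lam + t * radialPart Q θ) * Real.sin θ + t * angularPart Q θ * Real.cos θ)] := by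
    intro θ t ht
    rw [hF, starField_polarPt hN hQ lam ht, onCircle_zero, onCircle_one]
    congr 3 <;> [ring; (congr 1; ring)]
  set u : Plane := !₂[Real.cos z, Real.sin z] with hu
  set w : Plane := !₂[-Real.sin z, Real.cos z] with hw
  -- With `B = B' = 0` and `lam + s A = 0` at `z`, moving the angle changes the field only in the
  -- radial direction.
  have hang : D (r • w) = (r * s * deriv (radialPart Q) z) • u := by
    have h1 := hasDerivAt_polarPt (N := N) (θ := fun θ => θ) (s := fun _ => s) hs (hasDerivAt_id z)
      (hasDerivAt_const z s)
    have h2 := hFd.comp_hasDerivAt z h1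
    have h3 : HasDerivAt (fun θ => F (polarPt N θ s)) ((r * s * deriv (radialPart Q) z) • u) z := by
      have dL := (dA.const_mul s).const_add lam
      rw [← hasDerivWithinAt_univ, hasDerivWithinAt_plane_iff]
      intro i
      rw [hasDerivWithinAt_univ]
      fin_cases i
      · have := ((dL.mul (Real.hasDerivAt_cos z)).sub
          ((dB.const_mul s).mul (Real.hasDerivAt_sin z))).const_mul r
        convert! this using 1
        · funext θ
          simp [hform θ s hs, hr]
        · simp [hu, hB, hrad]
          ring
      · have := ((dL.mul (Real.hasDerivAt_sin z)).add
          ((dB.const_mul s).mul (Real.hasDerivAt_cos z))).const_mul r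
        convert! this using 1
        · funext θ
          simp [hform θ s hs, hr]
        · simp [hu, hB, hrad]
          ring
    have h4 := h2.unique h3
    rw [← h4]
    congr 1
    ext i
    fin_cases i <;> simp [hw, hr]
  -- The radial direction is an eigenvector, with nonzero image because `A ≠ 0`.
  have hradial : D ((r / (N * s)) • u) = (r * radialPart Q z) • u := by
    have h1 := hasDerivAt_polarPt (N := N) (θ := fun _ => z) (s := fun t => t) (τ := s) hs
      (hasDerivAt_const s z) (hasDerivAt_id s)
    have h2 := hFd.comp_hasDerivAt s h1
    have h3 : HasDerivAt (fun t => F (polarPt N z t)) ((r * radialPart Q z) • u) s := by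
      have dr : HasDerivAt (fun t : ℝ => t ^ ((N : ℝ)⁻¹)) (1 * (N : ℝ)⁻¹ * s ^ ((N : ℝ)⁻¹ - 1)) s :=
        (hasDerivAt_id s).rpow_const (Or.inl hs.ne')
      have dl := ((hasDerivAt_id s).mul_const (radialPart Q z)).const_add lam
      have hev : ∀ᶠ t in 𝓝 s, 0 < t := lt_mem_nhds hs
      rw [← hasDerivWithinAt_univ, hasDerivWithinAt_plane_iff]
      intro i
      rw [hasDerivWithinAt_univ]
      fin_cases i
      · have := (dr.mul dl).mul_const (Real.cos z)
        refine HasDerivAt.congr_of_eventuallyEq (f := fun t : ℝ =>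
          t ^ ((N : ℝ)⁻¹) * (lam + t * radialPart Q z) * Real.cos z) ?_ ?_
        · convert! this using 1
          simp [hu, hrad, hr]
        · filter_upwards [hev] with t ht
          simp [hform z t ht, hB]
          ring
      · have := (dr.mul dl).mul_const (Real.sin z)
        refine HasDerivAt.congr_of_eventuallyEq (f := fun t : ℝ =>
          t ^ ((N : ℝ)⁻¹) * (lam + t * radialPart Q z) * Real.sin z) ?_ ?_
        · convert! this using 1
          simp [hu, hrad, hr]
        · filter_upwards [hev] with t ht
          simp [hform z t ht, hB]
          ring
    have h4 := h2.unique h3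
    rw [← h4]
    congr 1
    ext i
    fin_cases i <;> simp [hu, hr] <;> field_simp
  -- Both images are multiples of `u`; the coefficient `e` cancels them and gives a kernel vector,
  -- hence the eigenvalue `0`.
  set e := s * deriv (radialPart Q) z / radialPart Q z with he
  set k : Plane := r • w - e • ((r / (N * s)) • u) with hk
  have hDk : D k = 0 := by
    rw [hk, map_sub, map_smul D e, hang, hradial, smul_smul, ← sub_smul, he]
    rw [show r * s * deriv (radialPart Q) z -
      s * deriv (radialPart Q) z / radialPart Q z * (r * radialPart Q z) = 0 by field_simp; ring,
      zero_smul]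
  have hk0 : k ≠ 0 := by
    intro h
    have h0 : k 0 = 0 := by rw [h]; rfl
    have h1 : k 1 = 0 := by rw [h]; rfl
    simp [hk, hu, hw] at h0 h1
    have : r = 0 := by
      linear_combination (-Real.sin z) * h0 + Real.cos z * h1 - r * Real.sin_sq_add_cos_sq z
    exact hr0.ne' this
  have heig : Module.End.HasEigenvalue (D.toLinearMap : Module.End ℝ Plane) 0 :=
    Module.End.hasEigenvalue_of_hasEigenvector (x := k)
      ⟨Module.End.mem_eigenspace_iff.2 (by simpa using hDk), hk0⟩
  have hroot := (Module.End.hasEigenvalue_iff_isRoot_charpoly _ _).1 heig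
  refine hyp.2 0 ?_ rfl
  have := hroot.map (f := algebraMap ℝ ℂ)
  simpa using this

theorem _root_.signs_of_deriv_ne_zero {f : ℝ → ℝ} {z : ℝ} (hz : f z = 0) (hd : deriv f z ≠ 0) :
    ((∀ᶠ x in 𝓝[>] z, 0 < f x) ∧ ∀ᶠ x in 𝓝[<] z, f x < 0) ∨
      ((∀ᶠ x in 𝓝[>] z, f x < 0) ∧ ∀ᶠ x in 𝓝[<] z, 0 < f x) := by
  rcases lt_or_gt_of_ne hd with hd | hd
  · have h1 := eventually_nhdsWithin_sign_eq_of_deriv_neg hd hz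
    refine Or.inr ⟨?_, ?_⟩
    · filter_upwards [nhdsWithin_le_nhds h1, self_mem_nhdsWithin] with x hx (hxz : z < x)
      rwa [sign_neg (sub_neg.2 hxz), sign_eq_neg_one_iff] at hx
    · filter_upwards [nhdsWithin_le_nhds h1, self_mem_nhdsWithin] with x hx (hxz : x < z)
      rwa [sign_pos (sub_pos.2 hxz), sign_eq_one_iff] at hx
  · have h1 := eventually_nhdsWithin_sign_eq_of_deriv_pos hd hz
    refine Or.inl ⟨?_, ?_⟩
    · filter_upwards [nhdsWithin_le_nhds h1, self_mem_nhdsWithin] with x hx (hxz : z < x)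
      rwa [sign_pos (sub_pos.2 hxz), sign_eq_one_iff] at hx
    · filter_upwards [nhdsWithin_le_nhds h1, self_mem_nhdsWithin] with x hx (hxz : x < z)
      rwa [sign_neg (sub_neg.2 hxz), sign_eq_neg_one_iff] at hx

end StarField


end

/-! ### The main theorem -/

theorem mainTheorem10 (n : ℕ) (hn : 1 < n) (Q : Fin 2 → MvPolynomial (Fin 2) ℝ)
    (hQ : ∀ i, (Q i).IsHomogeneous n) (hcontr : IsContracting Q)
    (lam : ℝ) (hlam : 0 < lam) (hfin : (equilibria (starField lam Q)).Finite) :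
    -- whenever there are equilibria other than the origin, the policycle exists and is unique
    ((equilibria (starField lam Q) \ {0}).Nonempty →
      ∃! S : Set Plane, IsPolicycle (starField lam Q) S ∧ (0 : Plane) ∉ S) ∧
    (∀ S : Set Plane, IsPolicycle (starField lam Q) S → (0 : Plane) ∉ S →
      equilibria (starField lam Q) \ {0} ⊆ S) ∧
    -- all equilibria hyperbolic
    ((∀ p ∈ equilibria (starField lam Q), IsHyperbolicEquilibrium (starField lam Q) p) →
      4 ∣ (equilibria (starField lam Q) \ {0}).ncard ∧
      (∀ p ∈ equilibria (starField lam Q) \ {0},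
        IsSink (starField lam Q) p ∨ IsSaddle (starField lam Q) p) ∧
      (∀ S : Set Plane, IsPolicycle (starField lam Q) S → (0 : Plane) ∉ S →
        AlternateOn S {p | IsSink (starField lam Q) p} {p | IsSaddle (starField lam Q) p})) ∧
    -- classification of the equilibria in general
    (∀ p ∈ equilibria (starField lam Q) \ {0},
      IsSink (starField lam Q) p ∨ IsSaddle (starField lam Q) p ∨
        IsSaddleNode (starField lam Q) p) ∧
    -- alternating positions in general
    (∀ S : Set Plane, IsPolicycle (starField lam Q) S → (0 : Plane) ∉ S →
      AlternateOn S {p | IsSink (starField lam Q) p} {p | IsSaddle (starField lam Q) p}) := by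
  obtain ⟨N, rfl⟩ : ∃ N, n = N + 1 := ⟨n - 1, by omega⟩
  have hN : N ≠ 0 := by omega
  have hodd := StarField.odd_degree hQ hcontr
  obtain ⟨M, hMN, hMh⟩ := StarField.exists_polarModel hN hQ hcontr hlam
  have hNA : ∀ θ, 0 < N * -StarField.radialPart Q θ := fun θ =>
    mul_pos (by exact_mod_cast Nat.pos_of_ne_zero hN)
      (neg_pos.2 (StarField.radialPart_neg hcontr θ))
  have halt : ∀ S : Set Plane, IsPolicycle (starField lam Q) S → (0 : Plane) ∉ S →
      AlternateOn S {p | IsSink (starField lam Q) p} {p | IsSaddle (starField lam Q) p} := by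
    intro S hS h0
    rw [M.policycle_eq_cycle hS h0]
    exact M.alternateOn_cycle hfin
  refine ⟨fun hne => ⟨M.cycle, ⟨M.isPolicycle_cycle hfin hne, M.zero_notMem_cycle⟩,
    fun S hS => M.policycle_eq_cycle hS.1 hS.2⟩, fun S hS h0 => ?_, fun hyp => ?_, ?_, halt⟩
  · rw [M.policycle_eq_cycle hS h0]
    exact M.equilibria_subset_cycle
  · have hsign : ∀ z, M.h z = 0 →
        ((∀ᶠ x in 𝓝[>] z, 0 < M.h x) ∧ ∀ᶠ x in 𝓝[<] z, M.h x < 0) ∨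
          ((∀ᶠ x in 𝓝[>] z, M.h x < 0) ∧ ∀ᶠ x in 𝓝[<] z, 0 < M.h x) := by
      intro z hz
      have hp := hyp _ (M.F_pt_eq_zero_iff.2 hz)
      rw [PolarModel.pt, hMN] at hp
      have hd := StarField.deriv_angularPart_ne_zero hN hQ hcontr lam (M.sstar_add_zero_pos z) hp
      have hB : StarField.angularPart Q z = 0 := by
        rw [hMh] at hz
        exact (div_eq_zero_iff.1 hz).resolve_right (hNA z).ne'
      -- The denominator of `h` is positive, so `h` inherits the sign changes of the angular part.
      have hpos : ∀ x, 0 < M.h x ↔ 0 < StarField.angularPart Q x := fun x => by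
        rw [hMh]
        exact div_pos_iff_of_pos_right (hNA x)
      have hneg : ∀ x, M.h x < 0 ↔ StarField.angularPart Q x < 0 := fun x => by
        rw [hMh]
        simp only [div_lt_iff₀ (hNA x), zero_mul]
      simp only [hpos, hneg]
      exact signs_of_deriv_ne_zero hB hd
    refine ⟨M.four_dvd_ncard hfin (fun θ => ?_) hsign, ?_, halt⟩
    · simp only [hMh, StarField.radialPart_add_pi hQ hodd, StarField.angularPart_add_pi hQ hodd]
    · rintro p ⟨hp, hp0⟩
      obtain ⟨z, hz, rfl⟩ := M.exists_pt_of_equilibrium hp0 hp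
      rcases hsign z hz with ⟨hR, hL⟩ | ⟨hR, hL⟩
      · exact Or.inr (M.isSaddle_of_signs hz hR hL)
      · exact Or.inl (M.isSink_of_signs hz hR hL)
  · rintro p ⟨hp, hp0⟩
    obtain ⟨z, hz, rfl⟩ := M.exists_pt_of_equilibrium hp0 hp
    exact M.classification hfin hz
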